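/- Let $L$ be a nonempty oriented link in $\mathbb R^3$ whose components carry labels in $\{1,\dots,n\}$ (an $n$-labelled link), given by a link diagram up to planar isotopy and Reidemeister moves. Conway potential function. Let $\mathcal L$ be a connected diagram of $L$ with crossings $c_1,\dots,c_m$ in which every arc (from undercrossing to undercrossing) starts at a crossing, and let $x_i$ be the arc starting at $c_i$. Let $x_j$ be the arc passing over at $c_i$ and $x_k$ the arc ending at $c_i$; put $r_i=x_jx_ix_j^{-1}x_k^{-1}$ if $c_i$ is positive and $r_i=x_ix_jx_k^{-1}x_j^{-1}$ if $c_i$ is negative (the Wirtinger relator read anticlockwise around $c_i$, starting in the region to the right of both strands). Let $\varphi$ be the ring homomorphism sending an arc with label $g$ to $t_g$, let $M=(\varphi(\partial r_i/\partial x_j))_{i,j}$ be the Jacobian of Fox derivatives, and let $D^{(ij)}$ be the determinant of $M$ with row $i$ and column $j$ deleted. Let $w_i$ be the word read along a path from the unbounded region to the region to the right of both strands at $c_i$ (a letter $x$ for crossing the arc $x$ from its right to its left, $x^{-1}$ for the opposite direction), let $\kappa_g$ be the rotation number of the sublink labelled $g$, and let $\nu_g$ be the number of crossings whose over-strand is labelled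 $g$. Put $$\nabla_n(L;t_1,\dots,t_n)=\frac{(-1)^{i+j}D^{(ij)}}{\varphi(w_i)\,(\varphi(x_j)-1)}\prod_{g=1}^n t_g^{(\kappa_g-\nu_g)/2}.$$ Let $\nabla_n(L)=\nabla_n(L;e^{h_1},\dots,e^{h_n})$, with $t_g^{1/2}=e^{h_g/2}$, regarded as an element of the fraction field of $\mathbb Q[[h_1,\dots,h_n]]$. For a formal Laurent series $f$ in $h_1,\dots,h_n$ let $c_{p_1,\dots,p_n}(f)$ be the coefficient of $h_1^{p_1}\cdots h_n^{p_n}$ ($p_i\in\mathbb Z$), and for $p\in\mathbb Z$ let $C_p(f)$ be the part of $f$ of total degree $p$. Vassiliev invariants. An invariant $v$ of $n$-labelled links with values in an abelian group is extended to singular links (with finitely many transverse double points) by $v(\text{double point})=v(\text{positive crossing})-v(\text{negative crossing})$, applied at every double point. It is a Vassiliev invariant of type $d\in\mathbb Z$ if it vanishes on all singular links with more than $d$ double points. Lemma. Every $n$-labelled link has a diagram $\mathcal L$ as above, and $\nabla_n(L)$ does not depend on the choice of $\mathcal L$, $i$ and $j$, so it is an invariant of the labelled link; it has a Laurent expansion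 in $h_1,\dots,h_n$. For all $p_1,\dots,p_n\in\mathbb Z$ the coefficient $c_{p_1,\dots,p_n}(\nabla_n(L))$ is a Vassiliev invariant of type $\sum_{i=1}^n p_i+1$. For every $p\in\mathbb Z$ the total-degree-$p$ part $C_p(\nabla_n(L))$ is a Vassiliev invariant of type $p+1$. -/

import Mathlib

/-! Labelled oriented links are presented by link diagrams in Morse position, cut into horizontal
slices each of which contains one minimum, one maximum or one crossing.  Links are diagrams up to
planar isotopy and the Reidemeister moves. -/

namespace Conway

/-! ### Diagrams -/

/-- A strand meeting a horizontal line: its label, and whether it is oriented upwards. -/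
abbrev Strand (n : ℕ) := Fin n × Bool

/-- The elementary pieces of a diagram; `X` is the type of decorations of a crossing. -/
inductive Piece (n : ℕ) (X : Type) : Type
  /-- A minimum labelled `g`; its left leg is oriented upwards iff `d = true`. -/
  | cup (g : Fin n) (d : Bool) : Piece n X
  /-- A maximum. -/
  | cap : Piece n X
  /-- A crossing of two adjacent strands. -/
  | cross (x : X) : Piece n X

namespace Piece
variable {n : ℕ} {X Y : Type}

/-- Number of strands entering a piece from below. -/
def inWidth : Piece n X → ℕ
  | cup _ _ => 0
  | cap => 2
  | cross _ => 2

/-- Number of strands leaving a piece at the top. -/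
def outWidth : Piece n X → ℕ
  | cup _ _ => 2
  | cap => 0
  | cross _ => 2

/-- The decoration of the piece, if it is a crossing. -/
def crossType : Piece n X → Option X
  | cup _ _ => none
  | cap => none
  | cross x => some x

/-- Change the decoration of crossings. -/
def map (f : X → Y) : Piece n X → Piece n Y
  | cup g d => cup g d
  | cap => cap
  | cross x => cross (f x)

end Piece

/-- A horizontal slice: a piece with exactly `pos` vertical strands to its left. -/
structure Slice (n : ℕ) (X : Type) where
  pos : ℕ
  piece : Piece n X

variable {n : ℕ} {X Y : Type}

/-- The strands above a slice, given those below it (listed from left to right); `none` if the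
slice does not fit. -/
def Slice.apply : Slice n X → List (Strand n) → Option (List (Strand n))
  | ⟨i, .cup g d⟩, s =>
      if i ≤ s.length then some (s.take i ++ (g, d) :: (g, !d) :: s.drop i) else none
  | ⟨i, .cap⟩, s =>
      match s.drop i with
      | a :: b :: r => if a.1 = b.1 ∧ a.2 ≠ b.2 then some (s.take i ++ r) else none
      | _ => none
  | ⟨i, .cross _⟩, s =>
      match s.drop i with
      | a :: b :: r => some (s.take i ++ b :: a :: r)
      | _ => none

/-- The strands above a stack of slices (listed from bottom to top). -/
def run : List (Slice n X) → List (Strand n) → Option (List (Strand n))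
  | [], s => some s
  | c :: w, s => (c.apply s).bind (run w)

/-- A nonempty closed oriented diagram, with components labelled by `Fin n` and crossings
decorated by `X`; its slices are listed from bottom to top. -/
structure Diagram (n : ℕ) (X : Type) where
  word : List (Slice n X)
  nonempty : word ≠ []
  closed : run word [] = some []

/-- A diagram of a labelled oriented link. The decoration of a crossing is `true` iff the line
from bottom left to top right passes over the line from bottom right to top left. -/
abbrev LinkDiagram (n : ℕ) := Diagram n Bool

/-- A diagram of a labelled oriented singular link: a crossing is either decorated as in a link
diagram, or it is a double point `none`. -/
abbrev SingularDiagram (n : ℕ) := Diagram n (Option Bool)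

/-! ### Links -/

/-- The local moves: planar isotopies and Reidemeister moves for diagrams in Morse position. -/
inductive Move : List (Slice n Bool) → List (Slice n Bool) → Prop
  /-- Two pieces beside each other may change their heights. -/
  | far (i r : ℕ) (A B : Piece n Bool) :
      Move [⟨i, A⟩, ⟨i + A.outWidth + r, B⟩] [⟨i + A.inWidth + r, B⟩, ⟨i, A⟩]
  /-- Straightening a strand. -/
  | zigzagRight (i : ℕ) (g : Fin n) (d : Bool) : Move [⟨i, .cup g d⟩, ⟨i + 1, .cap⟩] []
  | zigzagLeft (i : ℕ) (g : Fin n) (d : Bool) : Move [⟨i + 1, .cup g d⟩, ⟨i, .cap⟩] []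
  /-- Moving a strand over or under a minimum or a maximum. -/
  | slideCup (i : ℕ) (g : Fin n) (d x : Bool) :
      Move [⟨i, .cup g d⟩, ⟨i + 1, .cross x⟩] [⟨i + 1, .cup g d⟩, ⟨i, .cross (!x)⟩]
  | slideCap (i : ℕ) (x : Bool) :
      Move [⟨i + 1, .cross x⟩, ⟨i, .cap⟩] [⟨i, .cross (!x)⟩, ⟨i + 1, .cap⟩]
  /-- First Reidemeister move. -/
  | kinkCup (i : ℕ) (g : Fin n) (d x : Bool) :
      Move [⟨i, .cup g d⟩, ⟨i, .cross x⟩] [⟨i, .cup g (!d)⟩]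
  | kinkCap (i : ℕ) (x : Bool) : Move [⟨i, .cross x⟩, ⟨i, .cap⟩] [⟨i, .cap⟩]
  /-- Second Reidemeister move. -/
  | cancel (i : ℕ) (x : Bool) : Move [⟨i, .cross x⟩, ⟨i, .cross (!x)⟩] []
  /-- Third Reidemeister move. The condition on the decorations says that the three strands lie
  at three different heights. -/
  | braid (i : ℕ) (x y z : Bool) (h : y = x ∨ y = z) :
      Move [⟨i, .cross x⟩, ⟨i + 1, .cross y⟩, ⟨i, .cross z⟩]
        [⟨i + 1, .cross z⟩, ⟨i, .cross y⟩, ⟨i + 1, .cross x⟩]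

/-- Two link diagrams differ by one local move. -/
def LinkDiagram.MoveStep (D E : LinkDiagram n) : Prop :=
  ∃ a b l r : List (Slice n Bool), Move l r ∧ D.word = a ++ l ++ b ∧ E.word = a ++ r ++ b

/-- Labelled oriented links: diagrams modulo the equivalence relation generated by the moves. -/
def Link (n : ℕ) := Quot (LinkDiagram.MoveStep (n := n))

/-- The link presented by a diagram. -/
def Link.mk (D : LinkDiagram n) : Link n := Quot.mk _ D

/-! ### Strands and crossings of a diagram -/

namespace Diagram

/-- The strands at level `k`, that is, below slice number `k`. -/
def state (D : Diagram n X) (k : ℕ) : List (Strand n) := (run (D.word.take k) []).getD []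

/-- The label of the strand through the point `(k, p)`: level `k`, position `p` from the left
(counted from `0`). -/
def labelAt (D : Diagram n X) (q : ℕ × ℕ) : Option (Fin n) := ((D.state q.1)[q.2]?).map Prod.fst

/-- Whether the strand through a point is oriented upwards. -/
def upAt (D : Diagram n X) (q : ℕ × ℕ) : Bool := (((D.state q.1)[q.2]?).map Prod.snd).getD true

/-- The point `(k, p)` lies on the diagram. -/
def IsPoint (D : Diagram n X) (q : ℕ × ℕ) : Prop :=
  q.1 ≤ D.word.length ∧ q.2 < (D.state q.1).length

/-- The crossings of a diagram, indexed by the numbers of their slices. -/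
abbrev Crossing (D : Diagram n X) :=
  {k : Fin D.word.length // (D.word[k].piece.crossType).isSome = true}

/-- The level just below a crossing. -/
def Crossing.level {D : Diagram n X} (c : D.Crossing) : ℕ := c.1

/-- The number of strands to the left of a crossing. -/
def Crossing.pos {D : Diagram n X} (c : D.Crossing) : ℕ := D.word[c.1].pos

/-- The decoration of a crossing. -/
def Crossing.type {D : Diagram n X} (c : D.Crossing) : X := Option.get _ c.2

end Diagram

/-! ### Singular links and Vassiliev invariants -/

theorem Slice.apply_map (f : X → Y) (c : Slice n X) (s : List (Strand n)) :
    Slice.apply ⟨c.pos, c.piece.map f⟩ s = c.apply s := by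
  obtain ⟨i, _ | _ | _⟩ := c <;> rfl

theorem run_mapIdx (w : List (Slice n X)) (f : ℕ → Slice n X → X → Y) (s : List (Strand n)) :
    run (w.mapIdx fun k c => (⟨c.pos, c.piece.map (f k c)⟩ : Slice n Y)) s = run w s := by
  induction w generalizing f s with
  | nil => rfl
  | cons c w ih =>
    simp only [List.mapIdx_cons, run, Slice.apply_map]
    congr 1
    funext t
    exact ih (fun k => f (k + 1)) t

namespace Diagram

/-- The double points of a singular diagram, indexed by the numbers of their slices. -/
def doublePoints (S : SingularDiagram n) : Finset ℕ :=
  (Finset.range S.word.length).filter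
    fun k => (S.word[k]?).bind (fun c => c.piece.crossType) = some none

/-- Replace the double points in `A` by positive crossings and the others by negative ones.
A crossing whose strands are both upward or both downward is positive iff the line from bottom
left to top right passes over; otherwise it is positive iff that line passes under. -/
def resolve (S : SingularDiagram n) (A : Finset ℕ) : LinkDiagram n where
  word := S.word.mapIdx fun k c =>
    ⟨c.pos, c.piece.map fun x =>
      x.getD ((S.upAt (k, c.pos) == S.upAt (k, c.pos + 1)) == decide (k ∈ A))⟩
  nonempty := by
    intro h
    exact S.nonempty (by simpa using h)
  closed := by
    rw [run_mapIdx S.word (fun k c x =>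
      x.getD ((S.upAt (k, c.pos) == S.upAt (k, c.pos + 1)) == decide (k ∈ A)))]
    exact S.closed

end Diagram

/-- The value on a singular link of the extension of a link invariant by
`v(double point) = v(positive crossing) - v(negative crossing)`. -/
def singularExtension {A : Type*} [AddCommGroup A] (v : Link n → A) (S : SingularDiagram n) : A :=
  ∑ P ∈ S.doublePoints.powerset,
    ((-1 : ℤ) ^ (S.doublePoints \ P).card) • v (Link.mk (S.resolve P))

/-- `v` is a Vassiliev invariant of type `d`: it vanishes on all singular links with more than
`d` double points. -/
def IsVassilievOfType {A : Type*} [AddCommGroup A] (v : Link n → A) (d : ℤ) : Prop :=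
  ∀ S : SingularDiagram n, d < (S.doublePoints.card : ℤ) → singularExtension v S = 0

/-! ### Fox calculus -/

/-- The Fox derivative with respect to the letter `a`, of a word in the letters and their
inverses. -/
noncomputable def foxWord {α : Type} (a : α) :
    List (α × Bool) → MonoidAlgebra ℤ (FreeGroup α)
  | [] => 0
  | (b, true) :: w =>
      (open Classical in if b = a then 1 else 0) +
        MonoidAlgebra.of ℤ _ (FreeGroup.of b) * foxWord a w
  | (b, false) :: w =>
      MonoidAlgebra.of ℤ _ (FreeGroup.of b)⁻¹ *
        (foxWord a w - open Classical in if b = a then 1 else 0)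

theorem foxWord_step {α : Type} (a : α) {w v : List (α × Bool)} (h : FreeGroup.Red.Step w v) :
    foxWord a w = foxWord a v := by
  obtain @⟨L₁, L₂, b, e⟩ := h
  induction L₁ with
  | nil =>
    cases e
    · simp [foxWord, ← mul_assoc, ← MonoidAlgebra.one_def]
    · simp [foxWord, ← mul_assoc, ← MonoidAlgebra.one_def]
  | cons c L ih =>
    obtain ⟨c, _ | _⟩ := c <;> simp [foxWord, ih]

/-- The Fox derivative `∂/∂a` of an element of the free group. -/
noncomputable def foxDeriv {α : Type} (a : α) :
    FreeGroup α → MonoidAlgebra ℤ (FreeGroup α) :=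
  Quot.lift (foxWord a) fun _ _ h => foxWord_step a h

/-! ### The Conway potential function -/

namespace LinkDiagram
open Diagram

/-- Two points are joined by a piece of strand inside one slice, which does not pass under a
crossing. -/
inductive Joined (D : LinkDiagram n) : ℕ × ℕ → ℕ × ℕ → Prop
  | left (k p : ℕ) (c : Slice n Bool) (hc : D.word[k]? = some c) (hp : p < c.pos) :
      Joined D (k, p) (k + 1, p)
  | right (k p : ℕ) (c : Slice n Bool) (hc : D.word[k]? = some c) :
      Joined D (k, c.pos + c.piece.inWidth + p) (k + 1, c.pos + c.piece.outWidth + p)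
  | cup (k i : ℕ) (g : Fin n) (d : Bool) (hc : D.word[k]? = some ⟨i, .cup g d⟩) :
      Joined D (k + 1, i) (k + 1, i + 1)
  | cap (k i : ℕ) (hc : D.word[k]? = some ⟨i, .cap⟩) : Joined D (k, i) (k, i + 1)
  | overRight (k i : ℕ) (hc : D.word[k]? = some ⟨i, .cross true⟩) :
      Joined D (k, i) (k + 1, i + 1)
  | overLeft (k i : ℕ) (hc : D.word[k]? = some ⟨i, .cross false⟩) :
      Joined D (k, i + 1) (k + 1, i)

/-- Two points are joined inside one slice of the underlying planar graph of the diagram. -/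
inductive Touch (D : LinkDiagram n) : ℕ × ℕ → ℕ × ℕ → Prop
  | strand (q r : ℕ × ℕ) (h : D.Joined q r) : Touch D q r
  | crossRight (k i : ℕ) (x : Bool) (hc : D.word[k]? = some ⟨i, .cross x⟩) :
      Touch D (k, i) (k + 1, i + 1)
  | crossLeft (k i : ℕ) (x : Bool) (hc : D.word[k]? = some ⟨i, .cross x⟩) :
      Touch D (k, i + 1) (k + 1, i)
  | crossPoint (k i : ℕ) (x : Bool) (hc : D.word[k]? = some ⟨i, .cross x⟩) :
      Touch D (k, i) (k, i + 1)

/-- The arcs of a diagram, from undercrossing to undercrossing, as classes of points.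
(A pair `(k, p)` that is not a point of the diagram is never identified with a point of it.) -/
def Arc (D : LinkDiagram n) := Quot D.Joined

/-- The arc through a point. -/
def arc (D : LinkDiagram n) (q : ℕ × ℕ) : D.Arc := Quot.mk _ q

end LinkDiagram

theorem run_append (u w : List (Slice n X)) (s : List (Strand n)) :
    run (u ++ w) s = (run u s).bind (run w) := by
  induction u generalizing s with
  | nil => rfl
  | cons c u ih =>
    simp only [List.cons_append, run]
    cases c.apply s with
    | none => rfl
    | some t => exact ih t

theorem Diagram.apply_state (D : Diagram n X) (k : ℕ) (c : Slice n X)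
    (hc : D.word[k]? = some c) : c.apply (D.state k) = some (D.state (k + 1)) := by
  have h1 : D.word.take (k + 1) = D.word.take k ++ [c] := by
    rw [List.take_add_one, hc]; rfl
  have h2 : (run (D.word.take (k + 1)) []).bind (run (D.word.drop (k + 1))) = some [] := by
    rw [← run_append, List.take_append_drop, D.closed]
  have h3 : run (D.word.take (k + 1)) [] = (run (D.word.take k) []).bind c.apply := by
    rw [h1, run_append]
    congr 1
    funext s
    simp [run]
  simp only [Diagram.state]
  cases hk : run (D.word.take k) [] with
  | none => rw [h3, hk] at h2; simp at h2
  | some s =>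
    rw [hk] at h3
    cases hk' : run (D.word.take (k + 1)) [] with
    | none => rw [hk'] at h2; simp at h2
    | some t => rw [hk'] at h3; simpa using h3.symm

theorem LinkDiagram.label_eq (D : LinkDiagram n) (q r : ℕ × ℕ) (h : D.Joined q r) :
    D.labelAt q = D.labelAt r := by
  have key : ∀ (c : Slice n Bool) (s t : List (Strand n)), c.apply s = some t →
      (∀ p < c.pos, s[p]? = t[p]?) ∧
      (∀ p, s[c.pos + c.piece.inWidth + p]? = t[c.pos + c.piece.outWidth + p]?) ∧
      (∀ g d, c.piece = .cup g d → (t[c.pos]?).map Prod.fst = (t[c.pos + 1]?).map Prod.fst) ∧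
      (c.piece = .cap → (s[c.pos]?).map Prod.fst = (s[c.pos + 1]?).map Prod.fst) ∧
      (∀ x, c.piece = .cross x → s[c.pos]? = t[c.pos + 1]? ∧ s[c.pos + 1]? = t[c.pos]?) := by
    rintro ⟨i, _ | _ | _⟩ s t h
    · simp only [Slice.apply] at h
      split at h <;> simp_all only [Option.some.injEq, reduceCtorEq]
      subst h
      simp only [Piece.inWidth, Piece.outWidth]
      refine ⟨fun p hp => ?_, fun p => ?_, fun g d _ => ?_, by simp, by simp⟩ <;> grind
    · simp only [Slice.apply] at h
      split at h
      · rename_i a b r hs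
        split at h <;> simp_all only [Option.some.injEq, reduceCtorEq]
        have hs' : s = s.take i ++ a :: b :: r := by rw [← hs, List.take_append_drop]
        have hl : (s.take i).length = i := by
          have := congrArg List.length hs
          simp at this ⊢
          omega
        generalize s.take i = u at *
        subst hs' h
        simp only [Piece.inWidth, Piece.outWidth]
        refine ⟨fun p hp => ?_, fun p => ?_, by simp, fun _ => ?_, by simp⟩ <;> grind
      · simp at h
    · simp only [Slice.apply] at h
      split at h
      · rename_i a b r hs
        simp_all only [Option.some.injEq]
        have hs' : s = s.take i ++ a :: b :: r := by rw [← hs, List.take_append_drop]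
        have hl : (s.take i).length = i := by
          have := congrArg List.length hs
          simp at this ⊢
          omega
        generalize s.take i = u at *
        subst hs' h
        simp only [Piece.inWidth, Piece.outWidth]
        refine ⟨fun p hp => ?_, fun p => ?_, by simp, by simp, fun _ _ => ?_⟩ <;> grind
      · simp at h
  unfold Diagram.labelAt
  cases h with
  | left k p c hc hp =>
    exact congrArg _ ((key c _ _ (D.apply_state k c hc)).1 p hp)
  | right k p c hc =>
    exact congrArg _ ((key c _ _ (D.apply_state k c hc)).2.1 p)
  | cup k i g d hc =>
    exact (key _ _ _ (D.apply_state k _ hc)).2.2.1 g d rfl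
  | cap k i hc =>
    exact (key _ _ _ (D.apply_state k _ hc)).2.2.2.1 rfl
  | overRight k i hc =>
    exact congrArg _ ((key _ _ _ (D.apply_state k _ hc)).2.2.2.2 _ rfl).1
  | overLeft k i hc =>
    exact congrArg _ ((key _ _ _ (D.apply_state k _ hc)).2.2.2.2 _ rfl).2

namespace LinkDiagram
open Diagram

/-- The label of an arc. -/
def Arc.label {D : LinkDiagram n} : D.Arc → Option (Fin n) := Quot.lift D.labelAt D.label_eq

variable {D : LinkDiagram n}

/-! At a crossing, the line rising to the right joins the points `(c.level, c.pos)` and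
`(c.level + 1, c.pos + 1)`; the line rising to the left joins `(c.level, c.pos + 1)` and
`(c.level + 1, c.pos)`. -/

/-- The lower point of the line passing over. -/
def overPoint (c : D.Crossing) : ℕ × ℕ :=
  if c.type then (c.level, c.pos) else (c.level, c.pos + 1)

/-- The lower point of the line passing under. -/
def underLow (c : D.Crossing) : ℕ × ℕ :=
  if c.type then (c.level, c.pos + 1) else (c.level, c.pos)

/-- The upper point of the line passing under. -/
def underHigh (c : D.Crossing) : ℕ × ℕ :=
  if c.type then (c.level + 1, c.pos) else (c.level + 1, c.pos + 1)

/-- The arc passing over at a crossing. -/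
def overArc (c : D.Crossing) : D.Arc := D.arc (overPoint c)

/-- The arc starting at a crossing. -/
def startArc (c : D.Crossing) : D.Arc :=
  D.arc (if D.upAt (underLow c) then underHigh c else underLow c)

/-- The arc ending at a crossing. -/
def endArc (c : D.Crossing) : D.Arc :=
  D.arc (if D.upAt (underLow c) then underLow c else underHigh c)

/-- A crossing is positive. -/
def IsPositive (c : D.Crossing) : Prop :=
  c.type = (D.upAt (c.level, c.pos) == D.upAt (c.level, c.pos + 1))

/-- The Wirtinger relator, read anticlockwise from the region to the right of both strands. -/
noncomputable def relator (c : D.Crossing) : FreeGroup D.Arc :=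
  open Classical in
  if IsPositive c then
    FreeGroup.of (overArc c) * FreeGroup.of (startArc c) *
      (FreeGroup.of (overArc c))⁻¹ * (FreeGroup.of (endArc c))⁻¹
  else
    FreeGroup.of (startArc c) * FreeGroup.of (overArc c) *
      (FreeGroup.of (endArc c))⁻¹ * (FreeGroup.of (overArc c))⁻¹

/-- The word read from a path that starts at the far left and runs along level `k`, across the
first `r` strands. (Crossing a strand from its right to its left contributes its letter, crossing
it from its left to its right contributes the inverse of the letter.) -/
def pathWord (D : LinkDiagram n) (k r : ℕ) : FreeGroup D.Arc :=
  ((List.range r).map fun p =>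
    if D.upAt (k, p) then (FreeGroup.of (D.arc (k, p)))⁻¹ else FreeGroup.of (D.arc (k, p))).prod

/-- The word read from a path from the unbounded region to the region to the right of both strands
of a crossing. That region lies to the east, south, north or west of the crossing. -/
def baseWord (c : D.Crossing) : FreeGroup D.Arc :=
  match D.upAt (c.level, c.pos), D.upAt (c.level, c.pos + 1) with
  | true, true => D.pathWord c.level (c.pos + 2)
  | true, false => D.pathWord c.level (c.pos + 1)
  | false, true => D.pathWord (c.level + 1) (c.pos + 1)
  | false, false => D.pathWord c.level c.pos

/-- The rotation number of the sublink labelled `g`: the number of times that its tangent points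
due east, at minima (where it turns anticlockwise, `+1`) and at maxima (where it turns clockwise,
`-1`). -/
def rotation (D : LinkDiagram n) (g : Fin n) : ℤ :=
  ∑ k : Fin D.word.length,
    match D.word[k] with
    | ⟨_, .cup h d⟩ => if h = g ∧ d = false then 1 else 0
    | ⟨i, .cap⟩ => if D.labelAt (k, i) = some g ∧ D.upAt (k, i) = true then -1 else 0
    | ⟨_, .cross _⟩ => 0

/-- The number of crossings at which the line passing over is labelled `g`. -/
def overCount (D : LinkDiagram n) (g : Fin n) : ℕ :=
  (Finset.univ.filter fun c : D.Crossing => D.labelAt (overPoint c) = some g).card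

section Potential
variable {K : Type} [Field K] (s : Fin n → Kˣ)

/-- The abelianisation `φ`, sending an arc labelled `g` to `t_g = s_g ^ 2`. -/
noncomputable def abel (D : LinkDiagram n) : MonoidAlgebra ℤ (FreeGroup D.Arc) →ₐ[ℤ] K :=
  MonoidAlgebra.lift ℤ K (FreeGroup D.Arc)
    ((Units.coeHom K).comp
      (FreeGroup.lift fun a : D.Arc => a.label.elim 1 fun g => s g ^ 2))

/-- The Jacobian matrix `φ(∂ r_i / ∂ x_j)`; rows and columns are indexed by the crossings, the
letter `x_j` being the arc that starts at the crossing `j`. -/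
noncomputable def jacobian (D : LinkDiagram n) : Matrix D.Crossing D.Crossing K :=
  Matrix.of fun i j => D.abel s (foxDeriv (startArc j) (relator i))

/-- The potential function of a diagram computed with crossings `i` and `j`, at
`t_g = s_g ^ 2`. The entry `(j, i)` of the adjugate is `(-1) ^ (i + j)` times the determinant of
the Jacobian matrix without row `i` and column `j`. -/
noncomputable def potential (D : LinkDiagram n) (i j : D.Crossing) : K :=
  (D.jacobian s).adjugate j i /
      (D.abel s (MonoidAlgebra.of ℤ _ (baseWord i)) *
        (D.abel s (MonoidAlgebra.of ℤ _ (FreeGroup.of (startArc j))) - 1)) *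
    ((∏ g : Fin n, s g ^ (D.rotation g - (D.overCount g : ℤ)) : Kˣ) : K)

end Potential

/-- The diagrams used to compute the potential function: they are connected, and every arc starts
at a crossing. -/
structure Admissible (D : LinkDiagram n) : Prop where
  connected : ∀ q r : ℕ × ℕ, D.IsPoint q → D.IsPoint r → Relation.EqvGen D.Touch q r
  start : ∀ q : ℕ × ℕ, D.IsPoint q → ∃ c : D.Crossing, startArc c = D.arc q

end LinkDiagram

/-! ### Laurent expansion -/

/-- The field of fractions of the ring of formal power series in `h_1, …, h_n`. -/
abbrev SeriesField (n : ℕ) := FractionRing (MvPowerSeries (Fin n) ℚ)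

/-- The power series `exp (a h_g)`. -/
noncomputable def expSeries (a : ℚ) (g : Fin n) : MvPowerSeries (Fin n) ℚ :=
  PowerSeries.subst (MvPowerSeries.X g) (PowerSeries.rescale a (PowerSeries.exp ℚ))

theorem expSeries_mul (a b : ℚ) (g : Fin n) :
    expSeries a g * expSeries b g = expSeries (a + b) g := by
  unfold expSeries
  rw [← PowerSeries.subst_mul (PowerSeries.HasSubst.X g), PowerSeries.exp_mul_exp_eq_exp_add]

theorem expSeries_zero (g : Fin n) : expSeries 0 g = 1 := by
  have h : PowerSeries.rescale (0 : ℚ) (PowerSeries.exp ℚ) = 1 := by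
    rw [PowerSeries.rescale_zero]; simp
  rw [expSeries, h, ← PowerSeries.coe_substAlgHom (PowerSeries.HasSubst.X g), map_one]

/-- The series `exp (h_g / 2)`, a square root of `t_g = exp h_g`. -/
noncomputable def halfExp (g : Fin n) : (MvPowerSeries (Fin n) ℚ)ˣ where
  val := expSeries (1 / 2) g
  inv := expSeries (-(1 / 2)) g
  val_inv := by rw [expSeries_mul, add_neg_cancel, expSeries_zero]
  inv_val := by rw [expSeries_mul, neg_add_cancel, expSeries_zero]

/-- The element `t_g ^ (1/2) = exp (h_g / 2)` of the field. -/
noncomputable def sqrtExp (g : Fin n) : (SeriesField n)ˣ :=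
  Units.map (algebraMap (MvPowerSeries (Fin n) ℚ) (SeriesField n)) (halfExp g)

/-- The Conway potential function `∇(L; exp h_1, …, exp h_n)`: the common value of the potential
function of the admissible diagrams of `L`. -/
noncomputable def conwayPotential (L : Link n) : SeriesField n :=
  Classical.epsilon fun F =>
    ∃ (D : LinkDiagram n) (i j : D.Crossing), D.Admissible ∧ Link.mk D = L ∧
      F = D.potential sqrtExp i j

/-- `∑ c_p h^p` is a Laurent expansion of `F`: the exponents `p` are bounded below by some `-a`,
and `h^a F` is the power series `∑ c_p h^(p + a)`. -/
def IsLaurentExpansion (F : SeriesField n) (c : (Fin n → ℤ) → ℚ) : Prop :=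
  ∃ a : Fin n →₀ ℕ,
    (∀ p : Fin n → ℤ, c p ≠ 0 → ∀ g, -(a g : ℤ) ≤ p g) ∧
    algebraMap (MvPowerSeries (Fin n) ℚ) (SeriesField n) (MvPowerSeries.monomial a 1) * F =
      algebraMap (MvPowerSeries (Fin n) ℚ) (SeriesField n)
        (fun e : Fin n →₀ ℕ => c fun g => (e g : ℤ) - (a g : ℤ))

/-- The coefficients of the Laurent expansion. -/
noncomputable def laurentExpansion (F : SeriesField n) : (Fin n → ℤ) → ℚ :=
  Classical.epsilon (IsLaurentExpansion F)

/-- The part of total degree `m` of a formal Laurent series with coefficients `c`. -/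
def degreePart (m : ℤ) (c : (Fin n → ℤ) → ℚ) : (Fin n → ℤ) → ℚ :=
  fun p => if ∑ g, p g = m then c p else 0

end Conway

/-! The potential function is rebuilt as a state sum over the slices, in which both invariance and
the effect of a crossing change can be read off locally, and is then compared with the Fox
determinant.

State sum. A horizontal line carries the exterior algebra on its strands, written as functions of
occupation numbers. A minimum multiplies by the linear form of its relation, a maximum multiplies by
its form and extracts a top coefficient, and a crossing acts by the 2×2 minors of its two relations
(`kern`, `op`). Signs are taken relative to the configuration in which exactly the upward strands
are occupied; this makes distant pieces commute although minima and maxima are odd. The composite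
`opW` is unchanged by every local move (`Move.localEq`), by finite checks.

Determinant. Running the relations through the exterior algebra computes the determinant of the
matrix of all relations between edges, up to a sign due to the order of the columns. Running
simplified relations, which involve only the outgoing edge, gives the same sign times a product of
weights; the product of the two runs is the state sum (`exec_prog`, `exec_eq_det`, `det_coord_eq`).
The matrix is singular: its right kernel contains the values of the letters minus one (Fox's
fundamental formula), its left kernel the words read from the left edge (the redundancy of the
Wirtinger relations). Thus a closed diagram evaluates to zero, and all entries of the adjugate are
determined by one of them (`LinkDiagram.IsRows.adjugate`).

Cutting. The informative quantity is the value with the bottom minimum, labelled `g`, replaced by a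
coordinate form: it is an entry of the adjugate, and dividing it by `s g - (s g)⁻¹` gives
`LinkDiagram.conway`, which satisfies `LinkDiagram.IsRows.conway_eq` for every row and column. Moves
away from the bottom preserve it by local invariance. Only two moves can affect the bottom:
exchanging two minima amounts to choosing another entry of the adjugate (`conway_far`), and a kink
changes the cut state by a multiple of an uncut minimum, which closes up to zero (`cutValue_kink`).

Comparison. In an admissible diagram every edge is reached from the start of its arc, so the
relations along arcs form a unitriangular system. Eliminating them leaves the Jacobian of Fox
derivatives (`LinkDiagram.IsRows.adjugate_wirtinger`). The scaling factors of the rows multiply to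
the rotation and overcrossing powers, whence `LinkDiagram.Admissible.potential_eq`. Admissible
diagrams exist: after removing empty intermediate levels, every minimum but the lowest is tied to a
neighbouring strand by two cancelling crossings and every maximum receives a kink
(`Link.exists_admissible`).

Vassiliev property. With `s g = exp (h_g / 2)` the operators of the two crossings agree modulo the
ideal of series without constant term. An alternating sum over `k` double points therefore has cut
value in the `k`-th power of that ideal (`sum_resolveFrom_mem`). The divisor `s g - (s g)⁻¹` is
`h_g` times a unit, so the Laurent expansion exists, with at most a simple pole along `h_g`, and
exactly one degree is lost: coefficients of total degree below `k - 1` vanish. -/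

namespace Conway

/-! ### Fermionic operators of slices and of stacks of slices. -/

section Fock
variable {n : ℕ} {R : Type} [CommRing R]

/-- Sum over all lists of `k` bits. -/
def bitSum : ℕ → (List Bool → R) → R
  | 0, f => f []
  | k + 1, f => bitSum k (fun τ => f (false :: τ)) + bitSum k (fun τ => f (true :: τ))

theorem bitSum_congr {k : ℕ} {f g : List Bool → R} (h : ∀ τ, τ.length = k → f τ = g τ) :
    bitSum k f = bitSum k g := by
  induction k generalizing f g with
  | zero => exact h [] rfl
  | succ k ih =>
    simp only [bitSum]
    rw [ih fun τ hτ => h (false :: τ) (by simp [hτ]), ih fun τ hτ => h (true :: τ) (by simp [hτ])]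

theorem bitSum_add (k : ℕ) (f g : List Bool → R) :
    bitSum k (fun τ => f τ + g τ) = bitSum k f + bitSum k g := by
  induction k generalizing f g with
  | zero => rfl
  | succ k ih => simp only [bitSum, ih]; ring

theorem bitSum_mul_left (k : ℕ) (c : R) (f : List Bool → R) :
    bitSum k (fun τ => c * f τ) = c * bitSum k f := by
  induction k generalizing f with
  | zero => rfl
  | succ k ih => simp only [bitSum, ih]; ring

theorem bitSum_comm (k l : ℕ) (f : List Bool → List Bool → R) :
    bitSum k (fun τ => bitSum l fun τ' => f τ τ') = bitSum l fun τ' => bitSum k fun τ => f τ τ' := by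
  induction k generalizing f with
  | zero => rfl
  | succ k ih => simp only [bitSum, ih, bitSum_add]

theorem bitSum_map {S : Type} [CommRing S] (φ : R →+* S) (k : ℕ) (f : List Bool → R) :
    φ (bitSum k f) = bitSum k fun τ => φ (f τ) := by
  induction k generalizing f with
  | zero => rfl
  | succ k ih => simp only [bitSum, map_add, ih]

theorem bitSum_mem (I : Ideal R) {k : ℕ} {f : List Bool → R}
    (h : ∀ τ, τ.length = k → f τ ∈ I) : bitSum k f ∈ I := by
  induction k generalizing f with
  | zero => exact h [] rfl
  | succ k ih =>
    exact I.add_mem (ih fun τ hτ => h _ (by simp [hτ])) (ih fun τ hτ => h _ (by simp [hτ]))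

variable (s : Fin n → Rˣ)

/-- The square root of the image of the letter of a strand, read from left to right. -/
def hol (a : Strand n) : Rˣ := if a.2 then (s a.1)⁻¹ else s a.1

/-- The fermionic sign of moving an odd operator past the strands of a list. -/
def jw : List (Strand n) → List Bool → R
  | a :: l, b :: σ => (if a.2 = b then 1 else -1) * jw l σ
  | _, _ => 1

/-- The weight of a minimum. -/
def cupWt (g : Fin n) (d : Bool) : R := if d then 1 else ((s g)⁻¹ : Rˣ)

/-- The weight of a maximum with the given left leg. -/
def capWt (a : Strand n) : R := if a.2 then -(s a.1 : R) else 1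

/-- The sign of a crossing. -/
def crossSign (a b : Strand n) : R := if a.2 && b.2 then -1 else 1

/-- The weights of a crossing, for the occupation numbers of the lower and of the upper points. -/
def crossKern (x : Bool) (a b : Strand n) : List Bool → List Bool → R
  | [false, false], [false, false] => if x then hol s a else ((hol s b)⁻¹ : Rˣ)
  | [true, false], [false, true] => if x then hol s a else hol s b
  | [false, true], [true, false] => if x then ((hol s a)⁻¹ : Rˣ) else ((hol s b)⁻¹ : Rˣ)
  | [false, true], [false, true] => if x then -((hol s a)⁻¹ : Rˣ) * (1 - hol s b ^ 2) else 0
  | [true, false], [true, false] => if x then 0 else ((hol s b)⁻¹ : Rˣ) * (1 - hol s a ^ 2)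
  | [true, true], [true, true] => if x then -((hol s a)⁻¹ : Rˣ) else -(hol s b)
  | _, _ => 0

/-- The weights of a piece, for the occupation numbers of its lower and of its upper points;
the list of strands starts with those entering the piece. -/
def kern : Piece n Bool → List (Strand n) → List Bool → List Bool → R
  | .cup g d, _, τ, ω => match τ, ω with
    | [], [true, false] => cupWt s g d
    | [], [false, true] => cupWt s g d * hol s (g, d) ^ 2
    | _, _ => 0
  | .cap, l, τ, ω => match l with
    | a :: _ => match τ, ω with
      | [false, true], [] => capWt s a
      | [true, false], [] => -(capWt s a * hol s a ^ 2)
      | _, _ => 0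
    | _ => 0
  | .cross x, l, τ, ω => match l with
    | a :: b :: _ => crossSign a b * crossKern s x a b τ ω
    | _ => 0

/-- Minima and maxima are odd. -/
def jwDeg (P : Piece n Bool) (l : List (Strand n)) (σ : List Bool) : R :=
  if P.crossType.isSome then 1 else jw l σ

/-- The operator of a slice, on functions of the occupation numbers of a horizontal line. -/
def op (c : Slice n Bool) (st : List (Strand n)) (ψ : List Bool → R) (σ : List Bool) : R :=
  bitSum c.piece.inWidth fun τ =>
    jwDeg c.piece (st.take c.pos) (σ.take c.pos) *
      kern s c.piece (st.drop c.pos) τ ((σ.drop c.pos).take c.piece.outWidth) *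
      ψ (σ.take c.pos ++ τ ++ σ.drop (c.pos + c.piece.outWidth))

/-- The operator of a stack of slices. -/
def opW : List (Slice n Bool) → List (Strand n) → (List Bool → R) → List Bool → R
  | [], _, ψ => ψ
  | c :: w, st, ψ => opW w ((c.apply st).getD []) (op s c st ψ)

theorem op_eval (P : Piece n Bool) (su sw : List (Strand n)) (ψ : List Bool → R)
    (u ω v : List Bool) (hu : u.length = su.length) (hω : ω.length = P.outWidth) :
    op s ⟨su.length, P⟩ (su ++ sw) ψ (u ++ (ω ++ v)) =
      bitSum P.inWidth fun τ => jwDeg P su u * kern s P sw τ ω * ψ (u ++ (τ ++ v)) := by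
  unfold op
  apply bitSum_congr
  intro τ _
  have h1 : (u ++ (ω ++ v)).drop (su.length + P.outWidth) = v := by
    rw [← hu, ← hω, ← List.append_assoc, ← List.length_append, List.drop_left]
  simp only [List.take_left, List.drop_left, h1]
  rw [← hu, ← hω]
  simp

/-- Replaces case analysis on `Slice.apply` by a decomposition into the strands left of, at and
right of the piece. The clause over `su'` and `sv'` records that fitting depends only on the strands
at the piece; the far commutation needs it. -/
theorem apply_eq_some (c : Slice n Bool) (st t : List (Strand n)) (h : c.apply st = some t) :
    ∃ su si so sv, st = su ++ (si ++ sv) ∧ t = su ++ (so ++ sv) ∧ su.length = c.pos ∧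
      si.length = c.piece.inWidth ∧ so.length = c.piece.outWidth ∧
      (∀ su' sv', Slice.apply ⟨su'.length, c.piece⟩ (su' ++ (si ++ sv')) =
        some (su' ++ (so ++ sv'))) ∧
      (∀ g d, c.piece = .cup g d → so = [(g, d), (g, !d)]) ∧
      (c.piece = .cap → ∃ a : Strand n, si = [a, (a.1, !a.2)]) ∧
      (∀ x, c.piece = .cross x → ∃ a b, si = [a, b] ∧ so = [b, a]) := by
  obtain ⟨i, ⟨g, d⟩ | _ | x⟩ := c
  · simp only [Slice.apply] at h
    split at h
    · rename_i hi
      refine ⟨st.take i, [], [(g, d), (g, !d)], st.drop i, by simp, by simpa using h.symm,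
        by simpa using hi, rfl, rfl, ?_, by simp, by simp, by simp⟩
      intro su' sv'
      simp [Slice.apply]
    · simp at h
  · simp only [Slice.apply] at h
    split at h
    · rename_i a b r hr
      split at h
      · rename_i hab
        have hl := congrArg List.length hr
        simp at hl
        refine ⟨st.take i, [a, b], [], r, ?_, by simpa using h.symm, ?_, rfl, rfl, ?_, by simp,
          fun _ => ⟨a, ?_⟩, by simp⟩
        · simp [← hr]
        · simp; omega
        · intro su' sv'
          simp [Slice.apply, hab]
        · obtain ⟨a, a'⟩ := a
          obtain ⟨b, b'⟩ := b
          simp at hab ⊢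
          obtain ⟨rfl, h2⟩ := hab
          refine ⟨rfl, ?_⟩
          cases a' <;> cases b' <;> simp_all
      · simp at h
    · simp at h
  · simp only [Slice.apply] at h
    split at h
    · rename_i a b r hr
      have hl := congrArg List.length hr
      simp at hl
      refine ⟨st.take i, [a, b], [b, a], r, ?_, by simpa using h.symm, ?_, rfl, rfl, ?_, by simp,
        by simp, fun _ _ => ⟨a, b, rfl, rfl⟩⟩
      · simp [← hr]
      · simp; omega
      · intro su' sv'
        simp [Slice.apply]
    · simp at h

/-- States are functions on all lists of bits, but only lists of the right length have a meaning;
equality of states is always used in this restricted sense. -/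
theorem op_congr (c : Slice n Bool) (st t : List (Strand n)) (h : c.apply st = some t)
    {ψ ψ' : List Bool → R} (hψ : ∀ σ, σ.length = st.length → ψ σ = ψ' σ) (σ : List Bool)
    (hσ : σ.length = t.length) : op s c st ψ σ = op s c st ψ' σ := by
  obtain ⟨su, si, so, sv, rfl, rfl, hp, hi, ho, -⟩ := apply_eq_some c st t h
  unfold op
  apply bitSum_congr
  intro τ hτ
  congr 1
  apply hψ
  simp at hσ ⊢
  omega

theorem opW_congr (w : List (Slice n Bool)) (st t : List (Strand n)) (h : run w st = some t)
    {ψ ψ' : List Bool → R} (hψ : ∀ σ, σ.length = st.length → ψ σ = ψ' σ) (σ : List Bool)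
    (hσ : σ.length = t.length) : opW s w st ψ σ = opW s w st ψ' σ := by
  induction w generalizing st ψ ψ' with
  | nil => simp [run] at h; subst h; exact hψ σ hσ
  | cons c w ih =>
    simp only [run] at h
    cases hc : c.apply st with
    | none => simp [hc] at h
    | some st' =>
      simp only [hc, Option.bind_some] at h
      simp only [opW, hc, Option.getD_some]
      exact ih st' h fun τ hτ => op_congr s c st st' hc hψ τ hτ

theorem opW_append (a b : List (Slice n Bool)) (st t : List (Strand n)) (h : run a st = some t)
    (ψ : List Bool → R) : opW s (a ++ b) st ψ = opW s b t (opW s a st ψ) := by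
  induction a generalizing st ψ with
  | nil => simp [run] at h; subst h; rfl
  | cons c a ih =>
    simp only [run] at h
    cases hc : c.apply st with
    | none => simp [hc] at h
    | some st' =>
      simp only [hc, Option.bind_some] at h
      simp only [List.cons_append, opW, hc, Option.getD_some]
      exact ih st' h _

theorem op_add (c : Slice n Bool) (st : List (Strand n)) (ψ ψ' : List Bool → R) :
    op s c st (ψ + ψ') = op s c st ψ + op s c st ψ' := by
  funext σ
  simp only [op, Pi.add_apply, mul_add, bitSum_add]

theorem op_smul (c : Slice n Bool) (st : List (Strand n)) (k : R) (ψ : List Bool → R) :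
    op s c st (k • ψ) = k • op s c st ψ := by
  funext σ
  simp only [op, Pi.smul_apply, smul_eq_mul, ← bitSum_mul_left]
  exact bitSum_congr fun τ _ => by ring

theorem opW_add (w : List (Slice n Bool)) (st : List (Strand n)) (ψ ψ' : List Bool → R) :
    opW s w st (ψ + ψ') = opW s w st ψ + opW s w st ψ' := by
  induction w generalizing st ψ ψ' with
  | nil => rfl
  | cons c w ih => simp only [opW, op_add, ih]

theorem opW_smul (w : List (Slice n Bool)) (st : List (Strand n)) (k : R) (ψ : List Bool → R) :
    opW s w st (k • ψ) = k • opW s w st ψ := by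
  induction w generalizing st ψ with
  | nil => rfl
  | cons c w ih => simp only [opW, op_smul, ih]

theorem jw_append (l l' : List (Strand n)) (σ σ' : List Bool) (h : σ.length = l.length) :
    (jw (l ++ l') (σ ++ σ') : R) = jw l σ * jw l' σ' := by
  induction l generalizing σ with
  | nil => simp at h; subst h; simp [jw]
  | cons a l ih =>
    obtain _ | ⟨b, σ⟩ := σ
    · simp at h
    · simp at h
      simp only [List.cons_append, jw, ih σ h]
      ring

theorem jw_mul_self (l : List (Strand n)) (σ : List Bool) : (jw l σ * jw l σ : R) = 1 := by
  induction l generalizing σ with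
  | nil => simp [jw]
  | cons a l ih =>
    obtain _ | ⟨b, σ⟩ := σ
    · simp [jw]
    · simp only [jw]
      rw [mul_mul_mul_comm, ih]
      split_ifs <;> simp

end Fock
end Conway

namespace Conway

/-! ### Local invariance: each Reidemeister move and each straightening. -/

section Local
variable {n : ℕ}

theorem apply_cup (su sv : List (Strand n)) (g : Fin n) (d : Bool) :
    Slice.apply (⟨su.length, .cup g d⟩ : Slice n Bool) (su ++ sv) =
      some (su ++ (g, d) :: (g, !d) :: sv) := by
  simp [Slice.apply]

theorem apply_cup_succ (su sv : List (Strand n)) (e : Strand n) (g : Fin n) (d : Bool) :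
    Slice.apply (⟨su.length + 1, .cup g d⟩ : Slice n Bool) (su ++ e :: sv) =
      some (su ++ e :: (g, d) :: (g, !d) :: sv) := by
  simpa using apply_cup (su ++ [e]) sv g d

theorem apply_cross (su sv : List (Strand n)) (a b : Strand n) (x : Bool) :
    Slice.apply (⟨su.length, .cross x⟩ : Slice n Bool) (su ++ a :: b :: sv) =
      some (su ++ b :: a :: sv) := by
  simp [Slice.apply]

theorem apply_cross_succ (su sv : List (Strand n)) (e a b : Strand n) (x : Bool) :
    Slice.apply (⟨su.length + 1, .cross x⟩ : Slice n Bool) (su ++ e :: a :: b :: sv) =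
      some (su ++ e :: b :: a :: sv) := by
  simpa using apply_cross (su ++ [e]) sv a b x

theorem apply_cap (su sv : List (Strand n)) (a b : Strand n) :
    Slice.apply (⟨su.length, .cap⟩ : Slice n Bool) (su ++ a :: b :: sv) =
      if a.1 = b.1 ∧ a.2 ≠ b.2 then some (su ++ sv) else none := by
  simp [Slice.apply]

theorem apply_cap_succ (su sv : List (Strand n)) (e a b : Strand n) :
    Slice.apply (⟨su.length + 1, .cap⟩ : Slice n Bool) (su ++ e :: a :: b :: sv) =
      if a.1 = b.1 ∧ a.2 ≠ b.2 then some (su ++ e :: sv) else none := by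
  simpa using apply_cap (su ++ [e]) sv a b

variable {R : Type} [CommRing R] (s : Fin n → Rˣ)

theorem op_cup (su sv : List (Strand n)) (g : Fin n) (d : Bool) (ψ : List Bool → R)
    (u v : List Bool) (x y : Bool) (hu : u.length = su.length) :
    op s ⟨su.length, .cup g d⟩ (su ++ sv) ψ (u ++ x :: y :: v) =
      jw su u * kern s (.cup g d) sv [] [x, y] * ψ (u ++ v) :=
  op_eval s (.cup g d) su sv ψ u [x, y] v hu rfl

theorem op_cup_succ (su sv : List (Strand n)) (e : Strand n) (g : Fin n) (d : Bool)
    (ψ : List Bool → R) (u v : List Bool) (z x y : Bool) (hu : u.length = su.length) :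
    op s ⟨su.length + 1, .cup g d⟩ (su ++ e :: sv) ψ (u ++ z :: x :: y :: v) =
      jw su u * (if e.2 = z then 1 else -1) * kern s (.cup g d) sv [] [x, y] * ψ (u ++ z :: v) := by
  have := op_cup s (su ++ [e]) sv g d ψ (u ++ [z]) v x y (by simp [hu])
  simpa [jw_append _ _ _ _ hu, jw] using this

theorem op_cross (su sv : List (Strand n)) (a b : Strand n) (t : Bool) (ψ : List Bool → R)
    (u v : List Bool) (x y : Bool) (hu : u.length = su.length) :
    op s ⟨su.length, .cross t⟩ (su ++ a :: b :: sv) ψ (u ++ x :: y :: v) =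
      crossSign a b *
        (crossKern s t a b [false, false] [x, y] * ψ (u ++ false :: false :: v) +
        crossKern s t a b [true, false] [x, y] * ψ (u ++ true :: false :: v) +
        crossKern s t a b [false, true] [x, y] * ψ (u ++ false :: true :: v) +
        crossKern s t a b [true, true] [x, y] * ψ (u ++ true :: true :: v)) := by
  refine (op_eval s (.cross t) su (a :: b :: sv) ψ u [x, y] v hu rfl).trans ?_
  simp [bitSum, jwDeg, Piece.crossType, kern, Piece.inWidth]
  ring

theorem op_cap (su sv : List (Strand n)) (a b : Strand n) (ψ : List Bool → R)
    (u v : List Bool) (hu : u.length = su.length) :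
    op s ⟨su.length, .cap⟩ (su ++ a :: b :: sv) ψ (u ++ v) =
      jw su u * capWt s a *
        (ψ (u ++ false :: true :: v) - hol s a ^ 2 * ψ (u ++ true :: false :: v)) := by
  refine (op_eval s .cap su (a :: b :: sv) ψ u [] v hu rfl).trans ?_
  simp [bitSum, jwDeg, Piece.crossType, kern, Piece.inWidth]
  ring

theorem op_cap_succ (su sv : List (Strand n)) (e a b : Strand n) (ψ : List Bool → R)
    (u v : List Bool) (z : Bool) (hu : u.length = su.length) :
    op s ⟨su.length + 1, .cap⟩ (su ++ e :: a :: b :: sv) ψ (u ++ z :: v) =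
      jw su u * (if e.2 = z then 1 else -1) * capWt s a *
        (ψ (u ++ z :: false :: true :: v) - hol s a ^ 2 * ψ (u ++ z :: true :: false :: v)) := by
  have := op_cap s (su ++ [e]) sv a b ψ (u ++ [z]) v (by simp [hu])
  simpa [jw_append _ _ _ _ hu, jw] using this

theorem op_cross_true (su sv : List (Strand n)) (a b : Strand n) (ψ : List Bool → R)
    (u v : List Bool) (x y : Bool) (hu : u.length = su.length) :
    op s ⟨su.length, .cross true⟩ (su ++ a :: b :: sv) ψ (u ++ x :: y :: v) =
      crossSign a b * (match x, y with
        | false, false => hol s a * ψ (u ++ false :: false :: v)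
        | true, false => ((hol s a)⁻¹ : Rˣ) * ψ (u ++ false :: true :: v)
        | false, true => hol s a * ψ (u ++ true :: false :: v) +
            -((hol s a)⁻¹ : Rˣ) * (1 - hol s b ^ 2) * ψ (u ++ false :: true :: v)
        | true, true => -((hol s a)⁻¹ : Rˣ) * ψ (u ++ true :: true :: v)) := by
  rw [op_cross s su sv a b true ψ u v x y hu]
  cases x <;> cases y <;> simp [crossKern]

theorem op_cross_false (su sv : List (Strand n)) (a b : Strand n) (ψ : List Bool → R)
    (u v : List Bool) (x y : Bool) (hu : u.length = su.length) :
    op s ⟨su.length, .cross false⟩ (su ++ a :: b :: sv) ψ (u ++ x :: y :: v) =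
      crossSign a b * (match x, y with
        | false, false => ((hol s b)⁻¹ : Rˣ) * ψ (u ++ false :: false :: v)
        | true, false => ((hol s b)⁻¹ : Rˣ) * (1 - hol s a ^ 2) * ψ (u ++ true :: false :: v) +
            ((hol s b)⁻¹ : Rˣ) * ψ (u ++ false :: true :: v)
        | false, true => hol s b * ψ (u ++ true :: false :: v)
        | true, true => -(hol s b) * ψ (u ++ true :: true :: v)) := by
  rw [op_cross s su sv a b false ψ u v x y hu]
  cases x <;> cases y <;> simp [crossKern]

theorem op_cross_true_succ (su sv : List (Strand n)) (e a b : Strand n) (ψ : List Bool → R)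
    (u v : List Bool) (z x y : Bool) (hu : u.length = su.length) :
    op s ⟨su.length + 1, .cross true⟩ (su ++ e :: a :: b :: sv) ψ (u ++ z :: x :: y :: v) =
      crossSign a b * (match x, y with
        | false, false => hol s a * ψ (u ++ z :: false :: false :: v)
        | true, false => ((hol s a)⁻¹ : Rˣ) * ψ (u ++ z :: false :: true :: v)
        | false, true => hol s a * ψ (u ++ z :: true :: false :: v) +
            -((hol s a)⁻¹ : Rˣ) * (1 - hol s b ^ 2) * ψ (u ++ z :: false :: true :: v)
        | true, true => -((hol s a)⁻¹ : Rˣ) * ψ (u ++ z :: true :: true :: v)) := by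
  simpa using op_cross_true s (su ++ [e]) sv a b ψ (u ++ [z]) v x y (by simp [hu])

theorem op_cross_false_succ (su sv : List (Strand n)) (e a b : Strand n) (ψ : List Bool → R)
    (u v : List Bool) (z x y : Bool) (hu : u.length = su.length) :
    op s ⟨su.length + 1, .cross false⟩ (su ++ e :: a :: b :: sv) ψ (u ++ z :: x :: y :: v) =
      crossSign a b * (match x, y with
        | false, false => ((hol s b)⁻¹ : Rˣ) * ψ (u ++ z :: false :: false :: v)
        | true, false => ((hol s b)⁻¹ : Rˣ) * (1 - hol s a ^ 2) * ψ (u ++ z :: true :: false :: v) +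
            ((hol s b)⁻¹ : Rˣ) * ψ (u ++ z :: false :: true :: v)
        | false, true => hol s b * ψ (u ++ z :: true :: false :: v)
        | true, true => -(hol s b) * ψ (u ++ z :: true :: true :: v)) := by
  simpa using op_cross_false s (su ++ [e]) sv a b ψ (u ++ [z]) v x y (by simp [hu])

theorem exists_split {α β : Type} (l m : List α) (σ : List β) (h : σ.length = (l ++ m).length) :
    ∃ u v, σ = u ++ v ∧ u.length = l.length ∧ v.length = m.length := by
  refine ⟨σ.take l.length, σ.drop l.length, by simp, ?_, ?_⟩ <;> simp at h ⊢ <;> omega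

theorem exists_cons {β : Type} {m : ℕ} (σ : List β) (h : σ.length = m + 1) :
    ∃ x v, σ = x :: v ∧ v.length = m := by
  cases σ with
  | nil => simp at h
  | cons x v => exact ⟨x, v, rfl, by simpa using h⟩

/-- Two stacks of slices with the same effect on the state `st`. -/
def LocalEq (l r : List (Slice n Bool)) (st : List (Strand n)) : Prop :=
  ∀ t t', run l st = some t → run r st = some t' →
    t = t' ∧ ∀ (ψ : List Bool → R) σ, σ.length = t.length → opW s l st ψ σ = opW s r st ψ σ

/-- A finite check of the Yang–Baxter equation: for each of the six admissible decorations and each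
of the eight outgoing occupation patterns, both sides agree modulo `hol * hol⁻¹ = 1`. The hypothesis
`h` discards the two cyclic decorations. -/
theorem localEq_braid (su sv : List (Strand n)) (a b c : Strand n) (x y z : Bool)
    (h : y = x ∨ y = z) :
    LocalEq s [⟨su.length, .cross x⟩, ⟨su.length + 1, .cross y⟩, ⟨su.length, .cross z⟩]
      [⟨su.length + 1, .cross z⟩, ⟨su.length, .cross y⟩, ⟨su.length + 1, .cross x⟩]
      (su ++ a :: b :: c :: sv) := by
  intro t t' hl hr
  simp [run, apply_cross, apply_cross_succ] at hl hr
  refine ⟨hl.symm.trans hr, fun ψ σ hσ => ?_⟩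
  rw [← hl] at hσ
  obtain ⟨u, v, rfl, hu, hv⟩ := exists_split _ _ _ hσ
  obtain ⟨p, v, rfl, hv1⟩ := exists_cons _ hv
  obtain ⟨q, v, rfl, hv2⟩ := exists_cons _ hv1
  obtain ⟨r, v, rfl, -⟩ := exists_cons _ hv2
  simp only [opW, apply_cross, apply_cross_succ, Option.getD_some]
  have h1 : (hol s a : R) * ((hol s a)⁻¹ : Rˣ) = 1 := by simp
  have h2 : (hol s b : R) * ((hol s b)⁻¹ : Rˣ) = 1 := by simp
  have h3 : (hol s c : R) * ((hol s c)⁻¹ : Rˣ) = 1 := by simp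
  cases x <;> cases y <;> cases z <;> simp at h <;> cases p <;> cases q <;> cases r <;>
    simp only [op_cross_true, op_cross_false, op_cross_true_succ, op_cross_false_succ, hu] <;>
    grind

theorem localEq_cancel (su sv : List (Strand n)) (a b : Strand n) (x : Bool) :
    LocalEq s [⟨su.length, .cross x⟩, ⟨su.length, .cross (!x)⟩] [] (su ++ a :: b :: sv) := by
  intro t t' hl hr
  simp [run, apply_cross] at hl hr
  refine ⟨hl.symm.trans hr, fun ψ σ hσ => ?_⟩
  rw [← hl] at hσ
  obtain ⟨u, v, rfl, hu, hv⟩ := exists_split _ _ _ hσ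
  obtain ⟨p, v, rfl, hv1⟩ := exists_cons _ hv
  obtain ⟨q, v, rfl, -⟩ := exists_cons _ hv1
  simp only [opW, apply_cross, Option.getD_some]
  have h1 : (hol s a : R) * ((hol s a)⁻¹ : Rˣ) = 1 := by simp
  have h2 : (hol s b : R) * ((hol s b)⁻¹ : Rˣ) = 1 := by simp
  cases x <;> cases p <;> cases q <;>
    simp only [Bool.not_true, Bool.not_false, op_cross_true, op_cross_false, hu, crossSign] <;>
    grind

/-- The minimum and the maximum are both odd, so their signs `jw su u` multiply to one. What remains
is the compatibility of `cupWt` with `capWt`. -/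
theorem localEq_zigzagRight (su sv : List (Strand n)) (e : Strand n) (g : Fin n) (d : Bool) :
    LocalEq s [⟨su.length, .cup g d⟩, ⟨su.length + 1, .cap⟩] [] (su ++ e :: sv) := by
  intro t t' hl hr
  simp [run, apply_cup, apply_cap_succ] at hl hr
  obtain ⟨⟨h1, h2⟩, hl⟩ := hl
  obtain ⟨e, e'⟩ := e
  have : e' = d := by revert h2; cases e' <;> cases d <;> simp
  subst this
  simp only at h1
  subst h1
  refine ⟨hl.symm.trans hr, fun ψ σ hσ => ?_⟩
  rw [← hl] at hσ
  obtain ⟨u, v, rfl, hu, hv⟩ := exists_split _ _ _ hσ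
  obtain ⟨p, v, rfl, -⟩ := exists_cons _ hv
  simp only [opW, apply_cup, Option.getD_some]
  have h3 : (s g : R) * ((s g)⁻¹ : Rˣ) = 1 := by simp
  have h4 := jw_mul_self (R := R) su u
  rw [op_cap_succ s su sv _ _ _ _ u v p hu, op_cup _ _ _ _ _ _ _ _ _ _ hu,
    op_cup _ _ _ _ _ _ _ _ _ _ hu]
  cases e' <;> cases p <;> simp [kern, capWt, cupWt, hol] <;> grind

theorem localEq_zigzagLeft (su sv : List (Strand n)) (e : Strand n) (g : Fin n) (d : Bool) :
    LocalEq s [⟨su.length + 1, .cup g d⟩, ⟨su.length, .cap⟩] [] (su ++ e :: sv) := by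
  intro t t' hl hr
  simp [run, apply_cup_succ, apply_cap] at hl hr
  obtain ⟨⟨h1, h2⟩, hl⟩ := hl
  obtain ⟨e, e'⟩ := e
  have : e' = !d := by revert h2; cases e' <;> cases d <;> simp
  subst this
  simp only at h1
  subst h1
  refine ⟨hl.symm.trans hr, fun ψ σ hσ => ?_⟩
  rw [← hl] at hσ
  obtain ⟨u, v, rfl, hu, hv⟩ := exists_split _ _ _ hσ
  obtain ⟨p, v, rfl, -⟩ := exists_cons _ hv
  simp only [opW, apply_cup_succ, Option.getD_some]
  have h3 : (s e : R) * ((s e)⁻¹ : Rˣ) = 1 := by simp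
  have h4 := jw_mul_self (R := R) su u
  rw [op_cap s su _ _ _ _ u _ hu, op_cup_succ _ _ _ _ _ _ _ _ _ _ _ _ hu,
    op_cup_succ _ _ _ _ _ _ _ _ _ _ _ _ hu]
  cases d <;> cases p <;> simp [kern, capWt, cupWt, hol] <;> grind

/-- The crossing weights are normalised so that no framing factor appears: a kink merely reverses
the order of the legs of the minimum, for either decoration. -/
theorem localEq_kinkCup (su sv : List (Strand n)) (g : Fin n) (d x : Bool) :
    LocalEq s [⟨su.length, .cup g d⟩, ⟨su.length, .cross x⟩] [⟨su.length, .cup g (!d)⟩]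
      (su ++ sv) := by
  intro t t' hl hr
  simp [run, apply_cup, apply_cross] at hl hr
  refine ⟨hl.symm.trans hr, fun ψ σ hσ => ?_⟩
  rw [← hl] at hσ
  obtain ⟨u, v, rfl, hu, hv⟩ := exists_split _ _ _ hσ
  obtain ⟨p, v, rfl, hv1⟩ := exists_cons _ hv
  obtain ⟨q, v, rfl, -⟩ := exists_cons _ hv1
  simp only [opW, apply_cup, Option.getD_some]
  have h3 : (s g : R) * ((s g)⁻¹ : Rˣ) = 1 := by simp
  cases x <;> cases p <;> cases q <;>
    simp only [op_cross_true, op_cross_false, op_cup, hu] <;>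
    cases d <;> simp [kern, cupWt, hol, crossSign] <;> grind

theorem localEq_kinkCap (su sv : List (Strand n)) (a b : Strand n) (x : Bool) :
    LocalEq s [⟨su.length, .cross x⟩, ⟨su.length, .cap⟩] [⟨su.length, .cap⟩]
      (su ++ a :: b :: sv) := by
  intro t t' hl hr
  simp [run, apply_cap, apply_cross] at hl hr
  obtain ⟨-, hl⟩ := hl
  obtain ⟨⟨h1, h2⟩, hr⟩ := hr
  obtain ⟨g, d⟩ := a
  obtain ⟨g', d'⟩ := b
  have : d' = !d := by cases d <;> cases d' <;> simp_all
  subst this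
  simp only at h1
  subst h1
  refine ⟨hl.symm.trans hr, fun ψ σ hσ => ?_⟩
  rw [← hl] at hσ
  obtain ⟨u, v, rfl, hu, hv⟩ := exists_split _ _ _ hσ
  simp only [opW, apply_cross, Option.getD_some]
  have h3 : (s g : R) * ((s g)⁻¹ : Rˣ) = 1 := by simp
  rw [op_cap s su _ _ _ _ u _ hu, op_cap s su _ _ _ _ u _ hu]
  cases x <;>
    simp only [op_cross_true, op_cross_false, hu] <;>
    cases d <;> simp [capWt, hol, crossSign] <;> grind

theorem localEq_slideCup (su sv : List (Strand n)) (e : Strand n) (g : Fin n) (d x : Bool) :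
    LocalEq s [⟨su.length, .cup g d⟩, ⟨su.length + 1, .cross x⟩]
      [⟨su.length + 1, .cup g d⟩, ⟨su.length, .cross (!x)⟩] (su ++ e :: sv) := by
  intro t t' hl hr
  simp [run, apply_cup, apply_cup_succ, apply_cross, apply_cross_succ] at hl hr
  refine ⟨hl.symm.trans hr, fun ψ σ hσ => ?_⟩
  rw [← hl] at hσ
  obtain ⟨u, v, rfl, hu, hv⟩ := exists_split _ _ _ hσ
  obtain ⟨p, v, rfl, hv1⟩ := exists_cons _ hv
  obtain ⟨q, v, rfl, hv2⟩ := exists_cons _ hv1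
  obtain ⟨r, v, rfl, -⟩ := exists_cons _ hv2
  simp only [opW, apply_cup, apply_cup_succ, Option.getD_some]
  have h3 : (s g : R) * ((s g)⁻¹ : Rˣ) = 1 := by simp
  have h4 : (s e.1 : R) * ((s e.1)⁻¹ : Rˣ) = 1 := by simp
  obtain ⟨f, e⟩ := e
  cases x <;> cases p <;> cases q <;> cases r <;>
    simp only [Bool.not_true, Bool.not_false, op_cross_true, op_cross_false, op_cross_true_succ,
      op_cross_false_succ, op_cup, op_cup_succ, hu] <;>
    cases d <;> cases e <;> simp [kern, cupWt, hol, crossSign] <;> grind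

theorem localEq_slideCap (su sv : List (Strand n)) (a b c : Strand n) (x : Bool) :
    LocalEq s [⟨su.length + 1, .cross x⟩, ⟨su.length, .cap⟩]
      [⟨su.length, .cross (!x)⟩, ⟨su.length + 1, .cap⟩] (su ++ a :: b :: c :: sv) := by
  intro t t' hl hr
  simp [run, apply_cap, apply_cap_succ, apply_cross, apply_cross_succ] at hl hr
  obtain ⟨-, hl⟩ := hl
  obtain ⟨⟨h1, h2⟩, hr⟩ := hr
  obtain ⟨g, d⟩ := a
  obtain ⟨g', d'⟩ := c
  have : d' = !d := by cases d <;> cases d' <;> simp_all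
  subst this
  simp only at h1
  subst h1
  refine ⟨hl.symm.trans hr, fun ψ σ hσ => ?_⟩
  rw [← hl] at hσ
  obtain ⟨u, v, rfl, hu, hv⟩ := exists_split _ _ _ hσ
  obtain ⟨p, v, rfl, -⟩ := exists_cons _ hv
  simp only [opW, apply_cross, apply_cross_succ, Option.getD_some]
  have h3 : (s g : R) * ((s g)⁻¹ : Rˣ) = 1 := by simp
  have h4 : (s b.1 : R) * ((s b.1)⁻¹ : Rˣ) = 1 := by simp
  rw [op_cap s su _ _ _ _ u _ hu, op_cap_succ s su _ _ _ _ _ u _ _ hu]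
  obtain ⟨f, b⟩ := b
  cases x <;> cases p <;>
    simp only [Bool.not_true, Bool.not_false, op_cross_true, op_cross_false, op_cross_true_succ,
      op_cross_false_succ, hu] <;>
    cases d <;> cases b <;> simp [capWt, hol, crossSign] <;> grind

end Local
end Conway

namespace Conway

/-! ### Far commutation, and invariance under all moves. -/

section Local
variable {n : ℕ} {R : Type} [CommRing R] (s : Fin n → Rˣ)

theorem kern_window (P : Piece n Bool) (si x y : List (Strand n)) (h : si.length = P.inWidth)
    (τ ω : List Bool) : kern s P (si ++ x) τ ω = kern s P (si ++ y) τ ω := by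
  obtain ⟨g, d⟩ | _ | t := P
  · simp only [kern]
  · obtain _ | ⟨a, _ | ⟨b, si⟩⟩ := si <;> simp [Piece.inWidth] at h
    simp only [List.cons_append, kern]
  · obtain _ | ⟨a, _ | ⟨b, si⟩⟩ := si <;> simp [Piece.inWidth] at h
    simp only [List.cons_append, kern]

theorem crossKern_eq_zero (x : Bool) (a b : Strand n) (τ ω : List Bool)
    (h : τ.count true ≠ ω.count true) : crossKern s x a b τ ω = 0 := by
  unfold crossKern
  split <;> simp_all

/-- Measured against the configuration of upward strands, every piece preserves parity: a minimum
creates one occupied strand but also one upward strand. This is why odd pieces commute here instead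
of anticommuting. -/
theorem kern_parity (P : Piece n Bool) (si so x : List (Strand n)) (τ ω : List Bool)
    (hc : ∀ g d, P = .cup g d → so = [(g, d), (g, !d)] ∧ si = [])
    (hp : P = .cap → so = [] ∧ ∃ a : Strand n, si = [a, (a.1, !a.2)])
    (hx : ∀ t, P = .cross t → ∃ a b, si = [a, b] ∧ so = [b, a])
    (hτ : τ.length = P.inWidth) (hω : ω.length = P.outWidth) :
    kern s P (si ++ x) τ ω * jw so ω = kern s P (si ++ x) τ ω * jw si τ := by
  obtain ⟨g, d⟩ | _ | t := P
  · obtain ⟨rfl, rfl⟩ := hc g d rfl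
    obtain _ | ⟨p, τ⟩ := τ <;> simp [Piece.inWidth] at hτ
    obtain _ | ⟨p, _ | ⟨q, _ | ⟨r, ω⟩⟩⟩ := ω <;> simp [Piece.outWidth] at hω
    cases p <;> cases q <;> cases d <;> simp [kern, jw]
  · obtain ⟨rfl, ⟨a, a'⟩, rfl⟩ := hp rfl
    obtain _ | ⟨p, ω⟩ := ω <;> simp [Piece.outWidth] at hω
    obtain _ | ⟨p, _ | ⟨q, _ | ⟨r, τ⟩⟩⟩ := τ <;> simp [Piece.inWidth] at hτ
    cases p <;> cases q <;> cases a' <;> simp [kern, jw]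
  · obtain ⟨⟨a, a'⟩, ⟨b, b'⟩, rfl, rfl⟩ := hx t rfl
    obtain _ | ⟨p, _ | ⟨q, _ | ⟨r, ω⟩⟩⟩ := ω <;> simp [Piece.outWidth] at hω
    obtain _ | ⟨p', _ | ⟨q', _ | ⟨r, τ⟩⟩⟩ := τ <;> simp [Piece.inWidth] at hτ
    simp only [List.cons_append, kern]
    by_cases h : [p', q'].count true = [p, q].count true
    · congr 1
      revert h
      cases p <;> cases q <;> cases p' <;> cases q' <;> cases a' <;> cases b' <;>
        simp [jw]
    · rw [crossKern_eq_zero s _ _ _ _ _ h]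
      simp

/-- Both orders give the same double sum over the occupation numbers below the two pieces. The only
difference is the sign of `B` read across the strands of `A` before or after `A`, and `kern_parity`
identifies the two. -/
theorem localEq_far (i r : ℕ) (A B : Piece n Bool) (st : List (Strand n)) :
    LocalEq s [⟨i, A⟩, ⟨i + A.outWidth + r, B⟩] [⟨i + A.inWidth + r, B⟩, ⟨i, A⟩] st := by
  intro t t' hl hr
  simp only [run] at hl hr
  cases h1 : Slice.apply ⟨i, A⟩ st with
  | none => simp [h1] at hl
  | some t1 =>
  simp only [h1, Option.bind_some] at hl
  cases h2 : Slice.apply ⟨i + A.outWidth + r, B⟩ t1 with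
  | none => simp [h2] at hl
  | some t2 =>
  simp only [h2, Option.bind_some, Option.some.injEq] at hl
  subst hl
  obtain ⟨su, siA, soA, sv, rfl, rfl, hp, hiA, hoA, hA, hA1, hA2, hA3⟩ := apply_eq_some _ _ _ h1
  obtain ⟨su2, siB, soB, sv2, hs, rfl, hp2, hiB, hoB, hB, -⟩ := apply_eq_some _ _ _ h2
  simp only at hp hiA hoA hA hA1 hA2 hA3 hp2 hiB hoB hB
  -- `m` consists of the `r` strands between the pieces. In the second alternative the overlap is
  -- empty, because `B` does not start to the left of the end of `A`.
  obtain ⟨m, rfl⟩ : ∃ m, su2 = su ++ (soA ++ m) := by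
    have := (List.append_eq_append_iff.1 (show (su ++ soA) ++ sv = su2 ++ (siB ++ sv2) by
      rw [← hs]; simp))
    obtain ⟨a, ha, -⟩ | ⟨a, ha, -⟩ := this
    · exact ⟨a, by rw [ha]; simp⟩
    · have := congrArg List.length ha
      simp at this
      have : a = [] := by
        rw [← List.length_eq_zero_iff]; omega
      subst this
      exact ⟨[], by simpa using ha.symm⟩
  obtain rfl : sv = m ++ (siB ++ sv2) := by
    rw [List.append_assoc, List.append_assoc] at hs
    exact List.append_cancel_left (List.append_cancel_left hs)
  have hm : m.length = r := by simp at hp2; omega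
  have h3 := hB (su ++ (siA ++ m)) sv2
  have h4 := hA su (m ++ (soB ++ sv2))
  have e1 : (su ++ (siA ++ m)).length = i + A.inWidth + r := by simp; omega
  rw [e1] at h3
  rw [hp] at h4
  simp only [List.append_assoc] at hr h3 h4 ⊢
  rw [h3] at hr
  simp only [Option.bind_some, h4, Option.some.injEq] at hr
  subst hr
  refine ⟨rfl, fun ψ σ hσ => ?_⟩
  simp only [List.append_assoc] at h1 h2
  simp only [opW, h1, h3, Option.getD_some]
  obtain ⟨u, w, rfl, hu, hw⟩ := exists_split su _ σ hσ
  obtain ⟨ωA, w', rfl, hωA, hw'⟩ := exists_split soA _ w hw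
  obtain ⟨x, w2, rfl, hx, hw2⟩ := exists_split m _ w' hw'
  obtain ⟨ωB, v, rfl, hωB, hv⟩ := exists_split soB _ w2 hw2
  have L1 : i + A.outWidth + r = (su ++ (soA ++ m)).length := by simp; omega
  have L2 : i + A.inWidth + r = (su ++ (siA ++ m)).length := by simp; omega
  have E1 : ∀ φ : List Bool → R,
      op s ⟨i + A.outWidth + r, B⟩ (su ++ (soA ++ (m ++ (siB ++ sv2)))) φ
        (u ++ (ωA ++ (x ++ (ωB ++ v)))) =
      bitSum B.inWidth fun τ => jwDeg B (su ++ (soA ++ m)) (u ++ (ωA ++ x)) *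
        kern s B (siB ++ sv2) τ ωB * φ (u ++ (ωA ++ (x ++ (τ ++ v)))) := by
    intro φ
    have := op_eval s B (su ++ (soA ++ m)) (siB ++ sv2) φ (u ++ (ωA ++ x)) ωB v
      (by simp [hu, hωA, hx]) (by omega)
    rw [L1]
    simpa using this
  have E2 : ∀ τ : List Bool, τ.length = B.inWidth →
      op s ⟨i, A⟩ (su ++ (siA ++ (m ++ (siB ++ sv2)))) ψ (u ++ (ωA ++ (x ++ (τ ++ v)))) =
      bitSum A.inWidth fun τA => jwDeg A su u * kern s A (siA ++ []) τA ωA *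
        ψ (u ++ (τA ++ (x ++ (τ ++ v)))) := by
    intro τ hτ
    rw [← hp, op_eval s A su _ ψ u ωA _ hu (by omega)]
    exact bitSum_congr fun τA _ => by rw [kern_window s A siA _ [] hiA]
  have E3 : ∀ φ : List Bool → R,
      op s ⟨i, A⟩ (su ++ (siA ++ (m ++ (soB ++ sv2)))) φ (u ++ (ωA ++ (x ++ (ωB ++ v)))) =
      bitSum A.inWidth fun τA => jwDeg A su u * kern s A (siA ++ []) τA ωA *
        φ (u ++ (τA ++ (x ++ (ωB ++ v)))) := by
    intro φ
    rw [← hp, op_eval s A su _ φ u ωA _ hu (by omega)]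
    exact bitSum_congr fun τA _ => by rw [kern_window s A siA _ [] hiA]
  have E4 : ∀ τA : List Bool, τA.length = A.inWidth →
      op s ⟨i + A.inWidth + r, B⟩ (su ++ (siA ++ (m ++ (siB ++ sv2)))) ψ
        (u ++ (τA ++ (x ++ (ωB ++ v)))) =
      bitSum B.inWidth fun τ => jwDeg B (su ++ (siA ++ m)) (u ++ (τA ++ x)) *
        kern s B (siB ++ sv2) τ ωB * ψ (u ++ (τA ++ (x ++ (τ ++ v)))) := by
    intro τA hτA
    have := op_eval s B (su ++ (siA ++ m)) (siB ++ sv2) ψ (u ++ (τA ++ x)) ωB v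
      (by simp [hu, hiA, hτA, hx]) (by omega)
    rw [L2]
    simpa using this
  rw [E1, E3, bitSum_congr fun τ hτ => congrArg _ (E2 τ hτ),
    bitSum_congr fun τA hτA => congrArg _ (E4 τA hτA)]
  simp only [← bitSum_mul_left]
  rw [bitSum_comm]
  refine bitSum_congr fun τA hτA => bitSum_congr fun τ hτ => ?_
  have key := kern_parity s A siA soA [] τA ωA
    (fun g d h => ⟨hA1 g d h, by
      rw [← List.length_eq_zero_iff, hiA, h]; rfl⟩)
    (fun h => ⟨by rw [← List.length_eq_zero_iff, hoA, h]; rfl, hA2 h⟩) hA3 hτA (by omega)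
  -- The sign across the strands of `A` may be read on either side of `A` wherever the weight of `A`
  -- is nonzero.
  have hj : jwDeg B (su ++ (soA ++ m)) (u ++ (ωA ++ x)) * kern s A (siA ++ []) τA ωA =
      jwDeg B (su ++ (siA ++ m)) (u ++ (τA ++ x)) * kern s A (siA ++ []) τA ωA := by
    unfold jwDeg
    split_ifs
    · rfl
    · rw [jw_append _ _ _ _ hu, jw_append _ _ _ _ hu, jw_append _ _ _ _ hωA,
        jw_append _ _ _ _ (by omega)]
      linear_combination jw su u * jw m x * key
  linear_combination jwDeg A su u * kern s B (siB ++ sv2) τ ωB *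
    ψ (u ++ (τA ++ (x ++ (τ ++ v)))) * hj

theorem split_cup {i : ℕ} {g : Fin n} {d : Bool} {w : List (Slice n Bool)}
    {st t : List (Strand n)} (h : run (⟨i, .cup g d⟩ :: w) st = some t) :
    ∃ su sv, st = su ++ sv ∧ su.length = i := by
  simp only [run] at h
  cases h1 : Slice.apply (⟨i, .cup g d⟩ : Slice n Bool) st with
  | none => simp [h1] at h
  | some t1 =>
    obtain ⟨su, si, so, sv, rfl, -, hp, -⟩ := apply_eq_some _ _ _ h1
    exact ⟨su, _, rfl, hp⟩

theorem split_two {i : ℕ} {P : Piece n Bool} (hP : P.inWidth = 2) {w : List (Slice n Bool)}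
    {st t : List (Strand n)} (h : run (⟨i, P⟩ :: w) st = some t) :
    ∃ su a b sv, st = su ++ a :: b :: sv ∧ su.length = i := by
  simp only [run] at h
  cases h1 : Slice.apply ⟨i, P⟩ st with
  | none => simp [h1] at h
  | some t1 =>
    obtain ⟨su, si, so, sv, rfl, -, hp, hi, -⟩ := apply_eq_some _ _ _ h1
    simp only [hP] at hi
    obtain ⟨a, b, rfl⟩ := List.length_eq_two.1 hi
    exact ⟨su, a, b, sv, by simp, hp⟩

theorem split_last {α : Type} {l : List α} {i : ℕ} (h : l.length = i + 1) :
    ∃ l' e, l = l' ++ [e] ∧ l'.length = i := by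
  obtain rfl | ⟨l', e, rfl⟩ := List.eq_nil_or_concat' l
  · simp at h
  · exact ⟨l', e, rfl, by simpa using h⟩

theorem Move.localEq {l r : List (Slice n Bool)} (h : Move l r) (st : List (Strand n)) :
    LocalEq s l r st := by
  intro t t' hl hr
  refine (?_ : LocalEq s l r st) t t' hl hr
  cases h with
  | far i r A B => exact localEq_far s i r A B st
  | zigzagRight i g d =>
    obtain ⟨su, sv, rfl, rfl⟩ := split_cup hl
    cases sv with
    | nil => simp [run, Slice.apply] at hl
    | cons e sv => exact localEq_zigzagRight s su sv e g d
  | zigzagLeft i g d =>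
    obtain ⟨su, sv, rfl, h⟩ := split_cup hl
    obtain ⟨su, e, rfl, rfl⟩ := split_last h
    rw [List.append_assoc]
    exact localEq_zigzagLeft s su sv e g d
  | slideCup i g d x =>
    obtain ⟨su, sv, rfl, rfl⟩ := split_cup hl
    cases sv with
    | nil => simp [run, Slice.apply] at hl
    | cons e sv => exact localEq_slideCup s su sv e g d x
  | slideCap i x =>
    obtain ⟨su, b, c, sv, rfl, h⟩ := split_two rfl hl
    obtain ⟨su, a, rfl, rfl⟩ := split_last h
    rw [List.append_assoc]
    exact localEq_slideCap s su sv a b c x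
  | kinkCup i g d x =>
    obtain ⟨su, sv, rfl, rfl⟩ := split_cup hl
    exact localEq_kinkCup s su sv g d x
  | kinkCap i x =>
    obtain ⟨su, a, b, sv, rfl, rfl⟩ := split_two rfl hl
    exact localEq_kinkCap s su sv a b x
  | cancel i x =>
    obtain ⟨su, a, b, sv, rfl, rfl⟩ := split_two rfl hl
    exact localEq_cancel s su sv a b x
  | braid i x y z h =>
    obtain ⟨su, a, b, sv, rfl, rfl⟩ := split_two rfl hl
    cases sv with
    | nil => simp [run, Slice.apply] at hl
    | cons c sv => exact localEq_braid s su sv a b c x y z h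

end Local
end Conway

namespace Conway

/-! ### Exterior algebra programs and determinants. -/

section FockDet
variable {ι : Type} {R : Type} [CommRing R]

/-- Exterior multiplication by the linear form `r` in the variables `L`. -/
def cr : List ι → (ι → R) → (List Bool → R) → List Bool → R
  | a :: L, r, ψ, true :: σ => r a * ψ (false :: σ) - cr L r (fun τ => ψ (true :: τ)) σ
  | _ :: L, r, ψ, false :: σ => cr L r (fun τ => ψ (false :: τ)) σ
  | _, _, _, _ => 0

/-- Insert two unoccupied variables. -/
def birthF : ℕ → (List Bool → R) → List Bool → R
  | 0, ψ, false :: false :: σ => ψ σ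
  | i + 1, ψ, b :: σ => birthF i (fun τ => ψ (b :: τ)) σ
  | _, _, _ => 0

/-- Extract the coefficient of two occupied variables. -/
def consumeF : ℕ → (List Bool → R) → List Bool → R
  | 0, ψ, σ => ψ (true :: true :: σ)
  | i + 1, ψ, b :: σ => consumeF i (fun τ => ψ (b :: τ)) σ
  | _ + 1, _, [] => 0

/-- The instructions of a program that builds a determinant row by row. -/
inductive Instr (ι ρ : Type) : Type
  | birth (i : ℕ) (a b : ι) : Instr ι ρ
  | row (x : ρ) : Instr ι ρ
  | consume (i : ℕ) : Instr ι ρ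

variable {ρ : Type}

/-- Run a program. -/
def exec (f : ρ → ι → R) : List (Instr ι ρ) → List ι → (List Bool → R) → List Bool → R
  | [], _, ψ => ψ
  | .birth i a b :: P, L, ψ => exec f P (L.take i ++ a :: b :: L.drop i) (birthF i ψ)
  | .row x :: P, L, ψ => exec f P L (cr L (f x) ψ)
  | .consume i :: P, L, ψ => exec f P (L.take i ++ L.drop (i + 2)) (consumeF i ψ)

/-- The variables introduced by a program. -/
def births : List (Instr ι ρ) → List ι
  | [] => []
  | .birth _ a b :: P => a :: b :: births P
  | .row _ :: P => births P
  | .consume _ :: P => births P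

/-- The rows of a program. -/
def rowsOf : List (Instr ι ρ) → List ρ
  | [] => []
  | .birth _ _ _ :: P => rowsOf P
  | .row x :: P => x :: rowsOf P
  | .consume _ :: P => rowsOf P

/-- A program fits the list of current variables, and no row involves variables that are already
consumed or not yet introduced. -/
def WellFormed (f : ρ → ι → R) : List (Instr ι ρ) → List ι → Prop
  | [], L => L = []
  | .birth i a b :: P, L =>
      ∃ u v, L = u ++ v ∧ u.length = i ∧ WellFormed f P (u ++ a :: b :: v)
  | .row x :: P, L => (∀ e ∈ births P, f x e = 0) ∧ WellFormed f P L
  | .consume i :: P, L => ∃ u a b v, L = u ++ a :: b :: v ∧ u.length = i ∧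
      (∀ x ∈ rowsOf P, f x a = 0 ∧ f x b = 0) ∧ WellFormed f P (u ++ v)

/-- The flagged variables. -/
def olds : List (ι × Bool) → List ι
  | [] => []
  | (a, true) :: F => a :: olds F
  | (_, false) :: F => olds F

/-- Extend a function of the occupation numbers of the flagged variables to all variables. -/
def extendF : List (ι × Bool) → (List Bool → R) → List Bool → R
  | [], ψ, σ => ψ σ
  | (_, true) :: F, ψ, b :: σ => extendF F (fun τ => ψ (b :: τ)) σ
  | (_, false) :: F, ψ, false :: σ => extendF F ψ σ
  | _ :: _, _, _ => 0

theorem cr_zero (L : List ι) (r : ι → R) : cr L r (fun _ => 0) = fun _ => 0 := by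
  induction L with
  | nil => funext σ; simp [cr]
  | cons a L ih =>
    funext σ
    obtain _ | ⟨_ | _, σ⟩ := σ <;> simp [cr, ih]

theorem cr_add (L : List ι) (r : ι → R) (φ ψ : List Bool → R) (σ : List Bool) :
    cr L r (fun τ => φ τ + ψ τ) σ = cr L r φ σ + cr L r ψ σ := by
  induction L generalizing φ ψ σ with
  | nil => simp [cr]
  | cons a L ih =>
    obtain _ | ⟨_ | _, σ⟩ := σ <;> simp [cr, ih]
    ring

theorem cr_smul (L : List ι) (r : ι → R) (c : R) (ψ : List Bool → R) (σ : List Bool) :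
    cr L r (fun τ => c * ψ τ) σ = c * cr L r ψ σ := by
  induction L generalizing ψ σ with
  | nil => simp [cr]
  | cons a L ih =>
    obtain _ | ⟨_ | _, σ⟩ := σ <;> simp [cr, ih]
    ring

theorem cr_sum {κ : Type} (s : Finset κ) (L : List ι) (r : ι → R) (ψ : κ → List Bool → R)
    (σ : List Bool) : cr L r (fun τ => ∑ j ∈ s, ψ j τ) σ = ∑ j ∈ s, cr L r (ψ j) σ := by
  classical
  induction s using Finset.induction_on with
  | empty => simpa using congrFun (cr_zero L r) σ
  | insert a s ha ih => simp only [Finset.sum_insert ha, cr_add, ih]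

theorem extendF_zero (F : List (ι × Bool)) : extendF F (fun _ => (0 : R)) = fun _ => 0 := by
  induction F with
  | nil => rfl
  | cons a F ih =>
    funext σ
    obtain ⟨a, _ | _⟩ := a <;> obtain _ | ⟨_ | _, σ⟩ := σ <;> simp [extendF, ih]

/-- A form without unflagged variables does not notice whether these are already present and
unoccupied; no sign arises from passing unoccupied variables. -/
theorem cr_extendF (F : List (ι × Bool)) (r : ι → R) (h : ∀ e ∈ F, e.2 = false → r e.1 = 0)
    (ψ : List Bool → R) : cr (F.map Prod.fst) r (extendF F ψ) = extendF F (cr (olds F) r ψ) := by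
  induction F generalizing ψ with
  | nil => funext σ; simp [cr, extendF, olds]
  | cons a F ih =>
    have ih := ih fun e he => h e (by simp [he])
    funext σ
    obtain ⟨a, _ | _⟩ := a
    · have ha : r a = 0 := h (a, false) (by simp) rfl
      obtain _ | ⟨_ | _, σ⟩ := σ
      · simp [cr, extendF]
      · simp only [List.map_cons, cr, extendF, olds]
        exact congrFun (ih ψ) σ
      · simp [cr, extendF, ha, cr_zero]
    · obtain _ | ⟨_ | _, σ⟩ := σ
      · simp [cr, extendF]
      · simp only [List.map_cons, cr, extendF, olds]
        exact congrFun (ih _) σ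
      · simp only [List.map_cons, cr, extendF, olds]
        rw [congrFun (ih _) σ]
        have e1 : (fun τ => r a * ψ (false :: τ) - cr (olds F) r (fun τ => ψ (true :: τ)) τ) =
          fun τ => (r a * ψ (false :: τ)) + (-1) * cr (olds F) r (fun τ => ψ (true :: τ)) τ := by
            funext τ; ring
        have lin : ∀ (G : List (ι × Bool)) (c d : R) (φ χ : List Bool → R) (σ : List Bool),
            extendF G (fun τ => c * φ τ + d * χ τ) σ = c * extendF G φ σ + d * extendF G χ σ := by
          intro G
          induction G with
          | nil => intros; rfl
          | cons g G ihG =>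
            intro c d φ χ σ
            obtain ⟨g, _ | _⟩ := g <;> obtain _ | ⟨_ | _, σ⟩ := σ <;> simp [extendF, ihG]
        rw [e1, lin]
        ring

theorem olds_append (F G : List (ι × Bool)) : olds (F ++ G) = olds F ++ olds G := by
  induction F with
  | nil => rfl
  | cons a F ih => obtain ⟨a, _ | _⟩ := a <;> simp [olds, ih]

theorem olds_split (F : List (ι × Bool)) (u v : List ι) (h : olds F = u ++ v) :
    ∃ F₁ F₂, F = F₁ ++ F₂ ∧ olds F₁ = u ∧ olds F₂ = v := by
  induction F generalizing u with
  | nil =>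
    simp [olds] at h
    exact ⟨[], [], rfl, by simp [olds, h], by simp [olds, h]⟩
  | cons a F ih =>
    obtain ⟨a, _ | _⟩ := a
    · obtain ⟨F₁, F₂, rfl, h1, h2⟩ := ih u h
      exact ⟨(a, false) :: F₁, F₂, rfl, h1, h2⟩
    · cases u with
      | nil => exact ⟨[], (a, true) :: F, rfl, rfl, h⟩
      | cons c u =>
        simp [olds] at h
        obtain ⟨F₁, F₂, rfl, h1, h2⟩ := ih u h.2
        exact ⟨(a, true) :: F₁, F₂, rfl, by simp [olds, h1, h.1], h2⟩

theorem olds_split_cons (F : List (ι × Bool)) (a : ι) (v : List ι) (h : olds F = a :: v) :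
    ∃ F₁ F₂, F = F₁ ++ (a, true) :: F₂ ∧ olds F₁ = [] ∧ olds F₂ = v := by
  induction F with
  | nil => simp [olds] at h
  | cons c F ih =>
    obtain ⟨c, _ | _⟩ := c
    · obtain ⟨F₁, F₂, rfl, h1, h2⟩ := ih h
      exact ⟨(c, false) :: F₁, F₂, rfl, h1, h2⟩
    · simp [olds] at h
      exact ⟨[], F, by simp [h.1], rfl, h.2⟩

/-- Introducing two unoccupied variables amounts to removing their flags. They need not be adjacent
in the full list: `F₂` may hold variables born later. -/
theorem extendF_birth (F₁ F₂ F₃ : List (ι × Bool)) (a b : ι) (h : olds F₂ = [])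
    (ψ : List Bool → R) :
    extendF (F₁ ++ (a, true) :: (F₂ ++ (b, true) :: F₃)) (birthF (olds F₁).length ψ) =
      extendF (F₁ ++ (a, false) :: (F₂ ++ (b, false) :: F₃)) ψ := by
  induction F₁ generalizing ψ with
  | cons c F ih =>
    funext σ
    obtain ⟨c, _ | _⟩ := c <;> obtain _ | ⟨_ | _, σ⟩ := σ <;>
      simp [extendF, olds, birthF, ih]
  | nil =>
    have h2 : ∀ p : Bool, extendF (F₂ ++ (b, true) :: F₃) (fun τ => birthF 0 ψ (p :: τ)) =
        fun σ => if p then 0 else extendF (F₂ ++ (b, false) :: F₃) ψ σ := by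
      intro p
      induction F₂ with
      | cons c F ih =>
        obtain ⟨c, _ | _⟩ := c
        · have ih := ih h
          funext σ
          obtain _ | ⟨_ | _, σ⟩ := σ <;> simp [extendF, ih]
        · simp [olds] at h
      | nil =>
        funext σ
        cases p <;> obtain _ | ⟨_ | _, σ⟩ := σ <;> simp [extendF, birthF, extendF_zero]
    funext σ
    obtain _ | ⟨_ | _, σ⟩ := σ <;> simp [extendF, olds, h2]

theorem consumeF_extendF (F₁ F₂ : List (ι × Bool)) (a b : ι) (ψ : List Bool → R) :
    consumeF F₁.length (extendF (F₁ ++ (a, true) :: (b, true) :: F₂) ψ) =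
      extendF (F₁ ++ F₂) (consumeF (olds F₁).length ψ) := by
  induction F₁ generalizing ψ with
  | nil => funext σ; simp [consumeF, extendF, olds]
  | cons c F ih =>
    have h0 : ∀ i, consumeF i (fun _ : List Bool => (0 : R)) = fun _ => 0 := by
      intro i
      induction i with
      | zero => rfl
      | succ i ih => funext σ; cases σ <;> simp [consumeF, ih]
    funext σ
    obtain ⟨c, _ | _⟩ := c <;> obtain _ | ⟨_ | _, σ⟩ := σ <;>
      simp [extendF, olds, consumeF, ih, h0]

/-- Two occupied variables are passed at once, so their signs cancel; extraction can be postponed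
past every form that does not involve them. -/
theorem consumeF_cr (L₁ L₂ : List ι) (a b : ι) (r : ι → R) (ha : r a = 0) (hb : r b = 0)
    (ψ : List Bool → R) :
    consumeF L₁.length (cr (L₁ ++ a :: b :: L₂) r ψ) =
      cr (L₁ ++ L₂) r (consumeF L₁.length ψ) := by
  induction L₁ generalizing ψ with
  | nil => funext σ; simp [consumeF, cr, ha, hb]
  | cons c L ih =>
    have h0 : ∀ i (φ χ : List Bool → R) (c : R) σ, consumeF i (fun τ => c * φ τ - χ τ) σ =
        c * consumeF i φ σ - consumeF i χ σ := by
      intro i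
      induction i with
      | zero => intros; rfl
      | succ i ih => intro φ χ c σ; cases σ <;> simp [consumeF, ih]
    funext σ
    obtain _ | ⟨_ | _, σ⟩ := σ <;>
      simp [consumeF, cr, ih, h0]

/-- Multiply by several linear forms. -/
def crs (f : ρ → ι → R) (L : List ι) (xs : List ρ) (ψ : List Bool → R) : List Bool → R :=
  xs.foldl (fun φ x => cr L (f x) φ) ψ

theorem consumeF_crs (f : ρ → ι → R) (L₁ L₂ : List ι) (a b : ι) (xs : List ρ)
    (h : ∀ x ∈ xs, f x a = 0 ∧ f x b = 0) (ψ : List Bool → R) :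
    consumeF L₁.length (crs f (L₁ ++ a :: b :: L₂) xs ψ) =
      crs f (L₁ ++ L₂) xs (consumeF L₁.length ψ) := by
  induction xs generalizing ψ with
  | nil => rfl
  | cons x xs ih =>
    have := h x (by simp)
    simp only [crs, List.foldl_cons] at ih ⊢
    rw [ih (fun y hy => h y (by simp [hy])), consumeF_cr _ _ _ _ _ this.1 this.2]

theorem consumeF_replicate (i m : ℕ) (h : i ≤ m) (ψ : List Bool → R) :
    consumeF i ψ (List.replicate m true) = ψ (List.replicate (m + 2) true) := by
  induction i generalizing m ψ with
  | zero => rfl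
  | succ i ih =>
    obtain _ | m := m
    · omega
    · simp only [List.replicate_succ, consumeF] at ih ⊢
      rw [ih m (by omega)]

/-- All births can be moved to the start and all extractions to the end, so the program takes the
top coefficient of the product of its forms in a single ordered list `F` of variables. The form `f₀`
only certifies that positions fit; `F` is chosen before `f`, so that different forms share the same
order of columns. -/
theorem exec_eq_crs (P : List (Instr ι ρ)) (L : List ι) (f₀ : ρ → ι → R)
    (h₀ : WellFormed f₀ P L) :
    ∃ F : List (ι × Bool), olds F = L ∧ (∀ e ∈ F, e.2 = false → e.1 ∈ births P) ∧
      ∀ f : ρ → ι → R, WellFormed f P L → ∀ ψ, exec f P L ψ [] =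
        crs f (F.map Prod.fst) (rowsOf P) (extendF F ψ) (List.replicate F.length true) := by
  induction P generalizing L with
  | nil =>
    simp only [WellFormed] at h₀
    subst h₀
    exact ⟨[], rfl, by simp, fun f _ ψ => by simp [exec, crs, rowsOf, extendF]⟩
  | cons c P ih =>
    cases c with
    | birth i a b =>
      obtain ⟨u, v, rfl, rfl, h₀⟩ := h₀
      obtain ⟨F, hF, hF2, hF3⟩ := ih _ h₀
      obtain ⟨F₁, F', rfl, rfl, h2⟩ := olds_split F _ _ hF
      obtain ⟨Fx, F', rfl, h3, h4⟩ := olds_split_cons F' _ _ h2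
      obtain ⟨F₂, F₃, rfl, h5, rfl⟩ := olds_split_cons F' _ _ h4
      -- `Fx` and `F₂` contain no flagged variables; seen from before the birth, `a` and `b` become
      -- future variables too.
      refine ⟨(F₁ ++ Fx) ++ (a, false) :: (F₂ ++ (b, false) :: F₃), ?_, ?_, ?_⟩
      · simp [olds_append, olds, h3, h5]
      · intro e he he2
        simp only [births, List.mem_cons]
        simp only [List.mem_append, List.mem_cons] at he hF2
        rcases he with (he | he) | rfl | he | rfl | he
        · exact .inr (.inr (hF2 e (by tauto) he2))
        · exact .inr (.inr (hF2 e (by tauto) he2))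
        · exact .inl rfl
        · exact .inr (.inr (hF2 e (by tauto) he2))
        · exact .inr (.inl rfl)
        · exact .inr (.inr (hF2 e (by tauto) he2))
      · rintro f ⟨u', v', huv, hu, hf⟩ ψ
        obtain ⟨rfl, rfl⟩ := List.append_inj huv.symm hu
        have := hF3 f hf (birthF (olds F₁).length ψ)
        simp only [exec, List.take_left, List.drop_left, rowsOf]
        rw [this]
        have key := extendF_birth (F₁ ++ Fx) F₂ F₃ a b h5 ψ
        rw [olds_append, h3, List.append_nil, List.append_assoc] at key
        rw [key]
        simp
    | row x =>
      obtain ⟨-, h₀⟩ := h₀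
      obtain ⟨F, rfl, hF2, hF3⟩ := ih _ h₀
      refine ⟨F, rfl, hF2, ?_⟩
      rintro f ⟨hf, hf2⟩ ψ
      simp only [exec, rowsOf, crs, List.foldl_cons] at hF3 ⊢
      rw [hF3 f hf2, cr_extendF F _ fun e he he2 => hf _ (hF2 e he he2)]
    | consume i =>
      obtain ⟨u, a, b, v, rfl, rfl, -, h₀⟩ := h₀
      obtain ⟨F, hF, hF2, hF3⟩ := ih _ h₀
      obtain ⟨F₁, F₂, rfl, rfl, rfl⟩ := olds_split F _ _ hF
      -- The consumed variables are put back next to each other, which makes their extraction free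
      -- of signs.
      refine ⟨F₁ ++ (a, true) :: (b, true) :: F₂, by simp [olds_append, olds], ?_, ?_⟩
      · intro e he he2
        simp only [births]
        apply hF2 e _ he2
        simp at he ⊢
        rcases he with he | rfl | rfl | he <;> simp_all
      · rintro f ⟨u', a', b', v', huv, hu, hf, hf2⟩ ψ
        obtain ⟨rfl, h⟩ := List.append_inj huv.symm hu
        simp only [List.cons.injEq] at h
        obtain ⟨rfl, rfl, rfl⟩ := h
        have e1 : (olds F₁ ++ a' :: b' :: olds F₂).drop ((olds F₁).length + 2) = olds F₂ := by
          rw [← List.drop_drop, List.drop_left]; rfl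
        simp only [exec, List.take_left, e1, rowsOf]
        rw [hF3 f hf2, ← consumeF_extendF F₁ F₂ a' b' ψ, List.map_append]
        have := consumeF_crs f (F₁.map Prod.fst) (F₂.map Prod.fst) a' b' (rowsOf P) hf
          (extendF (F₁ ++ (a', true) :: (b', true) :: F₂) ψ)
        rw [List.length_map] at this
        rw [← this, consumeF_replicate _ _ (by simp)]
        simp [Nat.add_assoc, add_comm, add_left_comm]

/-- The function supported on the empty configuration. -/
def vacF : List Bool → R
  | [] => 1
  | true :: _ => 0
  | false :: σ => vacF σ

theorem extendF_vac (F : List (ι × Bool)) (h : olds F = []) (ψ : List Bool → R) (σ : List Bool)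
    (hσ : σ.length = F.length) : extendF F ψ σ = ψ [] * vacF σ := by
  induction F generalizing σ with
  | nil => simp at hσ; subst hσ; simp [extendF, vacF]
  | cons a F ih =>
    obtain ⟨a, _ | _⟩ := a
    · obtain _ | ⟨_ | _, σ⟩ := σ
      · simp at hσ
      · exact ih h σ (by simpa using hσ)
      · simp [extendF, vacF]
    · simp [olds] at h

/-- The product of the linear forms `f 0, …, f (m - 1)`, as a function of the occupation numbers
of the variables `L`. -/
def wedge (L : List ι) : (m : ℕ) → (Fin m → ι → R) → List Bool → R
  | 0, _ => vacF
  | m + 1, f => cr L (f 0) (wedge L m fun i => f i.succ)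

theorem wedge_cons_false (a : ι) (L : List ι) (m : ℕ) (f : Fin m → ι → R) (σ : List Bool) :
    wedge (a :: L) m f (false :: σ) = wedge L m f σ := by
  induction m generalizing σ with
  | zero => rfl
  | succ m ih =>
    simp only [wedge, cr]
    congr 1
    funext τ
    exact ih _ τ

/-- Laplace expansion along the first column: the form that supplies `a` is moved to the front past
the `j` forms before it. -/
theorem wedge_cons_true (a : ι) (L : List ι) (m : ℕ) (f : Fin (m + 1) → ι → R) (σ : List Bool) :
    wedge (a :: L) (m + 1) f (true :: σ) =
      ∑ j : Fin (m + 1), (-1) ^ (j : ℕ) * f j a * wedge L m (fun i => f (j.succAbove i)) σ := by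
  induction m generalizing σ with
  | zero =>
    have h : (fun τ => (wedge (a :: L) 0 (fun i => f i.succ) (true :: τ) : R)) = fun _ => 0 := rfl
    rw [wedge, cr, h, cr_zero]
    simp [wedge, vacF]
  | succ m ih =>
    rw [wedge, cr]
    simp only [ih]
    rw [cr_sum, wedge_cons_false, sub_eq_add_neg, ← Finset.sum_neg_distrib]
    refine Eq.trans ?_ (Fin.sum_univ_succ _).symm
    congr 1
    · simp
    · refine Finset.sum_congr rfl fun j _ => ?_
      rw [cr_smul, wedge]
      simp [pow_succ]

theorem wedge_eq_det (m : ℕ) (f : Fin m → ι → R) (l : Fin m → ι) :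
    wedge (List.ofFn l) m f (List.replicate m true) = (Matrix.of fun i j => f i (l j)).det := by
  induction m with
  | zero => simp [wedge, vacF]
  | succ m ih =>
    rw [List.ofFn_succ, List.replicate_succ, wedge_cons_true, Matrix.det_succ_column_zero]
    refine Finset.sum_congr rfl fun j _ => ?_
    rw [ih]
    rfl

theorem cr_support (L : List ι) (r : ι → R) (m : ℕ) (ψ : List Bool → R)
    (h : ∀ σ, σ.count true ≠ m → ψ σ = 0) (σ : List Bool) (hσ : σ.count true ≠ m + 1) :
    cr L r ψ σ = 0 := by
  induction L generalizing m ψ σ with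
  | nil => simp [cr]
  | cons a L ih =>
    obtain _ | ⟨_ | _, σ⟩ := σ
    · simp [cr]
    · simp only [cr]
      exact ih m _ (fun τ hτ => h _ (by simpa using hτ)) σ (by simpa using hσ)
    · simp only [List.count_cons_self, ne_eq, Nat.add_right_cancel_iff] at hσ
      simp only [cr, h (false :: σ) (by simpa using hσ)]
      cases m with
      | zero =>
        have : (fun τ => ψ (true :: τ)) = fun _ => 0 := by
          funext τ
          exact h _ (by simp)
        simp [this, cr_zero]
      | succ m =>
        rw [ih m _ (fun τ hτ => h _ (by simpa using hτ)) σ hσ]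
        simp

theorem wedge_support (L : List ι) (m : ℕ) (f : Fin m → ι → R) (σ : List Bool)
    (hσ : σ.count true ≠ m) : wedge L m f σ = 0 := by
  induction m generalizing σ with
  | zero =>
    induction σ with
    | nil => simp at hσ
    | cons b σ ih =>
      cases b
      · exact ih (by simpa using hσ)
      · rfl
  | succ m ih => exact cr_support L _ m _ (fun τ hτ => ih _ τ hτ) σ hσ

theorem cr_congr (L : List ι) (r : ι → R) (φ ψ : List Bool → R)
    (h : ∀ σ, σ.length = L.length → φ σ = ψ σ) (σ : List Bool) (hσ : σ.length = L.length) :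
    cr L r φ σ = cr L r ψ σ := by
  induction L generalizing φ ψ σ with
  | nil => simp [cr]
  | cons a L ih =>
    obtain _ | ⟨_ | _, σ⟩ := σ
    · simp [cr]
    · simp only [cr]
      exact ih _ _ (fun τ hτ => h _ (by simpa using hτ)) σ (by simpa using hσ)
    · simp only [cr]
      rw [ih _ _ (fun τ hτ => h _ (by simpa using hτ)) σ (by simpa using hσ),
        h _ (by simpa using hσ)]

/-- Each multiplication acts from the left, so the form applied last is the first factor of the
product; hence the reversal of `xs`. -/
theorem crs_eq_wedge (f : ρ → ι → R) (L : List ι) (xs : List ρ) (m : ℕ) (x : Fin m → ρ)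
    (h : xs.reverse = List.ofFn x) (c : R) (ψ : List Bool → R)
    (hψ : ∀ σ, σ.length = L.length → ψ σ = c * vacF σ) (σ : List Bool)
    (hσ : σ.length = L.length) :
    crs f L xs ψ σ = c * wedge L m (fun i => f (x i)) σ := by
  induction m generalizing xs σ with
  | zero =>
    simp at h
    subst h
    exact hψ σ hσ
  | succ m ih =>
    rw [List.ofFn_succ, List.reverse_eq_cons_iff] at h
    subst h
    rw [crs, List.foldl_append]
    simp only [List.foldl_cons, List.foldl_nil, wedge]
    rw [← cr_smul]
    refine cr_congr _ _ _ _ (fun τ hτ => ?_) σ hσ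
    exact ih _ (fun i => x i.succ) (by simp) τ hτ

/-- The value of a program without free variables is a determinant. -/
theorem exec_eq_det (P : List (Instr ι ρ)) (m : ℕ) (x : Fin m → ρ)
    (hx : (rowsOf P).reverse = List.ofFn x) (f₀ : ρ → ι → R) (h₀ : WellFormed f₀ P [])
    (ψ₀ : List Bool → R) (hf₀ : exec f₀ P [] ψ₀ [] ≠ 0) :
    ∃ l : Fin m → ι, ∀ f : ρ → ι → R, WellFormed f P [] → ∀ ψ,
      exec f P [] ψ [] = ψ [] * (Matrix.of fun i j => f (x i) (l j)).det := by
  obtain ⟨F, hF, -, h⟩ := exec_eq_crs P [] f₀ h₀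
  have key : ∀ f : ρ → ι → R, WellFormed f P [] → ∀ ψ, exec f P [] ψ [] =
      ψ [] * wedge (F.map Prod.fst) m (fun i => f (x i)) (List.replicate F.length true) := by
    intro f hf ψ
    rw [h f hf ψ]
    refine crs_eq_wedge f _ _ m x hx _ _ (fun σ hσ => ?_) _ (by simp)
    exact extendF_vac F hF ψ σ (by simpa using hσ)
  -- The product of `m` forms has degree `m`; its top coefficient could not be nonzero for `f₀` if
  -- the number of variables were different.
  have hm : F.length = m := by
    by_contra hm
    apply hf₀
    rw [key f₀ h₀, wedge_support _ _ _ _ (by simpa using hm), mul_zero]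
  subst hm
  refine ⟨fun i => (F.get i).1, fun f hf ψ => ?_⟩
  rw [key f hf, ← wedge_eq_det]
  congr 2
  apply List.ext_get <;> simp

end FockDet
end Conway

namespace Conway

/-! ### The effect of one or two relations on the exterior algebra. -/

section Program
variable {ι : Type} {R : Type} [CommRing R]

/-- The sign of moving an odd operator past occupied variables. -/
def occSign : List Bool → R
  | [] => 1
  | b :: σ => (if b then -1 else 1) * occSign σ

theorem occSign_mul_self (σ : List Bool) : (occSign σ * occSign σ : R) = 1 := by
  induction σ with
  | nil => simp [occSign]
  | cons b σ ih =>
    simp only [occSign]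
    rw [mul_mul_mul_comm, ih]
    cases b <;> simp

theorem occSign_isUnit (σ : List Bool) : IsUnit (occSign σ : R) :=
  IsUnit.of_mul_eq_one _ (occSign_mul_self σ)

theorem cr_append (L M : List ι) (r : ι → R) (h : ∀ e ∈ L, r e = 0) (ψ : List Bool → R)
    (u σ : List Bool) (hu : u.length = L.length) :
    cr (L ++ M) r ψ (u ++ σ) = occSign u * cr M r (fun τ => ψ (u ++ τ)) σ := by
  induction L generalizing u ψ with
  | nil => simp at hu; subst hu; simp [occSign]
  | cons a L ih =>
    obtain _ | ⟨b, u⟩ := u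
    · simp at hu
    · have ih := ih (fun e he => h e (by simp [he])) (fun τ => ψ (b :: τ)) u (by simpa using hu)
      have ha : r a = 0 := h a (by simp)
      cases b <;> simp [cr, occSign, ih, ha]

theorem cr_eq_zero (L : List ι) (r : ι → R) (h : ∀ e ∈ L, r e = 0) (ψ : List Bool → R) :
    cr L r ψ = fun _ => 0 := by
  induction L generalizing ψ with
  | nil => funext σ; simp [cr]
  | cons a L ih =>
    have ih := ih fun e he => h e (by simp [he])
    have ha : r a = 0 := h a (by simp)
    funext σ
    obtain _ | ⟨_ | _, σ⟩ := σ <;> simp [cr, ih, ha]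

theorem birthF_append (u : List Bool) (j : ℕ) (ψ : List Bool → R) (σ : List Bool) :
    birthF (u.length + j) ψ (u ++ σ) = birthF j (fun τ => ψ (u ++ τ)) σ := by
  induction u generalizing ψ with
  | nil => simp
  | cons b u ih =>
    rw [List.length_cons, Nat.add_right_comm]
    exact ih _

theorem consumeF_append (u : List Bool) (j : ℕ) (ψ : List Bool → R) (σ : List Bool) :
    consumeF (u.length + j) ψ (u ++ σ) = consumeF j (fun τ => ψ (u ++ τ)) σ := by
  induction u generalizing ψ with
  | nil => simp
  | cons b u ih =>
    rw [List.length_cons, Nat.add_right_comm]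
    exact ih _

theorem row_cup (Lu Lv : List ι) (a b : ι) (r : ι → R) (hLu : ∀ e ∈ Lu, r e = 0)
    (hLv : ∀ e ∈ Lv, r e = 0) (ψ : List Bool → R) (u v : List Bool) (x y : Bool)
    (hu : u.length = Lu.length) :
    cr (Lu ++ a :: b :: Lv) r (birthF Lu.length ψ) (u ++ x :: y :: v) =
      occSign u * (match x, y with
        | true, false => r a
        | false, true => r b
        | _, _ => 0) * ψ (u ++ v) := by
  rw [cr_append _ _ _ hLu _ _ _ hu, ← hu]
  have h := fun τ => birthF_append u 0 ψ τ
  simp only [add_zero] at h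
  simp only [h]
  cases x <;> cases y <;> simp [cr, birthF, cr_eq_zero Lv r hLv] <;> ring

theorem row_cap (Lu Lv : List ι) (a b : ι) (r : ι → R) (hLu : ∀ e ∈ Lu, r e = 0)
    (hLv : ∀ e ∈ Lv, r e = 0) (ψ : List Bool → R) (u v : List Bool)
    (hu : u.length = Lu.length) :
    consumeF Lu.length (cr (Lu ++ a :: b :: Lv) r ψ) (u ++ v) =
      occSign u * (r a * ψ (u ++ false :: true :: v) - r b * ψ (u ++ true :: false :: v)) := by
  have h := consumeF_append u 0 (cr (Lu ++ a :: b :: Lv) r ψ) v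
  rw [add_zero, hu] at h
  rw [h]
  simp only [consumeF]
  rw [cr_append _ _ _ hLu _ _ _ hu]
  simp [cr, cr_eq_zero Lv r hLv]

/-- The weights are the 2×2 minors of the two forms. Both forms pass the occupied variables on the
left, so the two signs `occSign u` cancel and a crossing is even, in contrast to a minimum or a
maximum. -/
theorem row_cross (Lu Lv : List ι) (a b c d : ι) (r₁ r₂ : ι → R)
    (hLu : ∀ e ∈ Lu, r₁ e = 0 ∧ r₂ e = 0) (hLv : ∀ e ∈ Lv, r₁ e = 0 ∧ r₂ e = 0)
    (ψ : List Bool → R) (u v : List Bool) (x y : Bool) (hu : u.length = Lu.length) :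
    consumeF Lu.length (cr (Lu ++ a :: b :: c :: d :: Lv) r₂
      (cr (Lu ++ a :: b :: c :: d :: Lv) r₁ (birthF (Lu.length + 2) ψ))) (u ++ x :: y :: v) =
      match x, y with
        | false, false => (r₂ a * r₁ b - r₂ b * r₁ a) * ψ (u ++ false :: false :: v)
        | true, false => (r₂ b * r₁ c - r₂ c * r₁ b) * ψ (u ++ true :: false :: v) -
            (r₂ a * r₁ c - r₂ c * r₁ a) * ψ (u ++ false :: true :: v)
        | false, true => (r₂ b * r₁ d - r₂ d * r₁ b) * ψ (u ++ true :: false :: v) -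
            (r₂ a * r₁ d - r₂ d * r₁ a) * ψ (u ++ false :: true :: v)
        | true, true => (r₂ c * r₁ d - r₂ d * r₁ c) * ψ (u ++ true :: true :: v) := by
  have h := consumeF_append u 0 (cr (Lu ++ a :: b :: c :: d :: Lv) r₂
      (cr (Lu ++ a :: b :: c :: d :: Lv) r₁ (birthF (Lu.length + 2) ψ))) (x :: y :: v)
  rw [add_zero, hu] at h
  rw [h]
  simp only [consumeF]
  rw [cr_append _ _ _ (fun e he => (hLu e he).2) _ _ _ hu]
  simp only [cr_append _ _ _ (fun e he => (hLu e he).1) _ _ _ hu]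
  rw [cr_smul, ← mul_assoc, occSign_mul_self, one_mul]
  have h1 := fun τ => birthF_append u 2 ψ τ
  rw [hu] at h1
  simp only [h1]
  cases x <;> cases y <;>
    simp [cr, birthF, cr_eq_zero Lv r₁ (fun e he => (hLv e he).1),
      cr_eq_zero Lv r₂ (fun e he => (hLv e he).2)] <;> ring

end Program

/-! ### The linear relations of a slice, and their agreement with its operator. -/

section Program
variable {n : ℕ} {R : Type} [CommRing R] (s : Fin n → Rˣ)

/-- The point at which an edge of the underlying graph of a diagram is born. -/
abbrev Name := ℕ × ℕ

/-- A linear relation between the edges at a cup, a cap or a crossing: `rel` is the relation, `out`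
the edge that leaves the piece and `inn` the edge that enters it (along the same strand),
`wt` a weight, `weight` the factor by which it differs from the Wirtinger relation, `tag` the level of the crossing for the relation at an undercrossing, and `mult` the
multiplicity of the relation in the relation between the relations. -/
structure Row (R : Type) [Monoid R] where
  rel : Name → R
  out : Name
  inn : Name
  wt : R
  weight : Rˣ
  tag : Option ℕ
  mult : R

/-- The coordinate form of a name. -/
def coord (a e : Name) : R := if e = a then 1 else 0

/-- The image of the word read across the strands of a list. -/
def holProd (l : List (Strand n)) : R := (l.map fun a => ((hol s a ^ 2 : Rˣ) : R)).prod

/-- The Fox differential of the relation `y_a * y_b = 1`, where `y_a` and `y_b` are the letters read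
from left to right across the two legs. -/
def cupRow (g : Fin n) (d : Bool) (p : R) (a b : Name) : Row R where
  rel e := coord a e + (hol s (g, d)) ^ 2 * coord b e
  out := if d then a else b
  inn := if d then b else a
  wt := cupWt s g d
  weight := if d then 1 else s g
  tag := none
  mult := p

/-- The same relation as at a minimum. Its multiplicity is negative because the two edges disappear
from the level sum instead of entering it. -/
def capRow (x : Strand n) (p : R) (a b : Name) : Row R where
  rel e := coord a e + (hol s x) ^ 2 * coord b e
  out := if x.2 then b else a
  inn := if x.2 then a else b
  wt := if x.2 then s x.1 else 1
  weight := if x.2 then (s x.1)⁻¹ else 1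
  tag := none
  mult := -p

/-- The relation for the line passing over, from the lower edge `a` to the upper edge `d`. -/
def overRow (x : Strand n) (p : R) (a d : Name) : Row R where
  rel e := coord d e - coord a e
  out := if x.2 then d else a
  inn := if x.2 then a else d
  wt := if x.2 then 1 else -1
  weight := 1
  tag := none
  mult := p

/-- The relation for the line passing under from bottom right to top left. -/
def underRowTrue (k : ℕ) (x y : Strand n) (p : R) (a b c : Name) : Row R where
  rel e := ((hol s x)⁻¹ : Rˣ) * coord c e - ((hol s x)⁻¹ : Rˣ) * (1 - hol s y ^ 2) * coord a e -
    hol s x * coord b e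
  out := if y.2 then c else b
  inn := if y.2 then b else c
  wt := if y.2 then 1 else -1
  weight := (s x.1)⁻¹
  tag := some k
  mult := p * hol s x

/-- The relation for the line passing under from bottom left to top right. -/
def underRowFalse (k : ℕ) (x y : Strand n) (p : R) (a b d : Name) : Row R where
  rel e := hol s y * coord d e - ((hol s y)⁻¹ : Rˣ) * coord a e -
    ((hol s y)⁻¹ : Rˣ) * (hol s x ^ 2 - 1) * coord b e
  out := if x.2 then d else a
  inn := if x.2 then a else d
  wt := if x.2 then 1 else -1
  weight := (s y.1)⁻¹
  tag := some k
  mult := p * hol s y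

/-- The instructions of a slice. -/
def sliceProg (k : ℕ) (c : Slice n Bool) (st : List (Strand n)) (L : List Name) :
    List (Instr Name (Row R)) :=
  match c.piece, st.drop c.pos, L.drop c.pos with
  | .cup g d, _, _ =>
      [.birth c.pos (k + 1, c.pos) (k + 1, c.pos + 1),
        .row (cupRow s g d (holProd s (st.take c.pos)) (k + 1, c.pos) (k + 1, c.pos + 1))]
  | .cap, x :: _, a :: b :: _ =>
      [.row (capRow s x (holProd s (st.take c.pos)) a b), .consume c.pos]
  | .cross true, x :: y :: _, a :: b :: _ =>
      [.birth (c.pos + 2) (k + 1, c.pos) (k + 1, c.pos + 1),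
        .row (underRowTrue s k x y (holProd s (st.take c.pos)) a b (k + 1, c.pos)),
        .row (overRow x (holProd s (st.take c.pos) * hol s y ^ 2) a (k + 1, c.pos + 1)),
        .consume c.pos]
  | .cross false, x :: y :: _, a :: b :: _ =>
      [.birth (c.pos + 2) (k + 1, c.pos) (k + 1, c.pos + 1),
        .row (overRow y (holProd s (st.take c.pos)) b (k + 1, c.pos)),
        .row (underRowFalse s k x y (holProd s (st.take c.pos)) a b (k + 1, c.pos + 1)),
        .consume c.pos]
  | _, _, _ => []

/-- The names of the edges above a slice. -/
def nextNames (k : ℕ) (c : Slice n Bool) (L : List Name) : List Name :=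
  match c.piece with
  | .cup _ _ => L.take c.pos ++ (k + 1, c.pos) :: (k + 1, c.pos + 1) :: L.drop c.pos
  | .cap => L.take c.pos ++ L.drop (c.pos + 2)
  | .cross _ => L.take c.pos ++ (k + 1, c.pos) :: (k + 1, c.pos + 1) :: L.drop (c.pos + 2)

/-- The program of a stack of slices. -/
def prog : ℕ → List (Slice n Bool) → List (Strand n) → List Name → List (Instr Name (Row R))
  | _, [], _, _ => []
  | k, c :: w, st, L =>
      sliceProg s k c st L ++ prog (k + 1) w ((c.apply st).getD []) (nextNames k c L)

/-- The simplified relation that only involves the outgoing edge. -/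
def Row.diag (x : Row R) (e : Name) : R := x.wt * coord x.out e

/-- The edges oriented upwards. -/
def ups (st : List (Strand n)) : List Bool := st.map Prod.snd

/-- Splits the sign in `op` into the sign produced by the relations and the one produced by the
simplified relations at the configuration of upward strands. -/
theorem jw_eq (l : List (Strand n)) (u : List Bool) (h : u.length = l.length) :
    (jw l u : R) = occSign u * occSign (ups l) := by
  induction l generalizing u with
  | nil => simp at h; subst h; simp [jw, occSign, ups]
  | cons a l ih =>
    obtain _ | ⟨b, u⟩ := u
    · simp at h
    · simp only [jw, occSign, ups, List.map_cons, ih u (by simpa using h)]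
      obtain ⟨a, a'⟩ := a
      cases a' <;> cases b <;> simp

/-- A function that vanishes except where exactly the upward strands are occupied. -/
def UpSupported (st : List (Strand n)) (ψ : List Bool → R) : Prop :=
  ∀ σ, σ.length = st.length → σ ≠ ups st → ψ σ = 0

theorem ups_length (st : List (Strand n)) : (ups st).length = st.length := by simp [ups]

variable {s}

/-- The operator of a slice is the effect of its relations times the scalar effect of its simplified
relations. The latter live on one configuration only, because the outgoing edge is the upward leg;
the scalar absorbs the weight `cupWt` and half of the sign. -/
theorem spec_cup (su sv : List (Strand n)) (g : Fin n) (d : Bool) (p : R) (Lu Lv : List Name)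
    (a b : Name) (hu : Lu.length = su.length) (hab : a ≠ b)
    (ha : a ∉ Lu ++ Lv) (hb : b ∉ Lu ++ Lv) (ψ ε : List Bool → R) (hε : UpSupported (su ++ sv) ε) :
    UpSupported (su ++ (g, d) :: (g, !d) :: sv)
      (cr (Lu ++ a :: b :: Lv) (cupRow s g d p a b).diag (birthF Lu.length ε)) ∧
    (∀ σ, σ.length = (su ++ (g, d) :: (g, !d) :: sv).length →
      cr (Lu ++ a :: b :: Lv) (cupRow s g d p a b).rel (birthF Lu.length ψ) σ *
      cr (Lu ++ a :: b :: Lv) (cupRow s g d p a b).diag (birthF Lu.length ε)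
        (ups (su ++ (g, d) :: (g, !d) :: sv)) =
      op s ⟨su.length, .cup g d⟩ (su ++ sv) (fun σ => ψ σ * ε (ups (su ++ sv))) σ) ∧
    (IsUnit (ε (ups (su ++ sv))) → IsUnit
      (cr (Lu ++ a :: b :: Lv) (cupRow s g d p a b).diag (birthF Lu.length ε)
        (ups (su ++ (g, d) :: (g, !d) :: sv)))) := by
  simp only [List.mem_append, not_or] at ha hb
  have ha' : ∀ e ∈ Lu, e ≠ a := fun e he h => ha.1 (h ▸ he)
  have hb' : ∀ e ∈ Lu, e ≠ b := fun e he h => hb.1 (h ▸ he)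
  have ha2 : ∀ e ∈ Lv, e ≠ a := fun e he h => ha.2 (h ▸ he)
  have hb2 : ∀ e ∈ Lv, e ≠ b := fun e he h => hb.2 (h ▸ he)
  have E1 : ∀ u v x y, u.length = su.length →
      cr (Lu ++ a :: b :: Lv) (cupRow s g d p a b).diag (birthF Lu.length ε) (u ++ x :: y :: v) =
      occSign u * (if x = d ∧ y = !d then cupWt s g d else 0) * ε (u ++ v) := by
    intro u v x y hu'
    rw [row_cup Lu Lv a b _ _ _ _ u v x y (by omega)]
    · cases d <;> cases x <;> cases y <;> simp [Row.diag, cupRow, coord, hab, Ne.symm hab]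
    · intro e he
      cases d <;> simp [Row.diag, cupRow, coord, ha' e he, hb' e he]
    · intro e he
      cases d <;> simp [Row.diag, cupRow, coord, ha2 e he, hb2 e he]
  have E2 : ups (su ++ (g, d) :: (g, !d) :: sv) = ups su ++ d :: (!d) :: ups sv := by simp [ups]
  refine ⟨fun σ hσ hne => ?_, fun σ hσ => ?_, fun hu0 => ?_⟩
  · obtain ⟨u, v, rfl, hu', hv'⟩ := exists_split _ _ _ hσ
    obtain ⟨x, v, rfl, hv1⟩ := exists_cons _ hv'
    obtain ⟨y, v, rfl, hv2⟩ := exists_cons _ hv1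
    rw [E1 u v x y hu']
    split_ifs with h
    · obtain ⟨rfl, rfl⟩ := h
      rw [hε (u ++ v) (by simp [hu', hv2]), mul_zero]
      intro h
      apply hne
      rw [E2]
      simp only [ups, List.map_append] at h ⊢
      obtain ⟨rfl, rfl⟩ := List.append_inj h (by simp [hu'])
      rfl
    · simp
  · obtain ⟨u, v, rfl, hu', hv'⟩ := exists_split _ _ _ hσ
    obtain ⟨x, v, rfl, hv1⟩ := exists_cons _ hv'
    obtain ⟨y, v, rfl, hv2⟩ := exists_cons _ hv1
    rw [E2, E1 _ _ _ _ (ups_length su), op_cup s su sv g d _ u v x y hu', jw_eq su u hu',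
      row_cup Lu Lv a b _ _ _ _ u v x y (by omega)]
    · have : ups su ++ ups sv = ups (su ++ sv) := by simp [ups]
      rw [this]
      cases x <;> cases y <;> simp [cupRow, coord, hab, Ne.symm hab, kern] <;> ring
    · intro e he
      simp [cupRow, coord, ha' e he, hb' e he]
    · intro e he
      simp [cupRow, coord, ha2 e he, hb2 e he]
  · rw [E2, E1 _ _ _ _ (ups_length su), if_pos ⟨rfl, rfl⟩]
    simp only [ups, List.map_append] at hu0 ⊢
    refine ((occSign_isUnit _).mul ?_).mul hu0
    unfold cupWt
    split_ifs <;> simp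

theorem spec_cap (su sv : List (Strand n)) (x : Strand n) (p : R) (Lu Lv : List Name)
    (a b : Name) (hu : Lu.length = su.length) (hab : a ≠ b)
    (ha : a ∉ Lu ++ Lv) (hb : b ∉ Lu ++ Lv) (ψ ε : List Bool → R)
    (hε : UpSupported (su ++ x :: (x.1, !x.2) :: sv) ε) :
    UpSupported (su ++ sv)
      (consumeF Lu.length (cr (Lu ++ a :: b :: Lv) (capRow s x p a b).diag ε)) ∧
    (∀ σ, σ.length = (su ++ sv).length →
      consumeF Lu.length (cr (Lu ++ a :: b :: Lv) (capRow s x p a b).rel ψ) σ *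
      consumeF Lu.length (cr (Lu ++ a :: b :: Lv) (capRow s x p a b).diag ε) (ups (su ++ sv)) =
      op s ⟨su.length, .cap⟩ (su ++ x :: (x.1, !x.2) :: sv)
        (fun σ => ψ σ * ε (ups (su ++ x :: (x.1, !x.2) :: sv))) σ) ∧
    (IsUnit (ε (ups (su ++ x :: (x.1, !x.2) :: sv))) → IsUnit
      (consumeF Lu.length (cr (Lu ++ a :: b :: Lv) (capRow s x p a b).diag ε)
        (ups (su ++ sv)))) := by
  simp only [List.mem_append, not_or] at ha hb
  have ha' : ∀ e ∈ Lu, e ≠ a := fun e he h => ha.1 (h ▸ he)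
  have hb' : ∀ e ∈ Lu, e ≠ b := fun e he h => hb.1 (h ▸ he)
  have ha2 : ∀ e ∈ Lv, e ≠ a := fun e he h => ha.2 (h ▸ he)
  have hb2 : ∀ e ∈ Lv, e ≠ b := fun e he h => hb.2 (h ▸ he)
  have E1 : ∀ u v, u.length = su.length →
      consumeF Lu.length (cr (Lu ++ a :: b :: Lv) (capRow s x p a b).diag ε) (u ++ v) =
      occSign u * capWt s x * ε (u ++ x.2 :: (!x.2) :: v) := by
    intro u v hu'
    rw [row_cap Lu Lv a b _ _ _ _ u v (by omega)]
    · obtain ⟨f, x⟩ := x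
      cases x <;> simp [Row.diag, capRow, coord, hab, Ne.symm hab, capWt] <;> ring
    · intro e he
      obtain ⟨f, x⟩ := x
      cases x <;> simp [Row.diag, capRow, coord, ha' e he, hb' e he]
    · intro e he
      obtain ⟨f, x⟩ := x
      cases x <;> simp [Row.diag, capRow, coord, ha2 e he, hb2 e he]
  have E2 : ups (su ++ x :: (x.1, !x.2) :: sv) = ups su ++ x.2 :: (!x.2) :: ups sv := by
    simp [ups]
  have E3 : ups (su ++ sv) = ups su ++ ups sv := by simp [ups]
  refine ⟨fun σ hσ hne => ?_, fun σ hσ => ?_, fun hu0 => ?_⟩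
  · obtain ⟨u, v, rfl, hu', hv'⟩ := exists_split _ _ _ hσ
    rw [E1 u v hu', hε _ (by simp [hu', hv']), mul_zero]
    intro h
    apply hne
    rw [E2] at h
    obtain ⟨rfl, h⟩ := List.append_inj h (by simp [hu', ups_length])
    simp at h
    rw [h, E3]
  · obtain ⟨u, v, rfl, hu', hv'⟩ := exists_split _ _ _ hσ
    rw [E3, E1 _ _ (ups_length su), op_cap s su sv x _ _ u v hu', jw_eq su u hu',
      row_cap Lu Lv a b _ _ _ _ u v (by omega), E2]
    · simp [capRow, coord, hab, Ne.symm hab]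
      ring
    · intro e he
      simp [capRow, coord, ha' e he, hb' e he]
    · intro e he
      simp [capRow, coord, ha2 e he, hb2 e he]
  · rw [E2] at hu0
    rw [E3, E1 _ _ (ups_length su)]
    refine ((occSign_isUnit _).mul ?_).mul hu0
    unfold capWt
    split_ifs <;> simp

/-- The entries of `crossKern` are the minors of the two relations, and `crossSign` is the scalar by
which the simplified relations act. -/
theorem spec_cross (su sv : List (Strand n)) (t : Bool) (x y : Strand n) (r₁ r₂ : Row R)
    (Lu Lv : List Name) (a b c d : Name) (k : ℕ) (p q : R) (hu : Lu.length = su.length)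
    (hn : [a, b, c, d].Nodup) (hd : ∀ e ∈ [a, b, c, d], e ∉ Lu ++ Lv)
    (hr : if t then r₁ = underRowTrue s k x y p a b c ∧ r₂ = overRow x q a d else
      r₁ = overRow y q b c ∧ r₂ = underRowFalse s k x y p a b d)
    (ψ ε : List Bool → R) (hε : UpSupported (su ++ x :: y :: sv) ε) :
    UpSupported (su ++ y :: x :: sv)
      (consumeF Lu.length (cr (Lu ++ a :: b :: c :: d :: Lv) r₂.diag
        (cr (Lu ++ a :: b :: c :: d :: Lv) r₁.diag (birthF (Lu.length + 2) ε)))) ∧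
    (∀ σ, σ.length = (su ++ y :: x :: sv).length →
      consumeF Lu.length (cr (Lu ++ a :: b :: c :: d :: Lv) r₂.rel
        (cr (Lu ++ a :: b :: c :: d :: Lv) r₁.rel (birthF (Lu.length + 2) ψ))) σ *
      consumeF Lu.length (cr (Lu ++ a :: b :: c :: d :: Lv) r₂.diag
        (cr (Lu ++ a :: b :: c :: d :: Lv) r₁.diag (birthF (Lu.length + 2) ε)))
          (ups (su ++ y :: x :: sv)) =
      op s ⟨su.length, .cross t⟩ (su ++ x :: y :: sv)
        (fun σ => ψ σ * ε (ups (su ++ x :: y :: sv))) σ) ∧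
    (IsUnit (ε (ups (su ++ x :: y :: sv))) → IsUnit
      (consumeF Lu.length (cr (Lu ++ a :: b :: c :: d :: Lv) r₂.diag
        (cr (Lu ++ a :: b :: c :: d :: Lv) r₁.diag (birthF (Lu.length + 2) ε)))
          (ups (su ++ y :: x :: sv)))) := by
  simp only [List.nodup_cons, List.mem_cons, not_or, List.not_mem_nil, or_false] at hn
  obtain ⟨⟨hab, hac, had⟩, ⟨hbc, hbd⟩, hcd, -⟩ := hn
  have hne : ∀ e ∈ Lu ++ Lv, e ≠ a ∧ e ≠ b ∧ e ≠ c ∧ e ≠ d := by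
    intro e he
    refine ⟨?_, ?_, ?_, ?_⟩ <;> rintro rfl <;> exact hd e (by simp) he
  have V1 : ∀ e ∈ Lu ++ Lv, r₁.diag e = 0 ∧ r₂.diag e = 0 := by
    intro e he
    obtain ⟨h1, h2, h3, h4⟩ := hne e he
    obtain ⟨f, x⟩ := x
    obtain ⟨g, y⟩ := y
    cases t <;> simp only [if_true, Bool.false_eq_true, if_false] at hr <;> obtain ⟨rfl, rfl⟩ := hr <;>
      cases x <;> cases y <;>
      simp [Row.diag, underRowTrue, underRowFalse, overRow, coord, h1, h2, h3, h4]
  have V2 : ∀ e ∈ Lu ++ Lv, r₁.rel e = 0 ∧ r₂.rel e = 0 := by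
    intro e he
    obtain ⟨h1, h2, h3, h4⟩ := hne e he
    cases t <;> simp only [if_true, Bool.false_eq_true, if_false] at hr <;> obtain ⟨rfl, rfl⟩ := hr <;>
      simp [underRowTrue, underRowFalse, overRow, coord, h1, h2, h3, h4]
  have E1 : ∀ u v z w, u.length = su.length →
      consumeF Lu.length (cr (Lu ++ a :: b :: c :: d :: Lv) r₂.diag
        (cr (Lu ++ a :: b :: c :: d :: Lv) r₁.diag (birthF (Lu.length + 2) ε)))
          (u ++ z :: w :: v) =
      if z = y.2 ∧ w = x.2 then crossSign x y * ε (u ++ x.2 :: y.2 :: v) else 0 := by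
    intro u v z w hu'
    rw [row_cross Lu Lv a b c d _ _ (fun e he => V1 e (by simp [he]))
      (fun e he => V1 e (by simp [he])) _ u v z w (by omega)]
    clear V1 V2
    obtain ⟨f, x⟩ := x
    obtain ⟨g, y⟩ := y
    cases t <;> simp only [if_true, Bool.false_eq_true, if_false] at hr <;> obtain ⟨rfl, rfl⟩ := hr <;>
      cases x <;> cases y <;> cases z <;> cases w <;>
      simp [Row.diag, underRowTrue, underRowFalse, overRow, coord, crossSign, hab, hac, had, hbc,
        hbd, hcd, Ne.symm hab, Ne.symm hac, Ne.symm had, Ne.symm hbc, Ne.symm hbd, Ne.symm hcd]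
  have E2 : ups (su ++ x :: y :: sv) = ups su ++ x.2 :: y.2 :: ups sv := by simp [ups]
  have E3 : ups (su ++ y :: x :: sv) = ups su ++ y.2 :: x.2 :: ups sv := by simp [ups]
  refine ⟨fun σ hσ hne => ?_, fun σ hσ => ?_, fun hu0 => ?_⟩
  · obtain ⟨u, v, rfl, hu', hv'⟩ := exists_split _ _ _ hσ
    obtain ⟨z, v, rfl, hv1⟩ := exists_cons _ hv'
    obtain ⟨w, v, rfl, hv2⟩ := exists_cons _ hv1
    rw [E1 u v z w hu']
    split_ifs with h
    all_goals try rfl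
    all_goals
      obtain ⟨rfl, rfl⟩ := h
      rw [hε _ (by simp [hu', hv2]), mul_zero]
      intro h
      apply hne
      rw [E2] at h
      rw [E3]
      obtain ⟨rfl, h⟩ := List.append_inj h (by simp [hu', ups_length])
      simp at h
      rw [h]
  · obtain ⟨u, v, rfl, hu', hv'⟩ := exists_split _ _ _ hσ
    obtain ⟨z, v, rfl, hv1⟩ := exists_cons _ hv'
    obtain ⟨w, v, rfl, hv2⟩ := exists_cons _ hv1
    rw [E3, E1 _ _ _ _ (ups_length su), row_cross Lu Lv a b c d _ _
      (fun e he => V2 e (by simp [he])) (fun e he => V2 e (by simp [he])) _ u v z w (by omega), E2]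
    clear V1 V2 E1
    have h1 : (hol s x : R) * ((hol s x)⁻¹ : Rˣ) = 1 := by simp
    have h2 : (hol s y : R) * ((hol s y)⁻¹ : Rˣ) = 1 := by simp
    cases t <;> simp only [if_true, Bool.false_eq_true, if_false] at hr <;> obtain ⟨rfl, rfl⟩ := hr <;>
      cases z <;> cases w <;>
      simp only [op_cross_true, op_cross_false, hu'] <;>
      simp [underRowTrue, underRowFalse, overRow, coord, hab, hac, had, hbc,
        hbd, hcd, Ne.symm hab, Ne.symm hac, Ne.symm had, Ne.symm hbc, Ne.symm hbd, Ne.symm hcd] <;>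
      ring
  · rw [E2] at hu0
    rw [E3, E1 _ _ _ _ (ups_length su), if_pos ⟨rfl, rfl⟩]
    refine IsUnit.mul ?_ hu0
    unfold crossSign
    split_ifs <;> simp

end Program
end Conway

namespace Conway

/-! ### The program of a word and its value. -/

section Program
variable {n : ℕ} {R : Type} [CommRing R] (s : Fin n → Rˣ)

/-- The shapes of the slices that fit the strands `st`. -/
inductive SliceView (k : ℕ) : Slice n Bool → List (Strand n) → List (Strand n) → List Name →
    List Name → List (Instr Name (Row R)) → Prop
  | cup (su sv : List (Strand n)) (Lu Lv : List Name) (g : Fin n) (d : Bool)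
      (hu : Lu.length = su.length) (hv : Lv.length = sv.length) :
      SliceView k ⟨su.length, .cup g d⟩ (su ++ sv) (su ++ (g, d) :: (g, !d) :: sv) (Lu ++ Lv)
        (Lu ++ (k + 1, su.length) :: (k + 1, su.length + 1) :: Lv)
        [.birth su.length (k + 1, su.length) (k + 1, su.length + 1),
          .row (cupRow s g d (holProd s su) (k + 1, su.length) (k + 1, su.length + 1))]
  | cap (su sv : List (Strand n)) (Lu Lv : List Name) (x : Strand n) (a b : Name)
      (hu : Lu.length = su.length) (hv : Lv.length = sv.length) :
      SliceView k ⟨su.length, .cap⟩ (su ++ x :: (x.1, !x.2) :: sv) (su ++ sv)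
        (Lu ++ a :: b :: Lv) (Lu ++ Lv)
        [.row (capRow s x (holProd s su) a b), .consume su.length]
  | cross (su sv : List (Strand n)) (Lu Lv : List Name) (t : Bool) (x y : Strand n) (a b : Name)
      (r₁ r₂ : Row R)
      (hr : if t then r₁ = underRowTrue s k x y (holProd s su) a b (k + 1, su.length) ∧
          r₂ = overRow x (holProd s su * hol s y ^ 2) a (k + 1, su.length + 1) else
        r₁ = overRow y (holProd s su) b (k + 1, su.length) ∧
          r₂ = underRowFalse s k x y (holProd s su) a b (k + 1, su.length + 1))
      (hu : Lu.length = su.length) (hv : Lv.length = sv.length) :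
      SliceView k ⟨su.length, .cross t⟩ (su ++ x :: y :: sv) (su ++ y :: x :: sv)
        (Lu ++ a :: b :: Lv) (Lu ++ (k + 1, su.length) :: (k + 1, su.length + 1) :: Lv)
        [.birth (su.length + 2) (k + 1, su.length) (k + 1, su.length + 1), .row r₁, .row r₂,
          .consume su.length]

theorem sliceView (k : ℕ) (c : Slice n Bool) (st t : List (Strand n)) (L : List Name)
    (hc : c.apply st = some t) (hL : L.length = st.length) :
    SliceView s k c st t L (nextNames k c L) (sliceProg s k c st L) := by
  obtain ⟨su, si, so, sv, rfl, rfl, hp, hi, ho, -, h1, h2, h3⟩ := apply_eq_some c st t hc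
  obtain ⟨i, P⟩ := c
  simp only at hp hi ho h1 h2 h3
  subst hp
  obtain ⟨Lu, Lr, rfl, hu, hr⟩ := exists_split su _ L hL
  obtain ⟨Li, Lv, rfl, hLi, hv⟩ := exists_split si _ Lr hr
  rw [hi] at hLi
  obtain ⟨g, d⟩ | _ | x := P
  · obtain rfl := h1 g d rfl
    obtain rfl := List.length_eq_zero_iff.1 hi
    obtain rfl := List.length_eq_zero_iff.1 hLi
    have := SliceView.cup (s := s) (k := k) su sv Lu Lv g d hu hv
    simpa [nextNames, sliceProg, ← hu] using this
  · obtain ⟨x, rfl⟩ := h2 rfl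
    obtain rfl := List.length_eq_zero_iff.1 ho
    obtain ⟨a, b, rfl⟩ := List.length_eq_two.1 hLi
    have := SliceView.cap (s := s) (k := k) su sv Lu Lv x a b hu hv
    have e1 : (Lu ++ a :: b :: Lv).drop su.length = a :: b :: Lv := by simp [← hu]
    have e2 : (Lu ++ a :: b :: Lv).drop (su.length + 2) = Lv := by rw [← List.drop_drop, e1]; rfl
    have e3 : (Lu ++ a :: b :: Lv).take su.length = Lu := by simp [← hu]
    simpa [nextNames, sliceProg, e1, e2, e3] using this
  · obtain ⟨x1, y1, rfl, rfl⟩ := h3 x rfl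
    obtain ⟨a, b, rfl⟩ := List.length_eq_two.1 hLi
    have e1 : (Lu ++ a :: b :: Lv).drop su.length = a :: b :: Lv := by simp [← hu]
    have e2 : (Lu ++ a :: b :: Lv).drop (su.length + 2) = Lv := by rw [← List.drop_drop, e1]; rfl
    have e3 : (Lu ++ a :: b :: Lv).take su.length = Lu := by simp [← hu]
    cases x
    · have := SliceView.cross (s := s) (k := k) su sv Lu Lv false x1 y1 a b _ _
        (by simpa using ⟨rfl, rfl⟩) hu hv
      simpa [nextNames, sliceProg, e1, e2, e3] using this
    · have := SliceView.cross (s := s) (k := k) su sv Lu Lv true x1 y1 a b _ _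
        (by simpa using ⟨rfl, rfl⟩) hu hv
      simpa [nextNames, sliceProg, e1, e2, e3] using this

/-- The names of the strands `st` at level `k`. -/
structure Names (k : ℕ) (st : List (Strand n)) (L : List Name) : Prop where
  length : L.length = st.length
  nodup : L.Nodup
  le : ∀ e ∈ L, e.1 ≤ k

variable {s} in
theorem SliceView.names {k : ℕ} {c : Slice n Bool} {st t : List (Strand n)} {L L' : List Name}
    {P : List (Instr Name (Row R))} (h : SliceView s k c st t L L' P) (hL : Names k st L) :
    Names (k + 1) t L' := by
  obtain ⟨h1, h2, h3⟩ := hL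
  have fresh : ∀ e ∈ L, ∀ j, e ≠ (k + 1, j) := by
    rintro e he j rfl
    have := h3 _ he
    simp at this
  cases h with
  | cup su sv Lu Lv g d hu hv =>
    refine ⟨by simp [hu, hv], ?_, ?_⟩
    · rw [List.nodup_append] at h2 ⊢
      simp only [List.nodup_cons, List.mem_cons]
      refine ⟨h2.1, ⟨?_, ?_, h2.2.1⟩, ?_⟩
      · rintro (h | h)
        · simp at h
        · exact fresh (k + 1, su.length) (by simp [h]) _ rfl
      · intro h
        exact fresh (k + 1, su.length + 1) (by simp [h]) _ rfl
      · rintro e he e' (rfl | rfl | he')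
        · exact fresh _ (by simp [he]) _
        · exact fresh _ (by simp [he]) _
        · exact h2.2.2 e he e' he'
    · intro e he
      simp at he
      rcases he with he | rfl | rfl | he
      · exact (h3 e (by simp [he])).trans (by omega)
      · simp
      · simp
      · exact (h3 e (by simp [he])).trans (by omega)
  | cap su sv Lu Lv x a b hu hv =>
    refine ⟨by simp [hu, hv], ?_, ?_⟩
    · exact h2.sublist (List.Sublist.append_left
        ((List.sublist_cons_self b Lv).trans (List.sublist_cons_self a _)) Lu)
    · intro e he
      exact (h3 e (by simp at he ⊢; tauto)).trans (by omega)
  | cross su sv Lu Lv t x y a b r₁ r₂ hr hu hv =>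
    refine ⟨by simp [hu, hv], ?_, ?_⟩
    · have h2 := h2.sublist (List.Sublist.append_left
        ((List.sublist_cons_self b Lv).trans (List.sublist_cons_self a _)) Lu)
      rw [List.nodup_append] at h2 ⊢
      simp only [List.nodup_cons, List.mem_cons]
      refine ⟨h2.1, ⟨?_, ?_, h2.2.1⟩, ?_⟩
      · rintro (h | h)
        · simp at h
        · exact fresh (k + 1, su.length) (by simp [h]) _ rfl
      · intro h
        exact fresh (k + 1, su.length + 1) (by simp [h]) _ rfl
      · rintro e he e' (rfl | rfl | he')
        · exact fresh _ (by simp [he]) _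
        · exact fresh _ (by simp [he]) _
        · exact h2.2.2 e he e' he'
    · intro e he
      simp at he
      rcases he with he | rfl | rfl | he
      · exact (h3 e (by simp [he])).trans (by omega)
      · simp
      · simp
      · exact (h3 e (by simp [he])).trans (by omega)

theorem rowsOf_append {ι ρ : Type} (P Q : List (Instr ι ρ)) :
    rowsOf (P ++ Q) = rowsOf P ++ rowsOf Q := by
  induction P with
  | nil => rfl
  | cons c P ih => cases c <;> simp [rowsOf, ih]

theorem births_append {ι ρ : Type} (P Q : List (Instr ι ρ)) :
    births (P ++ Q) = births P ++ births Q := by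
  induction P with
  | nil => rfl
  | cons c P ih => cases c <;> simp [births, ih]

variable {s} in
theorem SliceView.support {k : ℕ} {c : Slice n Bool} {st t : List (Strand n)} {L L' : List Name}
    {P : List (Instr Name (Row R))} (h : SliceView s k c st t L L' P) :
    (∀ e ∈ births P, e.1 = k + 1) ∧
    ∀ x ∈ rowsOf P, ∀ e, e ∉ L → e.1 ≠ k + 1 → x.rel e = 0 ∧ x.diag e = 0 := by
  have hc : ∀ {L : List Name} {a e : Name}, a ∈ L → e ∉ L → e ≠ a := by
    rintro L a e h1 h2 rfl
    exact h2 h1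
  have hk : ∀ {k j : ℕ} {e : Name}, e.1 ≠ k + 1 → e ≠ (k + 1, j) := by
    rintro k j e h rfl
    exact h rfl
  cases h with
  | cup su sv Lu Lv g d hu hv =>
    refine ⟨by simp [births], ?_⟩
    intro x hx e he hk1
    simp [rowsOf] at hx
    subst hx
    cases d <;> simp [cupRow, Row.diag, coord, hk hk1]
  | cap su sv Lu Lv x a b hu hv =>
    refine ⟨by simp [births], ?_⟩
    intro x hx e he hk1
    simp [rowsOf] at hx
    subst hx
    have h1 : e ≠ a := hc (by simp) he
    have h2 : e ≠ b := hc (by simp) he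
    unfold Row.diag capRow
    dsimp only
    split_ifs <;> simp [coord, h1, h2]
  | cross su sv Lu Lv t x y a b r₁ r₂ hr hu hv =>
    refine ⟨by simp [births], ?_⟩
    intro z hx e he hk1
    simp [rowsOf] at hx
    have h1 : e ≠ a := hc (by simp) he
    have h2 : e ≠ b := hc (by simp) he
    cases t <;> simp only [if_true, Bool.false_eq_true, if_false] at hr <;>
      obtain ⟨rfl, rfl⟩ := hr <;> obtain rfl | rfl := hx <;>
      simp only [Row.diag, overRow, underRowTrue, underRowFalse] <;> split_ifs <;>
      simp [coord, h1, h2, hk hk1]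

/-- Names record the level of birth, so births in the remaining word have levels above `k`, and an
old edge that is no longer present cannot occur in a later relation. -/
theorem prog_support (k : ℕ) (w : List (Slice n Bool)) (st t : List (Strand n)) (L : List Name)
    (hw : run w st = some t) (hL : Names k st L) :
    (∀ e ∈ births (prog s k w st L), k < e.1) ∧
    ∀ x ∈ rowsOf (prog s k w st L), ∀ e, e ∉ L → e.1 ≤ k → x.rel e = 0 ∧ x.diag e = 0 := by
  induction w generalizing k st L with
  | nil => simp [prog, births, rowsOf]
  | cons c w ih =>
    simp only [run] at hw
    cases hc : c.apply st with
    | none => simp [hc] at hw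
    | some st' =>
      simp only [hc, Option.bind_some] at hw
      have hv := sliceView s k c st st' L hc hL.length
      obtain ⟨i1, i2⟩ := ih (k + 1) st' _ hw (hv.names hL)
      obtain ⟨j1, j2⟩ := hv.support
      simp only [prog, hc, Option.getD_some, births_append, rowsOf_append, List.mem_append]
      refine ⟨?_, ?_⟩
      · rintro e (he | he)
        · rw [j1 e he]; omega
        · exact (Nat.lt_succ_self k).trans (i1 e he)
      · rintro x (hx | hx) e he hk
        · exact j2 x hx e he (by omega)
        · refine i2 x hx e ?_ (by omega)
          revert he
          generalize sliceProg s k c st L = P at hv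
          generalize nextNames k c L = L' at hv
          cases hv <;> simp <;> intros <;> simp_all <;> constructor <;> rintro rfl <;> simp at hk

/-- The condition on `f` is weak enough to cover the relations, the simplified relations, and the
relations with one of them replaced by a coordinate form on its support. -/
theorem prog_wellFormed (f : Row R → Name → R) (k : ℕ)
    (w : List (Slice n Bool)) (st : List (Strand n)) (L : List Name)
    (hf : ∀ x ∈ rowsOf (prog s k w st L), ∀ e, x.rel e = 0 → x.diag e = 0 → f x e = 0)
    (hw : run w st = some []) (hL : Names k st L) : WellFormed f (prog s k w st L) L := by
  induction w generalizing k st L with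
  | nil =>
    simp [run] at hw
    subst hw
    exact List.length_eq_zero_iff.1 hL.length
  | cons c w ih =>
    simp only [run] at hw
    cases hc : c.apply st with
    | none => simp [hc] at hw
    | some st' =>
      simp only [hc, Option.bind_some] at hw
      have hv := sliceView s k c st st' L hc hL.length
      have hL' := hv.names hL
      simp only [prog, hc, Option.getD_some, rowsOf_append, List.mem_append] at hf
      have ih := ih (k + 1) st' _ (fun x hx => hf x (.inr hx)) hw hL'
      obtain ⟨i1, i2⟩ := prog_support s (k + 1) w st' [] _ hw hL'
      obtain ⟨-, j2⟩ := hv.support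
      have j2 : ∀ x ∈ rowsOf (sliceProg s k c st L), ∀ e ∈ births (prog s (k + 1) w st'
          (nextNames k c L)), f x e = 0 := by
        intro x hx e he
        have h1 := i1 e he
        have h2 : e ∉ L := fun h => by
          have := hL.le e h
          omega
        have := j2 x hx e h2 (by omega)
        exact hf x (.inl hx) e this.1 this.2
      have i2 : ∀ x ∈ rowsOf (prog s (k + 1) w st' (nextNames k c L)), ∀ e ∈ L,
          e ∉ nextNames k c L → f x e = 0 := by
        intro x hx e he he2
        have := i2 x hx e he2 ((hL.le e he).trans (by omega))
        exact hf x (.inr hx) e this.1 this.2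
      simp only [prog, hc, Option.getD_some]
      have hfr : ∀ j, (k + 1, j) ∉ L := fun j h => by
        have := hL.le _ h
        simp at this
      have hnd := hL.nodup
      have hnd' := hL'.nodup
      generalize prog s (k + 1) w st' (nextNames k c L) = Q at *
      generalize sliceProg s k c st L = P at hv j2 ⊢
      generalize nextNames k c L = L' at *
      clear hL hL' i1 hc hw hf
      cases hv with
      | cup su sv Lu Lv g d hu hv =>
        refine ⟨Lu, Lv, rfl, hu, ?_, ih⟩
        exact j2 _ (by simp [rowsOf])
      | cap su sv Lu Lv x a b hu hv =>
        refine ⟨?_, Lu, a, b, Lv, rfl, hu, fun x hx => ⟨i2 x hx a (by simp) ?_,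
          i2 x hx b (by simp) ?_⟩, ih⟩
        · exact j2 _ (by simp [rowsOf])
        · simp [List.nodup_append] at hnd; grind
        · simp [List.nodup_append] at hnd; grind
      | cross su sv Lu Lv t x y a b r₁ r₂ hr hu hv =>
        refine ⟨Lu ++ [a, b], Lv, by simp, by simp [hu], ?_, ?_, Lu, a, b, _, by simp, hu,
          fun x hx => ⟨i2 x hx a (by simp) ?_, i2 x hx b (by simp) ?_⟩, ih⟩
        · exact j2 _ (by simp [rowsOf])
        · exact j2 _ (by simp [rowsOf])
        · simp [List.nodup_append] at hnd hfr; grind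
        · simp [List.nodup_append] at hnd hfr; grind

/-- The bridge between programs and the state sum, obtained by composing `spec_cup`, `spec_cap` and
`spec_cross`. The second factor is a unit, so it can later be traded for a product of weights and a
permutation sign. -/
theorem exec_prog (k : ℕ) (w : List (Slice n Bool)) (st : List (Strand n)) (L : List Name)
    (hw : run w st = some []) (hL : Names k st L) (ψ ε : List Bool → R) (hε : UpSupported st ε) :
    exec Row.rel (prog s k w st L) L ψ [] * exec Row.diag (prog s k w st L) L ε [] =
      opW s w st (fun σ => ψ σ * ε (ups st)) [] ∧
    (IsUnit (ε (ups st)) → IsUnit (exec Row.diag (prog s k w st L) L ε [])) := by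
  induction w generalizing k st L ψ ε with
  | nil =>
    simp [run] at hw
    subst hw
    simp [prog, exec, opW, ups]
  | cons c w ih =>
    simp only [run] at hw
    cases hc : c.apply st with
    | none => simp [hc] at hw
    | some st' =>
      simp only [hc, Option.bind_some] at hw
      have hv := sliceView s k c st st' L hc hL.length
      have hL' := hv.names hL
      have ih := ih (k + 1) st' _ hw hL'
      simp only [prog, opW, hc, Option.getD_some]
      -- One slice turns the pair `ψ`, `ε` into a pair `ψ'`, `ε'` with the same properties one level
      -- higher.
      suffices h : ∃ ψ' ε', (∀ Q, exec Row.rel (sliceProg s k c st L ++ Q) L ψ =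
          exec Row.rel Q (nextNames k c L) ψ') ∧
          (∀ Q, exec Row.diag (sliceProg s k c st L ++ Q) L ε =
          exec Row.diag Q (nextNames k c L) ε') ∧ UpSupported st' ε' ∧
          (∀ σ, σ.length = st'.length → ψ' σ * ε' (ups st') =
            op s c st (fun σ => ψ σ * ε (ups st)) σ) ∧
          (IsUnit (ε (ups st)) → IsUnit (ε' (ups st'))) by
        obtain ⟨ψ', ε', h1, h2, h3, h4, h5⟩ := h
        rw [h1, h2, (ih ψ' ε' h3).1]
        exact ⟨opW_congr s w st' [] hw h4 [] rfl, fun h => (ih ψ' ε' h3).2 (h5 h)⟩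
      have hfr : ∀ j, (k + 1, j) ∉ L := fun j h => by
        have := hL.le _ h
        simp at this
      have hnd := hL.nodup
      generalize sliceProg s k c st L = P at hv ⊢
      generalize nextNames k c L = L' at *
      clear hL hL' ih hw
      cases hv with
      | cup su sv Lu Lv g d hu hv =>
        have := spec_cup (s := s) su sv g d (holProd s su) Lu Lv (k + 1, su.length)
          (k + 1, su.length + 1) hu (by simp) (hfr _) (hfr _) ψ ε hε
        refine ⟨_, _, fun Q => ?_, fun Q => ?_, this.1, this.2.1, this.2.2⟩ <;>
          simp [exec, ← hu]
      | cap su sv Lu Lv x a b hu hv =>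
        have := spec_cap (s := s) su sv x (holProd s su) Lu Lv a b hu
          (by simp [List.nodup_append] at hnd; tauto) (by simp [List.nodup_append] at hnd ⊢; grind)
          (by simp [List.nodup_append] at hnd ⊢; grind) ψ ε hε
        have e1 : (Lu ++ a :: b :: Lv).drop su.length = a :: b :: Lv := by simp [← hu]
        have e2 : (Lu ++ a :: b :: Lv).drop (su.length + 2) = Lv := by
          rw [← List.drop_drop, e1]; rfl
        have e3 : (Lu ++ a :: b :: Lv).take su.length = Lu := by simp [← hu]
        refine ⟨_, _, fun Q => ?_, fun Q => ?_, this.1, this.2.1, this.2.2⟩ <;>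
          simp [exec, e2, e3, hu]
      | cross su sv Lu Lv t x y a b r₁ r₂ hr hu hv =>
        have := spec_cross (s := s) su sv t x y r₁ r₂ Lu Lv a b (k + 1, su.length)
          (k + 1, su.length + 1) k (holProd s su)
          (if t then holProd s su * hol s y ^ 2 else holProd s su) hu (by
            have := hfr su.length; have := hfr (su.length + 1)
            simp [List.nodup_append] at hnd this ⊢; grind)
          (by
            have := hfr su.length; have := hfr (su.length + 1)
            simp [List.nodup_append] at hnd this ⊢; grind) (by cases t <;> simpa using hr) ψ ε hε
        have e1 : ∀ M, (Lu ++ a :: b :: M).drop (su.length + 2) = M := by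
          intro M
          rw [← List.drop_drop, ← hu, List.drop_left]; rfl
        have e2 : ∀ M, (Lu ++ a :: b :: M).take (su.length + 2) = Lu ++ [a, b] := by
          intro M
          rw [← hu, List.take_append]
          simp
        have e3 : ∀ M, (Lu ++ M).take su.length = Lu := by simp [← hu]
        refine ⟨_, _, fun Q => ?_, fun Q => ?_, this.1, this.2.1, this.2.2⟩ <;>
          simp [exec, e1, e2, e3, hu]

end Program
end Conway

namespace Conway

/-! ### Adjugates of singular matrices. -/

section RankOne
variable {K : Type} [Field K] {ι : Type} [Fintype ι] [DecidableEq ι]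

/-- Replacing row `r` by a vector orthogonal to `v` leaves `v` in the kernel, so the new determinant
vanishes. The vector with entries `v q'` at `q` and `-v q` at `q'` yields the proportionality. -/
theorem adjugate_mul_right_kernel (M : Matrix ι ι K) (v : ι → K) (hv : v ≠ 0)
    (h : M.mulVec v = 0) (q q' r : ι) :
    M.adjugate q r * v q' = M.adjugate q' r * v q := by
  have h1 : (M.updateRow r (v q' • Pi.single q 1 + (-v q) • Pi.single q' 1)).det = 0 := by
    rw [← Matrix.exists_mulVec_eq_zero_iff]
    refine ⟨v, hv, ?_⟩
    funext i
    by_cases hi : i = r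
    · subst hi
      simp only [Matrix.mulVec, Matrix.updateRow_self, add_dotProduct, smul_dotProduct,
        single_dotProduct, Pi.zero_apply, smul_eq_mul]
      ring
    · have := congrFun h i
      simpa [Matrix.mulVec, Matrix.updateRow_ne hi] using this
  rw [Matrix.det_updateRow_add, Matrix.det_updateRow_smul, Matrix.det_updateRow_smul,
    ← Matrix.adjugate_apply, ← Matrix.adjugate_apply] at h1
  linear_combination h1

theorem adjugate_mul_left_kernel (M : Matrix ι ι K) (u : ι → K) (hu : u ≠ 0)
    (h : M.vecMul u = 0) (q r r' : ι) :
    M.adjugate q r * u r' = M.adjugate q r' * u r := by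
  have := adjugate_mul_right_kernel M.transpose u hu (by rwa [Matrix.mulVec_transpose]) r r' q
  rwa [← Matrix.adjugate_transpose] at this

end RankOne

/-! ### Names of edges, level by level. -/

section Levels
variable {n : ℕ} {R : Type} [CommRing R] (s : Fin n → Rˣ)

/-- The names of the edges at level `k`. -/
def namesAt (w : List (Slice n Bool)) : ℕ → List Name
  | 0 => []
  | k + 1 => match w[k]? with
    | some c => nextNames k c (namesAt w k)
    | none => []

/-- The instructions of the slice number `k`. -/
def LinkDiagram.instrs (D : LinkDiagram n) (k : ℕ) : List (Instr Name (Row R)) :=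
  match D.word[k]? with
  | some c => sliceProg s k c (D.state k) (namesAt D.word k)
  | none => []

/-- The program of a diagram. -/
def LinkDiagram.program (D : LinkDiagram n) : List (Instr Name (Row R)) :=
  prog s 0 D.word [] []

variable (D : LinkDiagram n)

theorem Diagram.state_zero : D.state 0 = [] := by simp [Diagram.state, run]

theorem Diagram.state_length : D.state D.word.length = [] := by simp [Diagram.state, D.closed]

theorem LinkDiagram.names (k : ℕ) (hk : k ≤ D.word.length) :
    Names k (D.state k) (namesAt D.word k) := by
  induction k with
  | zero => exact ⟨by simp [D.state_zero, namesAt], by simp [namesAt], by simp [namesAt]⟩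
  | succ k ih =>
    have ih := ih (by omega)
    have hc : D.word[k]? = some D.word[k] := by simp
    -- Names do not depend on the parameters, so trivial ones over `ℤ` serve.
    have hv := sliceView (fun _ : Fin n => (1 : ℤˣ)) k _ _ _ (namesAt D.word k)
      (D.apply_state k _ hc) ih.length
    have := hv.names ih
    simpa [namesAt, hc] using this

theorem LinkDiagram.sliceView (k : ℕ) (c : Slice n Bool) (hc : D.word[k]? = some c) :
    SliceView s k c (D.state k) (D.state (k + 1)) (namesAt D.word k) (namesAt D.word (k + 1))
      (D.instrs s k) := by
  have hk : k < D.word.length := by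
    by_contra h
    simp [List.getElem?_eq_none (not_lt.1 h)] at hc
  have := Conway.sliceView s k c _ _ (namesAt D.word k) (D.apply_state k c hc)
    (D.names k hk.le).length
  simpa [namesAt, hc, LinkDiagram.instrs] using this

/-- `prog` consumes a word from the front while carrying its level, so the induction is on the
number `j` of slices that remain. -/
theorem LinkDiagram.program_drop (j : ℕ) (hj : j ≤ D.word.length) :
    prog s (D.word.length - j) (D.word.drop (D.word.length - j)) (D.state (D.word.length - j))
      (namesAt D.word (D.word.length - j)) =
    (List.range' (D.word.length - j) j).flatMap (D.instrs s) := by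
  induction j with
  | zero => simp [prog]
  | succ j ih =>
    have ih := ih (by omega)
    generalize hk : D.word.length - (j + 1) = k
    have hk' : D.word.length - j = k + 1 := by omega
    rw [hk'] at ih
    have hlt : k < D.word.length := by omega
    have hc : D.word[k]? = some D.word[k] := by simp [hlt]
    rw [List.drop_eq_getElem_cons hlt, prog, D.apply_state k _ hc]
    have : nextNames k D.word[k] (namesAt D.word k) = namesAt D.word (k + 1) := by
      simp [namesAt, hc]
    rw [this, Option.getD_some, ih, List.range'_succ, List.flatMap_cons]
    simp [LinkDiagram.instrs, hc]

theorem LinkDiagram.program_eq :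
    D.program s = (List.range D.word.length).flatMap (D.instrs s) := by
  have := D.program_drop s D.word.length le_rfl
  simpa [D.state_zero, namesAt, List.range_eq_range', LinkDiagram.program] using this

theorem rowsOf_flatMap {κ ι ρ : Type} (l : List κ) (F : κ → List (Instr ι ρ)) :
    rowsOf (l.flatMap F) = l.flatMap fun k => rowsOf (F k) := by
  induction l with
  | nil => rfl
  | cons k l ih => simp [rowsOf_append, ih]

theorem births_flatMap {κ ι ρ : Type} (l : List κ) (F : κ → List (Instr ι ρ)) :
    births (l.flatMap F) = l.flatMap fun k => births (F k) := by
  induction l with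
  | nil => rfl
  | cons k l ih => simp [births_append, ih]

theorem LinkDiagram.mem_rows (x : Row R) : x ∈ rowsOf (D.program s) ↔
    ∃ k < D.word.length, x ∈ rowsOf (D.instrs s k) := by
  simp [D.program_eq, rowsOf_flatMap]

theorem LinkDiagram.mem_births (e : Name) : e ∈ births (D.program s) ↔
    ∃ k < D.word.length, e ∈ births (D.instrs s k) := by
  simp [D.program_eq, births_flatMap]

variable {s} in
theorem SliceView.mem_next {k : ℕ} {c : Slice n Bool} {st t : List (Strand n)} {L L' : List Name}
    {P : List (Instr Name (Row R))} (h : SliceView s k c st t L L' P) :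
    (∀ e ∈ L', e ∈ L ∨ e ∈ births P) ∧ (∀ e ∈ births P, e ∈ L') ∧
    ∀ x ∈ rowsOf P, (x.out ∈ L ∨ x.out ∈ births P) ∧ (x.inn ∈ L ∨ x.inn ∈ births P) := by
  cases h with
  | cup su sv Lu Lv g d hu hv =>
    refine ⟨by simp [births]; tauto, by simp [births], ?_⟩
    cases d <;> simp [rowsOf, cupRow, births]
  | cap su sv Lu Lv x a b hu hv =>
    refine ⟨by simp [births]; tauto, by simp [births], ?_⟩
    obtain ⟨x, x'⟩ := x
    cases x' <;> simp [rowsOf, capRow, births]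
  | cross su sv Lu Lv t x y a b r₁ r₂ hr hu hv =>
    refine ⟨by simp [births]; tauto, by simp [births], ?_⟩
    obtain ⟨x, x'⟩ := x
    obtain ⟨y, y'⟩ := y
    cases t <;> simp only [if_true, Bool.false_eq_true, if_false] at hr <;>
      obtain ⟨rfl, rfl⟩ := hr <;> cases x' <;> cases y' <;>
      simp [rowsOf, overRow, underRowFalse, underRowTrue, births]

theorem LinkDiagram.mem_births_of_mem_namesAt (k : ℕ) (hk : k ≤ D.word.length) (e : Name)
    (he : e ∈ namesAt D.word k) : e ∈ births (D.program s) := by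
  induction k with
  | zero => simp [namesAt] at he
  | succ k ih =>
    have hc : D.word[k]? = some D.word[k] := by simp
    rcases (D.sliceView s k _ hc).mem_next.1 e he with h | h
    · exact ih (by omega) h
    · exact (D.mem_births s e).2 ⟨k, by omega, h⟩

theorem LinkDiagram.mem_births_of_row (x : Row R) (hx : x ∈ rowsOf (D.program s)) :
    x.out ∈ births (D.program s) ∧ x.inn ∈ births (D.program s) := by
  obtain ⟨k, hk, hx⟩ := (D.mem_rows s x).1 hx
  have hc : D.word[k]? = some D.word[k] := by simp
  have h := (D.sliceView s k _ hc).mem_next.2.2 x hx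
  have h1 : ∀ e, (e ∈ namesAt D.word k ∨ e ∈ births (D.instrs s k)) →
      e ∈ births (D.program s) := by
    rintro e (he | he)
    · exact D.mem_births_of_mem_namesAt s k hk.le e he
    · exact (D.mem_births s e).2 ⟨k, hk, he⟩
  exact ⟨h1 _ h.1, h1 _ h.2⟩

variable {s} in
theorem SliceView.card {k : ℕ} {c : Slice n Bool} {st t : List (Strand n)} {L L' : List Name}
    {P : List (Instr Name (Row R))} (h : SliceView s k c st t L L' P) :
    st.length + 2 * (births P).length = t.length + 2 * (rowsOf P).length := by
  cases h <;> simp [births, rowsOf] <;> omega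

/-- Each slice balances births and relations against the change of width. For a closed diagram this
makes the matrix of relations square. -/
theorem prog_card (k : ℕ) (w : List (Slice n Bool)) (st t : List (Strand n)) (L : List Name)
    (hw : run w st = some t) (hL : Names k st L) :
    st.length + 2 * (births (prog s k w st L)).length =
      t.length + 2 * (rowsOf (prog s k w st L)).length := by
  induction w generalizing k st L with
  | nil => simp [run] at hw; simp [prog, births, rowsOf, hw]
  | cons c w ih =>
    simp only [run] at hw
    cases hc : c.apply st with
    | none => simp [hc] at hw
    | some st' =>
      simp only [hc, Option.bind_some] at hw
      have hv := Conway.sliceView s k c st st' L hc hL.length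
      have h1 := ih (k + 1) st' _ hw (hv.names hL)
      have h2 := hv.card
      simp only [prog, hc, Option.getD_some, births_append, rowsOf_append, List.length_append]
      omega

/-- The strand through a point. -/
def Diagram.strandAt (e : Name) : Option (Strand n) := (D.state e.1)[e.2]?

/-- An edge keeps its name, its label and its direction at all levels through which it passes, so
these can be read off at its birth. -/
theorem LinkDiagram.strandAt_namesAt (k : ℕ) (hk : k ≤ D.word.length) :
    (namesAt D.word k).map D.strandAt = (D.state k).map some := by
  induction k with
  | zero => simp [namesAt, D.state_zero]
  | succ k ih =>
    have ih := ih (by omega)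
    have hc : D.word[k]? = some D.word[k] := by simp
    have hv := D.sliceView (fun _ : Fin n => (1 : ℤˣ)) k _ hc
    have hst : ∀ j, D.strandAt (k + 1, j) = (D.state (k + 1))[j]? := fun j => rfl
    generalize namesAt D.word k = L at *
    generalize namesAt D.word (k + 1) = L' at *
    generalize D.state k = st at *
    generalize D.state (k + 1) = t at *
    generalize D.instrs (fun _ : Fin n => (1 : ℤˣ)) k = P at *
    generalize D.word[k] = c at *
    have hsplit : ∀ {A B : List Name} {u v : List (Strand n)}, A.length = u.length →
        (A ++ B).map D.strandAt = (u ++ v).map some → A.map D.strandAt = u.map some ∧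
          B.map D.strandAt = v.map some := by
      intro A B u v h1 h2
      simp only [List.map_append] at h2
      exact List.append_inj h2 (by simp [h1])
    cases hv with
    | cup su sv Lu Lv g d hu hv =>
      obtain ⟨h1, h2⟩ := hsplit hu ih
      simp [h1, h2, hst]
    | cap su sv Lu Lv x a b hu hv =>
      obtain ⟨h1, h2⟩ := hsplit hu ih
      simp at h2
      simp [h1, h2]
    | cross su sv Lu Lv t x y a b r₁ r₂ hr hu hv =>
      obtain ⟨h1, h2⟩ := hsplit hu ih
      simp at h2
      simp [h1, h2, hst]

end Levels
end Conway

namespace Conway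

/-! ### The two kernels of the matrix of relations. -/

section Kernels
variable {n : ℕ} {R : Type} [CommRing R] (s : Fin n → Rˣ)

variable {s} in
-- Fox's fundamental formula, one relation at a time: the differential of a relation, evaluated at
-- the values of the letters minus one, is the value of the relation minus one.
theorem SliceView.rel_kernel {k : ℕ} {c : Slice n Bool} {st t : List (Strand n)}
    {L L' : List Name} {P : List (Instr Name (Row R))} (h : SliceView s k c st t L L' P)
    (E : (Name → R) →ₗ[R] R)
    (hL : L.map (fun a => E (coord a)) = st.map fun a => (hol s a : R) ^ 2 - 1)
    (hL' : L'.map (fun a => E (coord a)) = t.map fun a => (hol s a : R) ^ 2 - 1) :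
    ∀ x ∈ rowsOf P, E x.rel = 0 := by
  have hsplit : ∀ {A B : List Name} {u v : List (Strand n)}, A.length = u.length →
      (A ++ B).map (fun a => E (coord a)) = (u ++ v).map (fun a => (hol s a : R) ^ 2 - 1) →
        B.map (fun a => E (coord a)) = v.map (fun a => (hol s a : R) ^ 2 - 1) := by
    intro A B u v h1 h2
    simp only [List.map_append] at h2
    exact (List.append_inj h2 (by simp [h1])).2
  cases h with
  | cup su sv Lu Lv g d hu hv =>
    intro x hx
    have h2 := hsplit hu hL'
    simp only [List.map_cons, List.cons.injEq] at h2
    obtain ⟨ha, hb, -⟩ := h2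
    simp [rowsOf] at hx
    subst hx
    have : (cupRow s g d (holProd s su) (k + 1, su.length) (k + 1, su.length + 1)).rel =
        coord (k + 1, su.length) + (hol s (g, d) : R) ^ 2 • coord (k + 1, su.length + 1) := by
      funext e; simp [cupRow]
    rw [this, map_add, map_smul, ha, hb]
    cases d <;> simp [hol, mul_sub, ← mul_pow]
  | cap su sv Lu Lv x a b hu hv =>
    intro z hx
    have h2 := hsplit hu hL
    simp only [List.map_cons, List.cons.injEq] at h2
    obtain ⟨ha, hb, -⟩ := h2
    simp [rowsOf] at hx
    subst hx
    have : (capRow s x (holProd s su) a b).rel = coord a + (hol s x : R) ^ 2 • coord b := by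
      funext e; simp [capRow]
    rw [this, map_add, map_smul, ha, hb]
    obtain ⟨x, d⟩ := x
    cases d <;> simp [hol, mul_sub, ← mul_pow]
  | cross su sv Lu Lv t x y a b r₁ r₂ hr hu hv =>
    have h1 := hsplit hu hL
    have h2 := hsplit hu hL'
    simp only [List.map_cons, List.cons.injEq] at h1 h2
    obtain ⟨ha, hb, -⟩ := h1
    obtain ⟨hc, hd, -⟩ := h2
    have e1 : ((hol s x)⁻¹ : Rˣ) * (hol s x : R) = 1 := by simp
    have e2 : ((hol s y)⁻¹ : Rˣ) * (hol s y : R) = 1 := by simp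
    have h3 : ∀ p a d, E (overRow x p a d).rel = E (coord d) - E (coord a) := by
      intro p a d
      rw [← map_sub]; rfl
    have h4 : ∀ a b c p, E (underRowTrue s k x y p a b c).rel = ((hol s x)⁻¹ : Rˣ) * E (coord c) -
        ((hol s x)⁻¹ : Rˣ) * (1 - hol s y ^ 2) * E (coord a) - hol s x * E (coord b) := by
      intro a b c p
      simp only [← smul_eq_mul, ← map_smul, ← map_sub]
      rfl
    have h5 : ∀ a b d p, E (underRowFalse s k x y p a b d).rel = hol s y * E (coord d) -
        ((hol s y)⁻¹ : Rˣ) * E (coord a) -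
        ((hol s y)⁻¹ : Rˣ) * (hol s x ^ 2 - 1) * E (coord b) := by
      intro a b c p
      simp only [← smul_eq_mul, ← map_smul, ← map_sub]
      rfl
    have h6 : ∀ p b c, E (overRow y p b c).rel = E (coord c) - E (coord b) := by
      intro p b c
      rw [← map_sub]; rfl
    intro z hx
    simp [rowsOf] at hx
    cases t <;> simp only [if_true, Bool.false_eq_true, if_false] at hr <;>
      obtain ⟨rfl, rfl⟩ := hr <;> obtain rfl | rfl := hx
    · rw [h6, hc, hb, sub_self]
    · rw [h5, hd, ha, hb]
      linear_combination (-((hol s x : R) ^ 2 - 1) * hol s y) * e2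
    · rw [h4, hc, ha, hb]
      linear_combination (((hol s y : R) ^ 2 - 1) * hol s x) * e1
    · rw [h3, hd, ha, sub_self]

/-- The sum of the edges of a level, each multiplied by the word read from the left. -/
def levelSum : List (Strand n) → List Name → Name → R
  | a :: st, b :: L, e => coord b e + hol s a ^ 2 * levelSum st L e
  | _, _, _ => 0

theorem levelSum_append (su sv : List (Strand n)) (Lu Lv : List Name)
    (hu : Lu.length = su.length) (e : Name) :
    levelSum s (su ++ sv) (Lu ++ Lv) e = levelSum s su Lu e + holProd s su * levelSum s sv Lv e := by
  induction su generalizing Lu with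
  | nil =>
    obtain rfl := List.length_eq_zero_iff.1 hu
    simp [levelSum, holProd]
  | cons a su ih =>
    obtain ⟨b, Lu, rfl, hu'⟩ := exists_cons _ hu
    simp only [List.cons_append, levelSum, ih Lu hu', holProd, List.map_cons, List.prod_cons]
    push_cast
    ring

variable {s} in
-- `levelSum` is the Fox differential of the word read across a whole level. The words below and
-- above a slice agree modulo its relations, and the multiplicities express this equality of
-- differentials.
theorem SliceView.mult_sum {k : ℕ} {c : Slice n Bool} {st t : List (Strand n)}
    {L L' : List Name} {P : List (Instr Name (Row R))} (h : SliceView s k c st t L L' P)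
    (e : Name) : ((rowsOf P).map fun x => x.mult * x.rel e).sum =
      levelSum s t L' e - levelSum s st L e := by
  cases h with
  | cup su sv Lu Lv g d hu hv =>
    rw [levelSum_append s _ _ _ _ hu, levelSum_append s _ _ _ _ hu]
    have e1 : ((s g)⁻¹ : Rˣ) * (s g : R) = 1 := by simp
    cases d <;> simp [rowsOf, cupRow, levelSum, hol]
    · linear_combination (-holProd s su * levelSum s sv Lv e) *
        (((s g)⁻¹ : Rˣ) * (s g : R) + 1) * e1
    · linear_combination (-holProd s su * levelSum s sv Lv e) *
        (((s g)⁻¹ : Rˣ) * (s g : R) + 1) * e1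
  | cap su sv Lu Lv x a b hu hv =>
    rw [levelSum_append s _ _ _ _ hu, levelSum_append s _ _ _ _ hu]
    obtain ⟨g, d⟩ := x
    have e1 : ((s g)⁻¹ : Rˣ) * (s g : R) = 1 := by simp
    cases d <;> simp [rowsOf, capRow, levelSum, hol]
    · linear_combination (holProd s su * levelSum s sv Lv e) *
        (((s g)⁻¹ : Rˣ) * (s g : R) + 1) * e1
    · linear_combination (holProd s su * levelSum s sv Lv e) *
        (((s g)⁻¹ : Rˣ) * (s g : R) + 1) * e1
  | cross su sv Lu Lv t x y a b r₁ r₂ hr hu hv =>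
    have e1 : ((hol s x)⁻¹ : Rˣ) * (hol s x : R) = 1 := by simp
    have e2 : ((hol s y)⁻¹ : Rˣ) * (hol s y : R) = 1 := by simp
    rw [levelSum_append s _ _ _ _ hu, levelSum_append s _ _ _ _ hu]
    cases t <;> simp only [if_true, Bool.false_eq_true, if_false] at hr <;>
      obtain ⟨rfl, rfl⟩ := hr <;>
      simp only [rowsOf, overRow, underRowTrue, underRowFalse, levelSum, List.map_cons,
        List.map_nil, List.sum_cons, List.sum_nil]
    · linear_combination (-holProd s su * (coord a e + ((hol s x : R) ^ 2 - 1) * coord b e)) * e2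
    · linear_combination (holProd s su * (coord (k + 1, su.length) e -
        (1 - (hol s y : R) ^ 2) * coord a e)) * e1

variable {s} in
theorem SliceView.mult_isUnit {k : ℕ} {c : Slice n Bool} {st t : List (Strand n)}
    {L L' : List Name} {P : List (Instr Name (Row R))} (h : SliceView s k c st t L L' P) :
    ∀ x ∈ rowsOf P, IsUnit x.mult := by
  have hp : ∀ l, IsUnit (holProd s l) := by
    intro l
    induction l with
    | nil => simp [holProd]
    | cons a l ih =>
      simp only [holProd, List.map_cons, List.prod_cons] at ih ⊢
      exact (Units.isUnit _).mul ih
  cases h with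
  | cup => simp [rowsOf, cupRow, hp]
  | cap => simp [rowsOf, capRow, hp]
  | cross su sv Lu Lv t x y a b r₁ r₂ hr hu hv =>
    cases t <;> simp only [if_true, Bool.false_eq_true, if_false] at hr <;>
      obtain ⟨rfl, rfl⟩ := hr <;> simp [rowsOf, overRow, underRowTrue, underRowFalse, hp]

variable (D : LinkDiagram n)

/-- The sums of the slices telescope from the empty bottom level to the empty top level. -/
theorem LinkDiagram.mult_sum (e : Name) :
    ((rowsOf (D.program s)).map fun x => x.mult * x.rel e).sum = 0 := by
  have key : ∀ j ≤ D.word.length, ((rowsOf ((List.range j).flatMap (D.instrs s))).map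
      fun x => x.mult * x.rel e).sum = levelSum s (D.state j) (namesAt D.word j) e := by
    intro j hj
    induction j with
    | zero => simp [rowsOf, D.state_zero, levelSum]
    | succ j ih =>
      have hc : D.word[j]? = some D.word[j] := by simp
      rw [List.range_succ, List.flatMap_append, rowsOf_append, List.map_append, List.sum_append,
        ih (by omega)]
      simp [(D.sliceView s j _ hc).mult_sum e]
  rw [D.program_eq, key _ le_rfl, D.state_length]
  simp [levelSum]

/-- The image of the letter read when crossing an edge from left to right. -/
def LinkDiagram.hsq (e : Name) : R := (D.strandAt e).elim 0 fun a => (hol s a : R) ^ 2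

theorem LinkDiagram.hsq_namesAt (k : ℕ) (hk : k ≤ D.word.length) :
    (namesAt D.word k).map (D.hsq s) = (D.state k).map fun a => (hol s a : R) ^ 2 := by
  have h := congrArg (List.map fun o : Option (Strand n) => o.elim 0 fun a => (hol s a : R) ^ 2)
    (D.strandAt_namesAt k hk)
  rw [List.map_map, List.map_map] at h
  exact h

end Kernels

/-! ### Removing the sign of the order of the columns. -/

section Determinant
variable {n : ℕ} {K : Type} [Field K] (s : Fin n → Kˣ) (D : LinkDiagram n)

/-- A nonzero determinant of coordinate forms forces `l` to be a rearrangement of `o`. Both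
determinants then contain the sign of the same permutation, and it disappears from their product. -/
theorem det_coord_eq {m : ℕ} (A : Matrix (Fin m) Name K) (o : Fin m → Name) (w : Fin m → K)
    (l : Fin m → Name) (h : (Matrix.of fun i j => w i * coord (o i) (l j)).det ≠ 0) :
    Function.Injective o ∧ (Matrix.of fun i j => A i (l j)).det *
      (Matrix.of fun i j => w i * coord (o i) (l j)).det =
      (∏ i, w i) * (Matrix.of fun i j => A i (o j)).det := by
  have hw : (Matrix.of fun i j => w i * coord (o i) (l j)).det =
      (∏ i, w i) * (Matrix.of fun i j => (coord (o i) (l j) : K)).det := Matrix.det_mul_column _ _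
  rw [hw] at h ⊢
  have h := right_ne_zero_of_mul h
  have hinj : Function.Injective o := by
    intro i i' hi
    by_contra hne
    apply h
    exact Matrix.det_zero_of_row_eq hne (by funext j; simp [hi])
  refine ⟨hinj, ?_⟩
  have hex : ∀ i, ∃ j, l j = o i := by
    intro i
    by_contra! hne
    apply h
    exact Matrix.det_eq_zero_of_row_eq_zero i fun j => by simp [coord, hne j]
  choose σ hσ using hex
  have hσi : Function.Injective σ := fun i j hij => hinj (by rw [← hσ, ← hσ, hij])
  let τ : Equiv.Perm (Fin m) := Equiv.ofBijective σ (Finite.injective_iff_bijective.1 hσi)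
  have hτ : ∀ j, l (τ j) = o j := hσ
  have h1 := Matrix.det_permute' τ (Matrix.of fun i j => A i (l j))
  have h2 := Matrix.det_permute' τ (Matrix.of fun i j => (coord (o i) (l j) : K))
  have h3 : (Matrix.of fun i j => A i (l j)).submatrix id τ = Matrix.of fun i j => A i (o j) := by
    ext i j; simp [hτ]
  have h4 : (Matrix.of fun i j => (coord (o i) (l j) : K)).submatrix id τ = 1 := by
    ext i j
    simp [hτ, coord, Matrix.one_apply, hinj.eq_iff, eq_comm]
  rw [h3] at h1
  rw [h4, Matrix.det_one] at h2
  have h5 : ((Equiv.Perm.sign τ : ℤ) : K) * ((Equiv.Perm.sign τ : ℤ) : K) = 1 := by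
    rw [← Int.cast_mul, ← Units.val_mul, Int.units_mul_self]
    simp
  rw [h1]
  set a := (Matrix.of fun i j => A i (l j)).det
  set b := (Matrix.of fun i j => (coord (o i) (l j) : K)).det
  linear_combination (-(∏ i, w i) * a * ((Equiv.Perm.sign τ : ℤ) : K)) * h2 -
    (∏ i, w i) * a * b * h5

end Determinant
end Conway

namespace Conway

/-! ### Cutting a diagram open at its bottom minimum. -/

section Cut
variable {n : ℕ} {R : Type} [CommRing R] (s : Fin n → Rˣ)

/-- The state that replaces the first minimum, labelled `g`, when the diagram is cut open there. -/
def cutState (g : Fin n) (d : Bool) : List Bool → R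
  | [true, false] => if d then s g else -(((s g)⁻¹ : Rˣ) : R) ^ 2
  | _ => 0

/-- The value of a diagram that is cut open at its first minimum. -/
def cutValue : List (Slice n Bool) → R
  | ⟨_, .cup g d⟩ :: w => opW s w [(g, d), (g, !d)] (cutState s g d) []
  | _ => 0

theorem exec_congr {ι ρ : Type} (f f' : ρ → ι → R) (P : List (Instr ι ρ))
    (h : ∀ x ∈ rowsOf P, f x = f' x) (L : List ι) (ψ : List Bool → R) :
    exec f P L ψ = exec f' P L ψ := by
  induction P generalizing L ψ with
  | nil => rfl
  | cons c P ih =>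
    cases c with
    | birth i a b => exact ih h _ _
    | consume i => exact ih h _ _
    | row x =>
      simp only [exec]
      rw [h x (by simp [rowsOf]), ih fun y hy => h y (by simp [rowsOf, hy])]

end Cut

theorem first_cup {n : ℕ} {X : Type} (c : Slice n X) (t : List (Strand n))
    (h : c.apply [] = some t) : ∃ g d, c = ⟨0, .cup g d⟩ ∧ t = [(g, d), (g, !d)] := by
  obtain ⟨i, ⟨g, d⟩ | _ | x⟩ := c
  · simp [Slice.apply] at h
    obtain ⟨rfl, rfl⟩ := h
    exact ⟨g, d, rfl, rfl⟩
  · simp [Slice.apply] at h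
  · simp [Slice.apply] at h

theorem Diagram.exists_cup {n : ℕ} {X : Type} (D : Diagram n X) :
    ∃ g d w, D.word = ⟨0, .cup g d⟩ :: w ∧ run w [(g, d), (g, !d)] = some [] := by
  have hne := D.nonempty
  have hcl := D.closed
  cases hw : D.word with
  | nil => exact absurd hw hne
  | cons c w =>
    rw [hw] at hcl
    simp only [run] at hcl
    cases hc : c.apply [] with
    | none => simp [hc] at hcl
    | some t =>
      obtain ⟨g, d, rfl, rfl⟩ := first_cup c t hc
      exact ⟨g, d, w, rfl, by simpa [hc] using hcl⟩

/-! ### The cut value as an entry of the adjugate. -/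

section Value
variable {n : ℕ} {K : Type} [Field K] (s : Fin n → Kˣ) (D : LinkDiagram n)

theorem LinkDiagram.program_wellFormed (f : Row K → Name → K)
    (hf : ∀ x ∈ rowsOf (D.program s), ∀ e, x.rel e = 0 → x.diag e = 0 → f x e = 0) :
    WellFormed f (D.program s) [] :=
  prog_wellFormed s f 0 D.word [] [] hf D.closed ⟨rfl, by simp, by simp⟩

/-- The run of simplified relations is a unit, so no edge is outgoing twice; since there are as many
relations as edges, every edge is outgoing exactly once. Columns can therefore be indexed by the
relations through their outgoing edges. -/
theorem LinkDiagram.exists_rows : ∃ (m : ℕ) (x : Fin m → Row K),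
    (rowsOf (D.program s)).reverse = List.ofFn x ∧ Function.Injective (fun i => (x i).out) ∧
    (∀ e ∈ births (D.program s), ∃ i, (x i).out = e) ∧
    ∀ f, WellFormed f (D.program s) [] →
      exec f (D.program s) [] (fun _ => 1) [] * exec Row.diag (D.program s) [] (fun _ => 1) [] =
        (∏ i, (x i).wt) * (Matrix.of fun i j => f (x i) (x j).out).det := by
  have hN : Names (n := n) 0 [] [] := ⟨rfl, by simp, by simp⟩
  have hU := (exec_prog s 0 D.word [] [] D.closed hN (fun _ => 1) (fun _ => 1) (by
    intro σ hσ h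
    exact absurd (List.length_eq_zero_iff.1 hσ) h)).2 (by simp)
  have hwf := D.program_wellFormed s Row.diag fun _ _ _ _ h => h
  have hcard := prog_card s 0 D.word [] [] [] D.closed hN
  change IsUnit (exec Row.diag (D.program s) [] (fun _ => 1) []) at hU
  change _ + 2 * (births (D.program s)).length = _ + 2 * (rowsOf (D.program s)).length at hcard
  obtain ⟨m, x, hx⟩ : ∃ (m : ℕ) (x : Fin m → Row K),
      (rowsOf (D.program s)).reverse = List.ofFn x :=
    ⟨_, fun i => (rowsOf (D.program s)).reverse.get i, (List.ofFn_get _).symm⟩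
  obtain ⟨l, hl⟩ := exec_eq_det (D.program s) m x hx Row.diag hwf (fun _ => 1) hU.ne_zero
  have hd := hl Row.diag hwf fun _ => 1
  rw [one_mul] at hd
  have hd0 := hU.ne_zero
  rw [hd] at hd0
  -- The zero matrix is a dummy; only injectivity is wanted here.
  obtain ⟨hinj, -⟩ := det_coord_eq (0 : Matrix (Fin m) Name K) (fun i => (x i).out)
    (fun i => (x i).wt) l hd0
  have hmem : ∀ i, x i ∈ rowsOf (D.program s) := fun i => by
    rw [← List.mem_reverse, hx]
    simp
  have hm : (rowsOf (D.program s)).length = m := by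
    rw [← List.length_reverse, hx, List.length_ofFn]
  refine ⟨m, x, hx, hinj, ?_, fun f hf => ?_⟩
  · have hsub : Finset.univ.image (fun i => (x i).out) ⊆ (births (D.program s)).toFinset := by
      intro e he
      obtain ⟨i, -, rfl⟩ := Finset.mem_image.1 he
      exact List.mem_toFinset.2 (D.mem_births_of_row s _ (hmem i)).1
    have heq := Finset.eq_of_subset_of_card_le hsub (by
      rw [Finset.card_image_of_injective _ hinj, Finset.card_univ, Fintype.card_fin]
      refine (List.toFinset_card_le _).trans ?_
      simp at hcard
      omega)
    intro e he
    rw [← List.mem_toFinset, ← heq] at he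
    obtain ⟨i, -, h⟩ := Finset.mem_image.1 he
    exact ⟨i, h⟩
  · rw [hd, hl f hf, one_mul]
    exact (det_coord_eq (Matrix.of fun i e => f (x i) e) (fun i => (x i).out)
      (fun i => (x i).wt) l hd0).2

/-- The Conway potential function of a diagram. -/
noncomputable def LinkDiagram.conway : K :=
  match D.word with
  | ⟨_, .cup g _⟩ :: _ => cutValue s D.word / (s g - ((s g)⁻¹ : Kˣ))
  | _ => 0

variable {s D} in
/-- The rows of the program of a diagram. -/
structure LinkDiagram.IsRows {m : ℕ} (x : Fin m → Row K) : Prop where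
  eq : (rowsOf (D.program s)).reverse = List.ofFn x
  inj : Function.Injective fun i => (x i).out
  surj : ∀ e ∈ births (D.program s), ∃ i, (x i).out = e
  value : ∀ f, WellFormed f (D.program s) [] →
      exec f (D.program s) [] (fun _ => 1) [] * exec Row.diag (D.program s) [] (fun _ => 1) [] =
        (∏ i, (x i).wt) * (Matrix.of fun i j => f (x i) (x j).out).det

/-- The matrix of the relations of a diagram. -/
def relMatrix {m : ℕ} (x : Fin m → Row K) : Matrix (Fin m) (Fin m) K :=
  Matrix.of fun i j => (x i).rel (x j).out

variable {s D} {m : ℕ} {x : Fin m → Row K}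

theorem LinkDiagram.IsRows.mem (hx : LinkDiagram.IsRows (s := s) (D := D) x)
    (i : Fin m) : x i ∈ rowsOf (D.program s) := by
  rw [← List.mem_reverse, hx.eq]
  simp

theorem LinkDiagram.IsRows.exists_eq (hx : LinkDiagram.IsRows (s := s) (D := D) x)
    (y : Row K) (hy : y ∈ rowsOf (D.program s)) :
    ∃ i, x i = y := by
  rw [← List.mem_reverse, hx.eq] at hy
  simpa using hy

theorem LinkDiagram.IsRows.sum (hx : LinkDiagram.IsRows (s := s) (D := D) x)
    (F : Row K → K) :
    ((rowsOf (D.program s)).map F).sum = ∑ i, F (x i) := by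
  rw [← List.sum_reverse, ← List.map_reverse, hx.eq, List.map_ofFn, List.sum_ofFn]
  rfl

theorem LinkDiagram.IsRows.nodup (hx : LinkDiagram.IsRows (s := s) (D := D) x) : ((rowsOf (D.program s)).map Row.out).Nodup := by
  rw [← List.nodup_reverse, ← List.map_reverse, hx.eq, List.map_ofFn]
  exact List.nodup_ofFn.2 hx.inj

/-- Applies `SliceView.rel_kernel` to the functional `E` that pairs a form with the values of the
letters minus one; bijectivity of the outgoing edges gives its values on coordinate forms. -/
theorem LinkDiagram.IsRows.right_kernel (hx : LinkDiagram.IsRows (s := s) (D := D) x)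
    (i : Fin m) :
    ∑ j, (x i).rel (x j).out * (D.hsq s (x j).out - 1) = 0 := by
  let E : (Name → K) →ₗ[K] K := ∑ j, (D.hsq s (x j).out - 1) • LinearMap.proj (x j).out
  have hE : ∀ r, E r = ∑ j, r (x j).out * (D.hsq s (x j).out - 1) := by
    intro r
    simp [E, mul_comm]
  have hc : ∀ a ∈ births (D.program s), E (coord a) = D.hsq s a - 1 := by
    intro a ha
    obtain ⟨q, rfl⟩ := hx.surj a ha
    rw [hE, Finset.sum_eq_single q]
    · simp [coord]
    · intro j _ hj
      have : (x j).out ≠ (x q).out := fun h => hj (hx.inj h)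
      simp [coord, this]
    · simp
  have hL : ∀ k ≤ D.word.length, (namesAt D.word k).map (fun a => E (coord a)) =
      (D.state k).map fun a => (hol s a : K) ^ 2 - 1 := by
    intro k hk
    have := congrArg (List.map fun z : K => z - 1) (D.hsq_namesAt s k hk)
    rw [List.map_map, List.map_map] at this
    refine Eq.trans (List.map_congr_left fun a ha => ?_) this
    exact hc a (D.mem_births_of_mem_namesAt s k hk a ha)
  rw [← hE]
  obtain ⟨k, hk, hi⟩ := (D.mem_rows s _).1 (hx.mem i)
  exact (D.sliceView s k D.word[k] (by simp)).rel_kernel E (hL k hk.le) (hL (k + 1) hk) _ hi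

theorem LinkDiagram.IsRows.left_kernel (hx : LinkDiagram.IsRows (s := s) (D := D) x)
    (j : Fin m) :
    ∑ i, (x i).mult * (x i).rel (x j).out = 0 := by
  rw [← hx.sum fun y => y.mult * y.rel (x j).out]
  exact D.mult_sum s _

theorem LinkDiagram.IsRows.mult_ne_zero (hx : LinkDiagram.IsRows (s := s) (D := D) x)
    (i : Fin m) : (x i).mult ≠ 0 := by
  obtain ⟨k, hk, hi⟩ := (D.mem_rows s _).1 (hx.mem i)
  exact ((D.sliceView s k D.word[k] (by simp)).mult_isUnit _ hi).ne_zero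

theorem LinkDiagram.IsRows.hsq_ne_one (hx : LinkDiagram.IsRows (s := s) (D := D) x)
    (hs : ∀ g, (s g : K) ^ 2 ≠ 1) (i : Fin m) :
    D.hsq s (x i).out - 1 ≠ 0 := by
  have h1 : ∀ a : Strand n, (hol s a : K) ^ 2 - 1 ≠ 0 := by
    rintro ⟨g, d⟩
    rw [sub_ne_zero]
    cases d
    · exact hs g
    · simpa [hol] using hs g
  have hb := (D.mem_births_of_row s _ (hx.mem i)).1
  obtain ⟨k, hk, hi⟩ := (D.mem_births s _).1 hb
  have h2 := (D.sliceView s k D.word[k] (by simp)).mem_next.2.1 _ hi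
  have h3 := D.hsq_namesAt s (k + 1) hk
  have h4 : D.hsq s (x i).out ∈ (D.state (k + 1)).map fun a => (hol s a : K) ^ 2 := by
    rw [← h3]
    exact List.mem_map_of_mem h2
  obtain ⟨a, -, ha⟩ := List.mem_map.1 h4
  rw [← ha]
  exact h1 a

/-- Both kernels contain a vector without zero entries, so the adjugate is proportional to their
outer product. This lies behind the independence of the potential function of the deleted row and
column. -/
theorem LinkDiagram.IsRows.adjugate (hx : LinkDiagram.IsRows (s := s) (D := D) x)
    (hs : ∀ g, (s g : K) ^ 2 ≠ 1) (q r q' r' : Fin m) :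
    (relMatrix x).adjugate q r * (D.hsq s (x q').out - 1) * (x r').mult =
      (relMatrix x).adjugate q' r' * (D.hsq s (x q).out - 1) * (x r).mult := by
  have h1 := adjugate_mul_right_kernel (relMatrix x) (fun j => D.hsq s (x j).out - 1)
    (fun h => hx.hsq_ne_one hs q (congrFun h q)) (funext fun i => hx.right_kernel i) q q' r
  have h2 := adjugate_mul_left_kernel (relMatrix x) (fun j => (x j).mult)
    (fun h => hx.mult_ne_zero q (congrFun h q)) (funext fun i => hx.left_kernel i) q' r r'
  beta_reduce at h1 h2
  linear_combination (x r').mult * h1 + (D.hsq s (x q).out - 1) * h2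

theorem LinkDiagram.IsRows.det_eq_zero (hx : LinkDiagram.IsRows (s := s) (D := D) x)
    (hs : ∀ g, (s g : K) ^ 2 ≠ 1) (q : Fin m) :
    (relMatrix x).det = 0 :=
  Matrix.exists_mulVec_eq_zero_iff.1 ⟨fun j => D.hsq s (x j).out - 1,
    fun h => hx.hsq_ne_one hs q (congrFun h q), funext fun i => hx.right_kernel i⟩

/-- Replacing one of the first relations of a diagram by a coordinate form. -/
theorem LinkDiagram.IsRows.cut (hx : LinkDiagram.IsRows (s := s) (D := D) x)
    (pre : List (Instr Name (Row K))) (k : ℕ) (w : List (Slice n Bool))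
    (st : List (Strand n)) (L : List Name) (hP : D.program s = pre ++ prog s k w st L)
    (hw : run w st = some []) (hL : Names k st L) (q r : Fin m) (κ : K)
    (hr : x r ∈ rowsOf pre) (hqr : (x r).rel (x q).out ≠ 0) (φ ε : List Bool → K)
    (hφ : ∀ f : Row K → Name → K, f (x r) = κ • coord (x q).out →
      (∀ y, y.out ≠ (x r).out → f y = y.rel) →
      ∀ Q, exec f (pre ++ Q) [] (fun _ => 1) = exec f Q L φ)
    (hε : ∀ Q, exec Row.diag (pre ++ Q) [] (fun _ => 1) = exec Row.diag Q L ε)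
    (hU : UpSupported st ε) :
    opW s w st (fun σ => φ σ * ε (ups st)) [] =
      κ * (∏ i, (x i).wt) * (relMatrix x).adjugate q r := by
  let f : Row K → Name → K := fun y => if y.out = (x r).out then κ • coord (x q).out else y.rel
  have h1 : f (x r) = κ • coord (x q).out := if_pos rfl
  have h2 : ∀ y, y.out ≠ (x r).out → f y = y.rel := fun y hy => if_neg hy
  -- The coordinate form lies within the support of the relation it replaces, by `hqr`, so the
  -- program still fits.
  have hf : WellFormed f (D.program s) [] := by
    refine D.program_wellFormed s f fun y hy e he _ => ?_
    by_cases hyr : y.out = (x r).out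
    · obtain ⟨i, rfl⟩ := hx.exists_eq y hy
      obtain rfl := hx.inj hyr
      have : e ≠ (x q).out := by
        rintro rfl
        exact hqr he
      simp [h1, coord, this]
    · rw [h2 y hyr, he]
  have htail : ∀ y ∈ rowsOf (prog s k w st L), f y = y.rel := by
    intro y hy
    apply h2
    have := hx.nodup
    rw [hP, rowsOf_append, List.map_append, List.nodup_append] at this
    exact fun h => this.2.2 _ (List.mem_map_of_mem hr) _ (List.mem_map_of_mem hy) h.symm
  have h3 := hx.value f hf
  rw [hP, hφ f h1 h2, hε, exec_congr _ _ _ htail, (exec_prog s k w st L hw hL φ ε hU).1] at h3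
  -- Replacing row `r` by a multiple of a basis vector turns the determinant into an entry of the
  -- adjugate.
  have h4 : (Matrix.of fun i j => f (x i) (x j).out) =
      (relMatrix x).updateRow r (κ • Pi.single q 1) := by
    ext i j
    by_cases hi : i = r
    · subst hi
      rw [Matrix.updateRow_self, Matrix.of_apply, h1]
      by_cases hj : j = q
      · subst hj
        simp [coord]
      · have : (x j).out ≠ (x q).out := fun h => hj (hx.inj h)
        simp [coord, this, hj]
    · rw [Matrix.updateRow_ne hi, Matrix.of_apply, h2 _ fun h => hi (hx.inj h)]
      rfl
  rw [h3, h4, Matrix.det_updateRow_smul, ← Matrix.adjugate_apply]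
  ring

/-- `cutState` is what remains of the bottom minimum when its relation is replaced by a multiple of
the coordinate form of the left leg, including the scalar of the simplified relation. -/
theorem LinkDiagram.IsRows.cut_first (hx : LinkDiagram.IsRows (s := s) (D := D) x)
    (g : Fin n) (d : Bool) (w : List (Slice n Bool)) (hw : D.word = ⟨0, .cup g d⟩ :: w) :
    ∃ q r, (x q).out = (1, 0) ∧ (x r).mult = 1 ∧ cutValue s D.word =
      (if d then (s g : K) else -((s g)⁻¹ : Kˣ)) * (∏ i, (x i).wt) *
        (relMatrix x).adjugate q r := by
  have hcl : run w [(g, d), (g, !d)] = some [] := by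
    have := D.closed
    rw [hw] at this
    simpa [run, Slice.apply] using this
  have hP : D.program s = [.birth 0 (1, 0) (1, 1), .row (cupRow s g d 1 (1, 0) (1, 1))] ++
      prog s 1 w [(g, d), (g, !d)] [(1, 0), (1, 1)] := by
    simp [LinkDiagram.program, hw, prog, sliceProg, nextNames, Slice.apply, holProd]
  obtain ⟨r, hr⟩ := hx.exists_eq (cupRow s g d 1 (1, 0) (1, 1)) (by simp [hP, rowsOf])
  obtain ⟨q, hq⟩ := hx.surj (1, 0) (by simp [hP, births])
  refine ⟨q, r, hq, by simp [hr, cupRow], ?_⟩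
  have hN : Names 1 [(g, d), (g, !d)] [((1, 0) : Name), (1, 1)] := ⟨rfl, by simp, by simp⟩
  have hsp := spec_cup (s := s) [] [] g d 1 [] [] (1, 0) (1, 1) rfl (by simp) (by simp) (by simp)
    (fun _ => 1) (fun _ => 1) (by
      intro σ hσ h
      exact absurd (List.length_eq_zero_iff.1 hσ) h)
  have := hx.cut _ 1 w _ _ hP hcl hN q r (if d then (s g : K) else -((s g)⁻¹ : Kˣ))
    (by simp [hr, rowsOf]) (by rw [hr, hq]; simp [cupRow, coord])
    (cr [(1, 0), (1, 1)] ((if d then (s g : K) else -((s g)⁻¹ : Kˣ)) • coord (1, 0))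
      (birthF 0 fun _ => 1))
    (cr [(1, 0), (1, 1)] (cupRow s g d 1 (1, 0) (1, 1)).diag (birthF 0 fun _ => 1))
    (fun f h1 _ Q => by
      rw [hr, hq] at h1
      simp [exec, h1])
    (fun Q => by simp [exec]) hsp.1
  rw [← this, hw, cutValue]
  refine opW_congr s w _ _ hcl (fun σ hσ => ?_) [] rfl
  obtain ⟨a, b, rfl⟩ := List.length_eq_two.1 hσ
  cases d <;> cases a <;> cases b <;>
    simp [cutState, cr, birthF, coord, ups, cupRow, Row.diag, cupWt] <;> ring

/-- The entry of the adjugate at the bottom minimum is known from `cut_first`; proportionality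
carries the formula to every other entry. All comparisons of diagrams go through this identity. -/
theorem LinkDiagram.IsRows.conway_eq (hx : LinkDiagram.IsRows (s := s) (D := D) x)
    (hs : ∀ g, (s g : K) ^ 2 ≠ 1) (q r : Fin m) :
    D.conway s * (D.hsq s (x q).out - 1) * (x r).mult =
      -(∏ i, (x i).wt) * (relMatrix x).adjugate q r := by
  obtain ⟨g, d, w, hw, hcl⟩ := D.exists_cup
  obtain ⟨q₀, r₀, h1, h2, h3⟩ := hx.cut_first g d w hw
  have h4 := hx.adjugate hs q r q₀ r₀
  have h5 : D.hsq s (x q₀).out = (hol s (g, d) : K) ^ 2 := by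
    rw [h1]
    simp [LinkDiagram.hsq, Diagram.strandAt, Diagram.state, hw, run, Slice.apply]
  have hsg := hs g
  have h0 : (s g : K) ≠ 0 := (s g).ne_zero
  have hne : (s g : K) - (s g : K)⁻¹ ≠ 0 := by
    intro h
    apply hsg
    field_simp at h
    linear_combination h
  -- The factor in `cutState` is chosen so that this product does not depend on the orientation `d`.
  have h6 : (if d then (s g : K) else -((s g)⁻¹ : Kˣ)) * (D.hsq s (x q₀).out - 1) =
      -((s g : K) - (s g : K)⁻¹) := by
    rw [h5]
    cases d <;> simp [hol] <;> field_simp <;> ring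
  have h7 : D.conway s = cutValue s D.word / ((s g : K) - (s g : K)⁻¹) := by
    simp [LinkDiagram.conway, hw]
  rw [h7, h3, div_mul_eq_mul_div, div_mul_eq_mul_div, div_eq_iff hne]
  rw [h2, mul_one] at h4
  linear_combination (-(if d then (s g : K) else -((s g)⁻¹ : Kˣ)) * (∏ i, (x i).wt)) * h4 +
    (∏ i, (x i).wt) * (relMatrix x).adjugate q r * h6

end Value
end Conway

namespace Conway

/-! ### Invariance of the cut value under all moves. -/

section Bottom
variable {n : ℕ} {K : Type} [Field K] (s : Fin n → Kˣ)

/-- The uncut state sum is the full determinant of the relations, up to a factor, and this matrix is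
singular. -/
theorem opW_closed_eq_zero (hs : ∀ g, (s g : K) ^ 2 ≠ 1) (D : LinkDiagram n) :
    opW s D.word [] (fun _ => 1) [] = 0 := by
  obtain ⟨m, x, h1, h2, h3, h4⟩ := D.exists_rows s
  have hx : LinkDiagram.IsRows (s := s) (D := D) x := ⟨h1, h2, h3, h4⟩
  have hE := (exec_prog s 0 D.word [] [] D.closed ⟨rfl, by simp, by simp⟩ (fun _ => 1)
    (fun _ => 1) (by
      intro σ hσ h
      exact absurd (List.length_eq_zero_iff.1 hσ) h)).1
  have hv := hx.value Row.rel (D.program_wellFormed s Row.rel fun _ _ _ h _ => h)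
  obtain ⟨g, d, w, hw, -⟩ := D.exists_cup
  obtain ⟨q, -⟩ := hx.cut_first g d w hw
  simp only [mul_one] at hE
  rw [← hE]
  change exec Row.rel (D.program s) [] _ [] * exec Row.diag (D.program s) [] _ [] = 0
  rw [hv]
  have := hx.det_eq_zero hs q
  rw [relMatrix] at this
  rw [this, mul_zero]

/-- A crossing above the cut legs mixes them: a cut state goes to the cut state of the reversed
minimum plus a multiple of the ordinary state of that minimum. The value of `μ` is irrelevant, since
`opW_closed_eq_zero` kills its contribution. -/
theorem cutState_kink (g : Fin n) (d x : Bool) : ∃ μ : K, ∀ σ : List Bool, σ.length = 2 →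
    op s ⟨0, .cross x⟩ [(g, d), (g, !d)] (cutState s g d) σ =
      (cutState s g (!d) + μ • op s ⟨0, .cup g (!d)⟩ [] fun _ => 1) σ := by
  have h0 : (s g : K) ≠ 0 := (s g).ne_zero
  refine ⟨if x then (if d then (s g : K)⁻¹ else -s g) else (if d then s g else -(s g : K)⁻¹), ?_⟩
  intro σ hσ
  obtain ⟨a, b, rfl⟩ := List.length_eq_two.1 hσ
  have h1 := op_cup s [] [] g (!d) (fun _ => 1) [] [] a b rfl
  simp only [List.length_nil, List.nil_append] at h1
  have h2 := op_cross_true s [] [] (g, d) (g, !d) (cutState s g d) [] [] a b rfl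
  have h3 := op_cross_false s [] [] (g, d) (g, !d) (cutState s g d) [] [] a b rfl
  simp only [List.length_nil, List.nil_append] at h2 h3
  simp only [Pi.add_apply, Pi.smul_apply, smul_eq_mul]
  rw [h1]
  cases x
  · rw [h3]
    cases d <;> cases a <;> cases b <;> simp [cutState, crossSign, hol, kern, cupWt, jw] <;>
      field_simp <;> ring
  · rw [h2]
    cases d <;> cases a <;> cases b <;> simp [cutState, crossSign, hol, kern, cupWt, jw] <;>
      field_simp <;> ring

theorem cutValue_kink (hs : ∀ g, (s g : K) ^ 2 ≠ 1) (g : Fin n) (d x : Bool)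
    (b : List (Slice n Bool)) (hb : run (⟨0, .cup g (!d)⟩ :: b) [] = some []) :
    cutValue s (⟨0, .cup g d⟩ :: ⟨0, .cross x⟩ :: b) = cutValue s (⟨0, .cup g (!d)⟩ :: b) := by
  obtain ⟨μ, hμ⟩ := cutState_kink s g d x
  have h0 := opW_closed_eq_zero s hs ⟨_, by simp, hb⟩
  have hb' : run b [(g, !d), (g, d)] = some [] := by
    simpa [run, Slice.apply] using hb
  simp only [opW, Slice.apply, List.length_nil, le_refl, if_true, Option.getD_some, List.take_nil,
    List.drop_nil, List.nil_append, Bool.not_not] at h0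
  simp only [cutValue, opW, Slice.apply, List.drop_zero, List.take_zero, List.nil_append,
    Option.getD_some, Bool.not_not]
  rw [opW_congr s b _ [] hb' hμ [] rfl, opW_add, opW_smul]
  simp [h0]

/-- Exchanging two bottom minima changes which of them is cut. Cutting `D` at its second minimum
gives another entry of the same adjugate, and `conway_eq` relates it to the first one, including the
change of the divisor from label `g` to label `g'`. -/
theorem conway_far (hs : ∀ g, (s g : K) ^ 2 ≠ 1) (D : LinkDiagram n) (g g' : Fin n) (d d' : Bool)
    (b : List (Slice n Bool)) (hD : D.word = ⟨0, .cup g d⟩ :: ⟨2, .cup g' d'⟩ :: b) :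
    D.conway s = cutValue s (⟨0, .cup g' d'⟩ :: ⟨0, .cup g d⟩ :: b) /
      (s g' - ((s g')⁻¹ : Kˣ)) := by
  obtain ⟨m, x, h1, h2, h3, h4⟩ := D.exists_rows s
  have hx : LinkDiagram.IsRows (s := s) (D := D) x := ⟨h1, h2, h3, h4⟩
  have hcl : run b [(g, d), (g, !d), (g', d'), (g', !d')] = some [] := by
    have := D.closed
    rw [hD] at this
    simpa [run, Slice.apply] using this
  have hh : (hol s (g, d) : K) ^ 2 * (hol s (g, !d) : K) ^ 2 = 1 := by
    cases d <;> simp [hol, ← mul_pow]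
  have hP : D.program s = [.birth 0 (1, 0) (1, 1), .row (cupRow s g d 1 (1, 0) (1, 1)),
      .birth 2 (2, 2) (2, 3), .row (cupRow s g' d' 1 (2, 2) (2, 3))] ++
      prog s 2 b [(g, d), (g, !d), (g', d'), (g', !d')] [(1, 0), (1, 1), (2, 2), (2, 3)] := by
    simp [LinkDiagram.program, hD, prog, sliceProg, nextNames, Slice.apply, holProd, hh]
  obtain ⟨r, hr⟩ := hx.exists_eq (cupRow s g' d' 1 (2, 2) (2, 3)) (by simp [hP, rowsOf])
  obtain ⟨q, hq⟩ := hx.surj (2, 2) (by simp [hP, births])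
  have hN : Names 2 [(g, d), (g, !d), (g', d'), (g', !d')]
    [((1, 0) : Name), (1, 1), (2, 2), (2, 3)] := ⟨rfl, by simp, by simp⟩
  have hsp := spec_cup (s := s) [] [] g d 1 [] [] (1, 0) (1, 1) rfl (by simp) (by simp) (by simp)
    (fun _ => 1) (fun _ => 1) (by
      intro σ hσ h
      exact absurd (List.length_eq_zero_iff.1 hσ) h)
  have hsp2 := spec_cup (s := s) [(g, d), (g, !d)] [] g' d' 1 [(1, 0), (1, 1)] [] (2, 2) (2, 3)
    rfl (by simp) (by simp) (by simp) (fun _ => 1) _ hsp.1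
  set κ : K := if d' then (s g' : K) else -((s g')⁻¹ : Kˣ) with hκ
  have key := hx.cut _ 2 b _ _ hP hcl hN q r κ
    (by simp [hr, rowsOf]) (by rw [hr, hq]; simp [cupRow, coord])
    (cr [(1, 0), (1, 1), (2, 2), (2, 3)] (κ • coord (2, 2)) (birthF 2
      (cr [(1, 0), (1, 1)] (cupRow s g d 1 (1, 0) (1, 1)).rel (birthF 0 fun _ => 1))))
    (cr [(1, 0), (1, 1), (2, 2), (2, 3)] (cupRow s g' d' 1 (2, 2) (2, 3)).diag (birthF 2
      (cr [(1, 0), (1, 1)] (cupRow s g d 1 (1, 0) (1, 1)).diag (birthF 0 fun _ => 1))))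
    (fun f h1 h2 Q => by
      rw [hr, hq] at h1
      rw [hr] at h2
      have h2 := h2 (cupRow s g d 1 (1, 0) (1, 1)) (by
        cases d <;> cases d' <;> simp [cupRow])
      simp [exec, h1, h2])
    (fun Q => by simp [exec]) hsp2.1
  have hc := hx.conway_eq hs q r
  have hsg := hs g'
  have h0 : (s g' : K) ≠ 0 := (s g').ne_zero
  have h0' : (s g : K) ≠ 0 := (s g).ne_zero
  have hne : (s g' : K) - (s g' : K)⁻¹ ≠ 0 := by
    intro h
    apply hsg
    field_simp at h
    linear_combination h
  have h5 : D.hsq s (x q).out = (hol s (g', d') : K) ^ 2 := by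
    rw [hq]
    simp [LinkDiagram.hsq, Diagram.strandAt, Diagram.state, hD, run, Slice.apply]
  have h6 : κ * (D.hsq s (x q).out - 1) = -((s g' : K) - (s g' : K)⁻¹) := by
    rw [h5, hκ]
    cases d' <;> simp [hol] <;> field_simp <;> ring
  have h7 : (x r).mult = 1 := by simp [hr, cupRow]
  -- With the minima in the other order, the cut value is literally the value of `D` cut at its
  -- second minimum: the two states on the four legs coincide.
  have h8 : cutValue s (⟨0, .cup g' d'⟩ :: ⟨0, .cup g d⟩ :: b) =
      κ * (∏ i, (x i).wt) * (relMatrix x).adjugate q r := by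
    rw [← key]
    simp only [cutValue, opW, Slice.apply, List.take_zero, List.drop_zero, List.nil_append,
      zero_le, if_true, Option.getD_some]
    refine opW_congr s b _ _ hcl (fun σ hσ => ?_) [] rfl
    obtain ⟨a₁, σ, rfl, hσ1⟩ := exists_cons _ hσ
    obtain ⟨a₂, σ, rfl, hσ2⟩ := exists_cons _ hσ1
    obtain ⟨a₃, a₄, rfl⟩ := List.length_eq_two.1 hσ2
    have e1 := op_cup s [] [(g', d'), (g', !d')] g d (cutState s g' d') [] [a₃, a₄] a₁ a₂ rfl
    simp only [List.length_nil, List.nil_append] at e1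
    rw [e1]
    clear key hsp hsp2 hc
    rw [hκ]
    cases d <;> cases d' <;> cases a₁ <;> cases a₂ <;> cases a₃ <;> cases a₄ <;>
      simp [cutState, cr, birthF, coord, ups, cupRow, Row.diag, cupWt, kern, jw, hol] <;>
      field_simp
  rw [eq_div_iff (by simpa using hne), h8]
  rw [h7, mul_one] at hc
  rw [Units.val_inv_eq_inv_val]
  linear_combination D.conway s * h6 - κ * hc

theorem conway_moveStep (hs : ∀ g, (s g : K) ^ 2 ≠ 1) (D E : LinkDiagram n) (h : D.MoveStep E) :
    D.conway s = E.conway s := by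
  obtain ⟨a, b, l, r, hm, hD, hE⟩ := h
  have hDc := D.closed
  have hEc := E.closed
  cases a with
  -- The move lies above the bottom minimum, which is the same in both diagrams, so local invariance
  -- suffices.
  | cons c a =>
    obtain ⟨g, d, w, hw, hcl⟩ := D.exists_cup
    rw [hD] at hw
    simp only [List.cons_append, List.cons.injEq] at hw
    obtain ⟨rfl, rfl⟩ := hw
    rw [hD] at hDc
    rw [hE] at hEc
    have hcl' : run (a ++ r ++ b) [(g, d), (g, !d)] = some [] := by
      simpa [run, Slice.apply] using hEc
    have hsplit : ∀ m, run (a ++ m ++ b) [(g, d), (g, !d)] = some [] → ∃ st t,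
        run a [(g, d), (g, !d)] = some st ∧ run m st = some t ∧ run b t = some [] := by
      intro m h
      rw [run_append, run_append] at h
      obtain ⟨t, h, h3⟩ := Option.bind_eq_some_iff.1 h
      obtain ⟨st, h1, h2⟩ := Option.bind_eq_some_iff.1 h
      exact ⟨st, t, h1, h2, h3⟩
    obtain ⟨st, t, i1, i2, i3⟩ := hsplit l hcl
    obtain ⟨st', t', j1, j2, j3⟩ := hsplit r hcl'
    obtain rfl : st = st' := by simpa [i1] using j1
    obtain ⟨rfl, hop⟩ := Move.localEq s hm st t t' i2 j2
    simp only [LinkDiagram.conway, hD, hE, List.cons_append, cutValue]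
    rw [List.append_assoc, List.append_assoc, opW_append s a _ _ st i1,
      opW_append s a _ _ st i1, opW_append s l _ _ t i2, opW_append s r _ _ t j2]
    rw [opW_congr s b t [] i3 (hop _) [] rfl]
  | nil =>
    simp only [List.nil_append] at hD hE
    rw [hD] at hDc
    rw [hE] at hEc
    cases hm with
    | far i r A B =>
      obtain ⟨g, d, w, hw, -⟩ := D.exists_cup
      obtain ⟨g', d', w', hw', -⟩ := E.exists_cup
      rw [hD] at hw
      rw [hE] at hw'
      simp only [List.cons_append, List.cons.injEq, Slice.mk.injEq] at hw hw'
      obtain ⟨⟨rfl, rfl⟩, -⟩ := hw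
      obtain ⟨⟨h1, rfl⟩, -⟩ := hw'
      -- The other diagram must also start at position `0`, so there are no strands between the two
      -- minima.
      obtain rfl : r = 0 := by omega
      have hD' : D.word = ⟨0, .cup g d⟩ :: ⟨2, .cup g' d'⟩ :: b := by
        rw [hD]; simp [Piece.outWidth]
      have hE' : E.word = ⟨0, .cup g' d'⟩ :: ⟨0, .cup g d⟩ :: b := by
        rw [hE]; simp [Piece.inWidth]
      rw [conway_far s hs D g g' d d' b hD']
      simp [LinkDiagram.conway, hE']
    | kinkCup i g d x =>
      obtain ⟨g', d', w, hw, -⟩ := D.exists_cup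
      rw [hD] at hw
      simp only [List.cons_append, List.cons.injEq, Slice.mk.injEq] at hw
      obtain ⟨⟨rfl, -⟩, -⟩ := hw
      simp only [LinkDiagram.conway, hD, hE, List.cons_append, List.nil_append]
      rw [cutValue_kink s hs g d x b hEc]
    -- This move and those below act on a strand that is already there, so they cannot start at the
    -- empty level.
    | zigzagRight i g d =>
      obtain ⟨g', d', w, hw, -⟩ := D.exists_cup
      rw [hD] at hw
      simp only [List.cons_append, List.cons.injEq, Slice.mk.injEq] at hw
      obtain ⟨⟨rfl, -⟩, -⟩ := hw
      simp [run, Slice.apply] at hDc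
    | slideCup i g d x =>
      obtain ⟨g', d', w, hw, -⟩ := D.exists_cup
      rw [hD] at hw
      simp only [List.cons_append, List.cons.injEq, Slice.mk.injEq] at hw
      obtain ⟨⟨rfl, -⟩, -⟩ := hw
      simp [run, Slice.apply] at hDc
    | zigzagLeft i g d =>
      simp [run, Slice.apply] at hDc
    | slideCap i x => simp [run, Slice.apply] at hDc
    | kinkCap i x => simp [run, Slice.apply] at hDc
    | cancel i x => simp [run, Slice.apply] at hDc
    | braid i x y z h => simp [run, Slice.apply] at hDc

theorem conway_eq_of_link (hs : ∀ g, (s g : K) ^ 2 ≠ 1) (D E : LinkDiagram n)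
    (h : Link.mk D = Link.mk E) : D.conway s = E.conway s :=
  congrArg (Quot.lift (fun D : LinkDiagram n => D.conway s) (conway_moveStep s hs)) h

end Bottom
end Conway

namespace Conway

/-! ### Edges, arcs, and the crossing at which an arc starts. -/

section Arcs
variable {n : ℕ} {R : Type} [CommRing R] {s : Fin n → Rˣ}

theorem SliceView.cup_inv {k i : ℕ} {g : Fin n} {d : Bool} {st t : List (Strand n)}
    {L L' : List Name} {P : List (Instr Name (Row R))}
    (h : SliceView s k ⟨i, .cup g d⟩ st t L L' P) : ∃ su sv Lu Lv, Lu.length = su.length ∧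
      Lv.length = sv.length ∧ i = su.length ∧ st = su ++ sv ∧ t = su ++ (g, d) :: (g, !d) :: sv ∧
      L = Lu ++ Lv ∧ L' = Lu ++ (k + 1, i) :: (k + 1, i + 1) :: Lv ∧
      rowsOf P = [cupRow s g d (holProd s su) (k + 1, i) (k + 1, i + 1)] := by
  cases h with
  | cup su sv Lu Lv g d hu hv => exact ⟨su, sv, Lu, Lv, hu, hv, rfl, rfl, rfl, rfl, rfl, rfl⟩

theorem SliceView.cap_inv {k i : ℕ} {st t : List (Strand n)}
    {L L' : List Name} {P : List (Instr Name (Row R))}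
    (h : SliceView s k ⟨i, .cap⟩ st t L L' P) : ∃ su sv Lu Lv x a b, Lu.length = su.length ∧
      Lv.length = sv.length ∧ i = su.length ∧ st = su ++ x :: (x.1, !x.2) :: sv ∧ t = su ++ sv ∧
      L = Lu ++ a :: b :: Lv ∧ L' = Lu ++ Lv ∧
      rowsOf P = [capRow s x (holProd s su) a b] := by
  cases h with
  | cap su sv Lu Lv x a b hu hv =>
    exact ⟨su, sv, Lu, Lv, x, a, b, hu, hv, rfl, rfl, rfl, rfl, rfl, rfl⟩

theorem SliceView.cross_inv {k i : ℕ} {u : Bool} {st t : List (Strand n)}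
    {L L' : List Name} {P : List (Instr Name (Row R))}
    (h : SliceView s k ⟨i, .cross u⟩ st t L L' P) : ∃ su sv Lu Lv x y a b, Lu.length = su.length ∧
      Lv.length = sv.length ∧ i = su.length ∧ st = su ++ x :: y :: sv ∧ t = su ++ y :: x :: sv ∧
      L = Lu ++ a :: b :: Lv ∧ L' = Lu ++ (k + 1, i) :: (k + 1, i + 1) :: Lv ∧
      rowsOf P = if u then [underRowTrue s k x y (holProd s su) a b (k + 1, i),
          overRow x (holProd s su * hol s y ^ 2) a (k + 1, i + 1)] else
        [overRow y (holProd s su) b (k + 1, i),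
          underRowFalse s k x y (holProd s su) a b (k + 1, i + 1)] := by
  cases h with
  | cross su sv Lu Lv t x y a b r₁ r₂ hr hu hv =>
    refine ⟨su, sv, Lu, Lv, x, y, a, b, hu, hv, rfl, rfl, rfl, rfl, rfl, ?_⟩
    cases u <;> simp only [if_true, Bool.false_eq_true, if_false] at hr <;>
      obtain ⟨rfl, rfl⟩ := hr <;> rfl

theorem SliceView.getElem {k : ℕ} {c : Slice n Bool} {st t : List (Strand n)} {L L' : List Name}
    {P : List (Instr Name (Row R))} (h : SliceView s k c st t L L' P) :
    (∀ p < c.pos, L[p]? = L'[p]?) ∧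
    (∀ p, L[c.pos + c.piece.inWidth + p]? = L'[c.pos + c.piece.outWidth + p]?) ∧
    (∀ p, c.pos ≤ p → p < c.pos + c.piece.outWidth → L'[p]? = some (k + 1, p)) ∧
    ∀ e ∈ births P, L'[e.2]? = some e := by
  cases h with
  | cup su sv Lu Lv g d hu hv =>
    simp only [Piece.inWidth, Piece.outWidth, births, ← hu]
    refine ⟨fun p hp => ?_, fun p => ?_, fun p hp hp' => ?_, ?_⟩
    · rw [List.getElem?_append_left hp, List.getElem?_append_left hp]
    · rw [List.getElem?_append_right (by omega), List.getElem?_append_right (by omega)]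
      simp [show Lu.length + 2 + p - Lu.length = p + 2 by omega]
    · obtain rfl | rfl : p = Lu.length ∨ p = Lu.length + 1 := by omega
      · simp
      · rw [List.getElem?_append_right (by omega)]; simp
    · intro e he
      simp at he
      rcases he with rfl | rfl
      · simp
      · rw [List.getElem?_append_right (by simp)]; simp
  | cap su sv Lu Lv x a b hu hv =>
    simp only [Piece.inWidth, Piece.outWidth, births, ← hu]
    refine ⟨fun p hp => ?_, fun p => ?_, fun p hp hp' => by omega, by simp⟩
    · rw [List.getElem?_append_left hp, List.getElem?_append_left hp]
    · rw [List.getElem?_append_right (by omega), List.getElem?_append_right (by omega)]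
      simp [show Lu.length + 2 + p - Lu.length = p + 2 by omega]
  | cross su sv Lu Lv t x y a b r₁ r₂ hr hu hv =>
    simp only [Piece.inWidth, Piece.outWidth, births, ← hu]
    refine ⟨fun p hp => ?_, fun p => ?_, fun p hp hp' => ?_, ?_⟩
    · rw [List.getElem?_append_left hp, List.getElem?_append_left hp]
    · rw [List.getElem?_append_right (by omega), List.getElem?_append_right (by omega)]
      simp [show Lu.length + 2 + p - Lu.length = p + 2 by omega]
    · obtain rfl | rfl : p = Lu.length ∨ p = Lu.length + 1 := by omega
      · simp
      · rw [List.getElem?_append_right (by omega)]; simp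
    · intro e he
      simp at he
      rcases he with rfl | rfl
      · simp
      · rw [List.getElem?_append_right (by simp)]; simp

variable (s) (D : LinkDiagram n)

/-- The edge through a point. -/
def LinkDiagram.nameOf (q : ℕ × ℕ) : Option Name := (namesAt D.word q.1)[q.2]?

/-- Follows the vertical strand down from `q` to the birth of its edge; each vertical step stays
within the arc. -/
theorem LinkDiagram.arc_nameOf (q : ℕ × ℕ) (hq : q.1 ≤ D.word.length) (e : Name)
    (he : D.nameOf q = some e) : D.arc q = D.arc e := by
  obtain ⟨k, p⟩ := q
  induction k generalizing p with
  | zero => simp [nameOf, namesAt] at he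
  | succ k ih =>
    simp only at hq
    have hc : D.word[k]? = some D.word[k] := by simp
    obtain ⟨h1, h2, h3, -⟩ := (D.sliceView (fun _ : Fin n => (1 : ℤˣ)) k _ hc).getElem
    have ih := fun p => ih p (by simp only; omega)
    simp only [nameOf] at he ih
    by_cases hp1 : p < D.word[k].pos
    · rw [← h1 p hp1] at he
      rw [← ih p he]
      exact (Quot.sound (Joined.left k p _ hc hp1)).symm
    by_cases hp2 : p < D.word[k].pos + D.word[k].piece.outWidth
    · rw [h3 p (by omega) hp2] at he
      obtain rfl := Option.some.inj he
      rfl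
    · obtain ⟨j, rfl⟩ : ∃ j, p = D.word[k].pos + D.word[k].piece.outWidth + j :=
        ⟨p - (D.word[k].pos + D.word[k].piece.outWidth), by omega⟩
      rw [← h2] at he
      rw [← ih _ he]
      exact (Quot.sound (Joined.right k j _ hc)).symm

theorem lt_length_of_getElem? {α : Type} {l : List α} {k : ℕ} {c : α} (h : l[k]? = some c) :
    k < l.length := (List.getElem?_eq_some_iff.1 h).1

/-- Vertical joinings stay on one edge; all others pass through a minimum, a maximum or an
overcrossing, whose relations are exactly the untagged ones. -/
theorem LinkDiagram.Joined.nameOf {D : LinkDiagram n} {q r : ℕ × ℕ} (h : D.Joined q r) :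
    D.nameOf q = D.nameOf r ∨ ∃ y ∈ rowsOf (D.program s), y.tag = none ∧
      ((D.nameOf q = some y.out ∧ D.nameOf r = some y.inn) ∨
        (D.nameOf q = some y.inn ∧ D.nameOf r = some y.out)) := by
  cases h with
  | left k p c hc hp => exact .inl ((D.sliceView s k c hc).getElem.1 p hp)
  | right k p c hc => exact .inl ((D.sliceView s k c hc).getElem.2.1 p)
  | cup k i g d hc =>
    right
    obtain ⟨su, sv, Lu, Lv, hu, hv, rfl, -, -, h1, h2, h3⟩ := (D.sliceView s k _ hc).cup_inv
    refine ⟨_, (D.mem_rows s _).2 ⟨k, lt_length_of_getElem? hc, by rw [h3]; exact List.mem_singleton_self _⟩,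
      rfl, ?_⟩
    simp only [LinkDiagram.nameOf, h2]
    cases d <;> simp [cupRow, ← hu]
  | cap k i hc =>
    right
    obtain ⟨su, sv, Lu, Lv, x, a, b, hu, hv, rfl, -, -, h1, h2, h3⟩ :=
      (D.sliceView s k _ hc).cap_inv
    refine ⟨_, (D.mem_rows s _).2 ⟨k, lt_length_of_getElem? hc, by rw [h3]; exact List.mem_singleton_self _⟩,
      rfl, ?_⟩
    simp only [LinkDiagram.nameOf, h1]
    obtain ⟨f, x⟩ := x
    cases x <;> simp [capRow, ← hu]
  | overRight k i hc =>
    right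
    obtain ⟨su, sv, Lu, Lv, x, y, a, b, hu, hv, rfl, -, -, h1, h2, h3⟩ :=
      (D.sliceView s k _ hc).cross_inv
    refine ⟨overRow x (holProd s su * hol s y ^ 2) a (k + 1, su.length + 1),
      (D.mem_rows s _).2 ⟨k, lt_length_of_getElem? hc, by rw [h3]; simp⟩, rfl, ?_⟩
    simp only [LinkDiagram.nameOf, h1, h2]
    obtain ⟨f, x⟩ := x
    cases x <;> simp [overRow, ← hu]
  | overLeft k i hc =>
    right
    obtain ⟨su, sv, Lu, Lv, x, y, a, b, hu, hv, rfl, -, -, h1, h2, h3⟩ :=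
      (D.sliceView s k _ hc).cross_inv
    refine ⟨overRow y (holProd s su) b (k + 1, su.length),
      (D.mem_rows s _).2 ⟨k, lt_length_of_getElem? hc, by rw [h3]; simp⟩, rfl, ?_⟩
    simp only [LinkDiagram.nameOf, h1, h2]
    obtain ⟨f, y⟩ := y
    cases y <;> simp [overRow, ← hu]

theorem LinkDiagram.nameOf_birth (e : Name) (he : e ∈ births (D.program s)) :
    e.1 ≤ D.word.length ∧ D.nameOf e = some e := by
  obtain ⟨k, hk, he⟩ := (D.mem_births s e).1 he
  have hv := D.sliceView s k D.word[k] (by simp)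
  have h1 := hv.support.1 e he
  refine ⟨by omega, ?_⟩
  rw [nameOf, h1]
  exact hv.getElem.2.2.2 e he

/-- The relation of an uncut line is about two edges of the same arc. -/
theorem LinkDiagram.arc_out_eq_arc_inn (y : Row R) (hy : y ∈ rowsOf (D.program s))
    (ht : y.tag = none) : D.arc y.out = D.arc y.inn := by
  obtain ⟨k, hk, hy⟩ := (D.mem_rows s y).1 hy
  have hc : D.word[k]? = some D.word[k] := by simp
  have hv := D.sliceView s k _ hc
  have hN := fun p e h => D.arc_nameOf (k, p) hk.le e h
  simp only [nameOf] at hN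
  rcases hw : D.word[k] with ⟨i, ⟨g, d⟩ | _ | u⟩
  · rw [hw] at hv hc
    obtain ⟨su, sv, Lu, Lv, hu, hv, rfl, -, -, h1, h2, h3⟩ := hv.cup_inv
    have := Quot.sound (Joined.cup k _ g d hc)
    rw [h3, List.mem_singleton] at hy
    subst hy
    cases d
    · exact this.symm
    · exact this
  · rw [hw] at hv hc
    obtain ⟨su, sv, Lu, Lv, x, a, b, hu, hv, rfl, -, -, h1, h2, h3⟩ := hv.cap_inv
    have h4 : D.arc (k, su.length) = D.arc (k, su.length + 1) := Quot.sound (Joined.cap k _ hc)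
    rw [hN su.length a (by simp [h1, ← hu]), hN (su.length + 1) b (by simp [h1, ← hu])] at h4
    rw [h3, List.mem_singleton] at hy
    subst hy
    obtain ⟨f, x⟩ := x
    cases x
    · exact h4
    · exact h4.symm
  · rw [hw] at hv hc
    obtain ⟨su, sv, Lu, Lv, x, z, a, b, hu, hv, rfl, -, -, h1, h2, h3⟩ := hv.cross_inv
    have ha := hN su.length a (by simp [h1, ← hu])
    have hb := hN (su.length + 1) b (by simp [h1, ← hu])
    rw [h3] at hy
    cases u
    · have h4 : D.arc (k, su.length + 1) = D.arc (k + 1, su.length) :=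
        Quot.sound (Joined.overLeft k _ hc)
      rw [hb] at h4
      simp only [Bool.false_eq_true, if_false, List.mem_cons, List.not_mem_nil, or_false] at hy
      obtain rfl | rfl := hy
      · obtain ⟨f, z⟩ := z
        cases z
        · exact h4
        · exact h4.symm
      · simp [underRowFalse] at ht
    · have h4 : D.arc (k, su.length) = D.arc (k + 1, su.length + 1) :=
        Quot.sound (Joined.overRight k _ hc)
      rw [ha] at h4
      simp only [if_true, List.mem_cons, List.not_mem_nil, or_false] at hy
      obtain rfl | rfl := hy
      · simp [underRowTrue] at ht
      · obtain ⟨f, x⟩ := x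
        cases x
        · exact h4
        · exact h4.symm

/-- The edge `e` is reached in `d` steps from the edge that starts at the crossing at level `k`. -/
inductive Origin (rows : List (Row R)) : Name → ℕ → ℕ → Prop
  | start (y : Row R) (hy : y ∈ rows) (k : ℕ) (ht : y.tag = some k) : Origin rows y.out k 0
  | step (y : Row R) (hy : y ∈ rows) (ht : y.tag = none) (k d : ℕ) (h : Origin rows y.inn k d) :
      Origin rows y.out k (d + 1)

variable {s}

theorem Origin.inv_start {rows : List (Row R)} (hn : (rows.map Row.out).Nodup) {y : Row R}
    (hy : y ∈ rows) {k k' d : ℕ} (ht : y.tag = some k) (h : Origin rows y.out k' d) :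
    k' = k ∧ d = 0 := by
  generalize he : y.out = e at h
  cases h with
  | start z hz k' hk =>
    obtain rfl := List.inj_on_of_nodup_map hn hy hz he
    rw [ht] at hk
    exact ⟨(Option.some.inj hk).symm, rfl⟩
  | step z hz hk k' d h =>
    obtain rfl := List.inj_on_of_nodup_map hn hy hz he
    rw [ht] at hk
    cases hk

theorem Origin.inv_step {rows : List (Row R)} (hn : (rows.map Row.out).Nodup) {y : Row R}
    (hy : y ∈ rows) {k d : ℕ} (ht : y.tag = none) (h : Origin rows y.out k d) :
    ∃ d', d = d' + 1 ∧ Origin rows y.inn k d' := by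
  generalize he : y.out = e at h
  cases h with
  | start z hz k' hk =>
    obtain rfl := List.inj_on_of_nodup_map hn hy hz he
    rw [ht] at hk
    cases hk
  | step z hz hk k' d h =>
    obtain rfl := List.inj_on_of_nodup_map hn hy hz he
    exact ⟨d, rfl, h⟩

/-- An edge is outgoing for only one relation, so the way back along its arc is forced. The step
count serves as the grading for a triangularity argument. -/
theorem Origin.unique {rows : List (Row R)} (hn : (rows.map Row.out).Nodup) {e : Name}
    {k d k' d' : ℕ} (h : Origin rows e k d) (h' : Origin rows e k' d') : k = k' ∧ d = d' := by
  induction h generalizing k' d' with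
  | start y hy k ht =>
    obtain ⟨rfl, rfl⟩ := h'.inv_start hn hy ht
    exact ⟨rfl, rfl⟩
  | step y hy ht k d h ih =>
    obtain ⟨d', rfl, h1⟩ := h'.inv_step hn hy ht
    obtain ⟨rfl, rfl⟩ := ih h1
    exact ⟨rfl, rfl⟩

variable (s)

/-- The crossings at which the arc through a point starts. -/
def LinkDiagram.origins (q : ℕ × ℕ) : Set ℕ :=
  {k | ∃ e d, D.nameOf q = some e ∧ Origin (rowsOf (D.program s)) e k d}

variable {s D}

/-- Makes `origins` descend to arcs, so that equality of arcs, a quotient relation, can be turned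
back into a path of edges. -/
theorem LinkDiagram.Joined.origins {q r : ℕ × ℕ} (h : D.Joined q r)
    (hn : ((rowsOf (D.program s)).map Row.out).Nodup) : D.origins s q = D.origins s r := by
  have key : ∀ y ∈ rowsOf (D.program s), y.tag = none → ∀ k,
      (∃ d, Origin (rowsOf (D.program s)) y.out k d) ↔
        ∃ d, Origin (rowsOf (D.program s)) y.inn k d := by
    intro y hy ht k
    constructor
    · rintro ⟨d, h⟩
      obtain ⟨d', -, h⟩ := h.inv_step hn hy ht
      exact ⟨d', h⟩
    · rintro ⟨d, h⟩
      exact ⟨d + 1, .step y hy ht k d h⟩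
  obtain h | ⟨y, hy, ht, ⟨h1, h2⟩ | ⟨h1, h2⟩⟩ := h.nameOf s
  · simp [LinkDiagram.origins, h]
  · ext k
    simpa [LinkDiagram.origins, h1, h2] using key y hy ht k
  · ext k
    simpa [LinkDiagram.origins, h1, h2] using (key y hy ht k).symm

theorem LinkDiagram.origins_eq_of_arc_eq (hn : ((rowsOf (D.program s)).map Row.out).Nodup)
    {q r : ℕ × ℕ} (h : D.arc q = D.arc r) : D.origins s q = D.origins s r :=
  congrArg (Quot.lift (D.origins s) fun _ _ h => h.origins hn) h

theorem LinkDiagram.crossing_word (c : D.Crossing) :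
    D.word[c.level]? = some ⟨c.pos, .cross c.type⟩ := by
  have h : ∀ (z : Slice n Bool) (hz : z.piece.crossType.isSome = true),
      z = ⟨z.pos, .cross (z.piece.crossType.get hz)⟩ := by
    rintro ⟨i, _ | _ | x⟩ hz <;> simp [Piece.crossType] at hz ⊢
  have h1 : D.word[c.level]? = some D.word[c.1] := by simp [Diagram.Crossing.level]
  rw [h1]
  exact congrArg some (h _ c.2)

theorem LinkDiagram.exists_crossing {k i : ℕ} {u : Bool} (h : D.word[k]? = some ⟨i, .cross u⟩) :
    ∃ c : D.Crossing, c.level = k ∧ c.pos = i ∧ c.type = u := by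
  obtain ⟨hk, h⟩ := List.getElem?_eq_some_iff.1 h
  have h' : D.word[(⟨k, hk⟩ : Fin D.word.length)] = ⟨i, .cross u⟩ := h
  refine ⟨⟨⟨k, hk⟩, by rw [h']; rfl⟩, rfl, ?_, ?_⟩
  · simp [Diagram.Crossing.pos, h]
  · simp [Diagram.Crossing.type, h, Piece.crossType]

theorem LinkDiagram.crossing_ext {c c' : D.Crossing} (h : c.level = c'.level) : c = c' :=
  Subtype.ext (Fin.ext h)

end Arcs
end Conway

namespace Conway

/-! ### Relations of edges compared with Fox derivatives of Wirtinger relators. -/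

section Wirtinger
variable {n : ℕ} {K : Type} [Field K] (s : Fin n → Kˣ) (D : LinkDiagram n)

/-- The factor between the letter of a strand and the letter read from left to right. -/
def flip (a : Strand n) : K := if a.2 then -((s a.1 : K) ^ 2)⁻¹ else 1

/-- The factor between the letter of an edge and the letter read from left to right. -/
def LinkDiagram.flip (e : Name) : K := (D.strandAt e).elim 1 (Conway.flip s)

/-- The image of the letter of an arc. -/
def LinkDiagram.tau (a : D.Arc) : K := a.label.elim 1 fun g => (s g : K) ^ 2

theorem LinkDiagram.abel_of (a : D.Arc) :
    D.abel s (MonoidAlgebra.of ℤ _ (FreeGroup.of a)) = D.tau s a := by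
  rw [abel, MonoidAlgebra.lift_of]
  simp only [MonoidHom.comp_apply, FreeGroup.lift_apply_of, tau]
  cases a.label <;> simp

theorem LinkDiagram.abel_of_inv (a : D.Arc) :
    D.abel s (MonoidAlgebra.of ℤ _ (FreeGroup.of a)⁻¹) = (D.tau s a)⁻¹ := by
  rw [abel, MonoidAlgebra.lift_of]
  simp only [MonoidHom.comp_apply, FreeGroup.lift_apply_of, tau, map_inv]
  cases a.label <;> simp

theorem LinkDiagram.tau_ne_zero (a : D.Arc) : D.tau s a ≠ 0 := by
  unfold tau
  cases a.label <;> simp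

open Classical in
-- The product rule. The two arcs of the line passing under have the same image under `φ`, which
-- collapses the terms of the overpassing letter to one.
theorem LinkDiagram.abel_fox_positive (a o b e : D.Arc) (h : D.tau s e = D.tau s b) :
    D.abel s (foxDeriv a (FreeGroup.of o * FreeGroup.of b * (FreeGroup.of o)⁻¹ *
      (FreeGroup.of e)⁻¹)) = (1 - D.tau s b) * (if o = a then 1 else 0) +
        D.tau s o * (if b = a then 1 else 0) - if e = a then 1 else 0 := by
  have h1 : FreeGroup.of o * FreeGroup.of b * (FreeGroup.of o)⁻¹ * (FreeGroup.of e)⁻¹ =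
      FreeGroup.mk [(o, true), (b, true), (o, false), (e, false)] := rfl
  have h2 : foxDeriv a (FreeGroup.mk [(o, true), (b, true), (o, false), (e, false)]) =
      foxWord a [(o, true), (b, true), (o, false), (e, false)] := rfl
  have ho := D.tau_ne_zero s o
  have hb := D.tau_ne_zero s b
  have hi : ∀ P : Prop, D.abel s (if P then 1 else 0) = if P then 1 else 0 := by
    intro P; split_ifs <;> simp
  rw [h1, h2]
  simp only [foxWord, map_add, map_mul, map_sub, D.abel_of, D.abel_of_inv, hi, map_zero, h]
  field_simp
  ring

open Classical in
theorem LinkDiagram.abel_fox_negative (a o b e : D.Arc) (h : D.tau s e = D.tau s b) :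
    D.abel s (foxDeriv a (FreeGroup.of b * FreeGroup.of o * (FreeGroup.of e)⁻¹ *
      (FreeGroup.of o)⁻¹)) = (D.tau s b - 1) * (if o = a then 1 else 0) +
        (if b = a then 1 else 0) - D.tau s o * if e = a then 1 else 0 := by
  have h1 : FreeGroup.of b * FreeGroup.of o * (FreeGroup.of e)⁻¹ * (FreeGroup.of o)⁻¹ =
      FreeGroup.mk [(b, true), (o, true), (e, false), (o, false)] := rfl
  have h2 : foxDeriv a (FreeGroup.mk [(b, true), (o, true), (e, false), (o, false)]) =
      foxWord a [(b, true), (o, true), (e, false), (o, false)] := rfl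
  have ho := D.tau_ne_zero s o
  have hb := D.tau_ne_zero s b
  have hi : ∀ P : Prop, D.abel s (if P then 1 else 0) = if P then 1 else 0 := by
    intro P; split_ifs <;> simp
  rw [h1, h2]
  simp only [foxWord, map_add, map_mul, map_sub, D.abel_of, D.abel_of_inv, hi, map_zero, h]
  field_simp
  ring

/-- Identifies the multiplicities of the relations, defined through `holProd`, with the base words
of the potential function. -/
theorem LinkDiagram.abel_pathWord (k r : ℕ) (su sv : List (Strand n)) (h : D.state k = su ++ sv)
    (hr : r = su.length) :
    D.abel s (MonoidAlgebra.of ℤ _ (D.pathWord k r)) = holProd s su := by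
  subst hr
  rw [abel, MonoidAlgebra.lift_of, pathWord, map_list_prod, List.map_map, holProd]
  congr 1
  apply List.ext_getElem
  · simp
  · intro p h1 h2
    simp only [List.length_map, List.length_range] at h1
    have hs : (D.state k)[p]? = some su[p] := by
      rw [h, List.getElem?_append_left (by simpa using h1)]
      simp
    have hl : (D.arc (k, p)).label = some su[p].1 := by
      change D.labelAt (k, p) = _
      simp [Diagram.labelAt, hs]
    have hu : D.upAt (k, p) = su[p].2 := by simp [Diagram.upAt, hs]
    simp only [List.getElem_map, List.getElem_range, Function.comp_apply, hu]
    generalize su[p] = a at *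
    obtain ⟨g, d⟩ := a
    cases d <;> simp [hl, hol]

/-- The relation at an undercrossing, up to the factor `wt / (weight * flip)`, is the abelianised
Wirtinger relation. -/
structure LinkDiagram.CrossingRow (c : D.Crossing) (y : Row K) (o : Name) : Prop where
  over_mem : o ∈ births (D.program s)
  over_arc : D.arc o = overArc c
  out_arc : D.arc y.out = startArc c
  inn_arc : D.arc y.inn = endArc c
  label : D.tau s (endArc c) = D.tau s (startArc c)
  rel : (IsPositive c ∧ ∀ e, y.wt * y.rel e * D.flip s e = y.weight * D.flip s y.out *
        ((1 - D.tau s (startArc c)) * coord o e + D.tau s (overArc c) * coord y.out e -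
          coord y.inn e)) ∨
      (¬ IsPositive c ∧ ∀ e, y.wt * y.rel e * D.flip s e = y.weight * D.flip s y.out *
        ((D.tau s (startArc c) - 1) * coord o e + coord y.out e -
          D.tau s (overArc c) * coord y.inn e))
  base : D.abel s (MonoidAlgebra.of ℤ _ (baseWord c)) * y.wt =
    -(y.mult * y.weight * D.flip s y.out)

theorem LinkDiagram.strandAt_nameOf (q : ℕ × ℕ) (hq : q.1 ≤ D.word.length) (e : Name)
    (he : D.nameOf q = some e) : D.strandAt e = D.strandAt q := by
  have h := congrArg (fun l => l[q.2]?) (D.strandAt_namesAt q.1 hq)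
  simp only [List.getElem?_map] at h
  rw [nameOf] at he
  rw [he] at h
  cases hs : (D.state q.1)[q.2]? with
  | none => simp [hs] at h
  | some a =>
    simp [hs] at h
    rw [h, Diagram.strandAt, hs]

/-- The factor `flip` comes from the differential of an inverse, `d(x⁻¹) = -x⁻¹ dx`. Once columns
refer to the letters of arcs, an untagged relation just equates the letters of its two edges. -/
theorem LinkDiagram.rel_flip (y : Row K) (hy : y ∈ rowsOf (D.program s)) (ht : y.tag = none)
    (e : Name) : y.wt * y.rel e * D.flip s e =
      y.weight * D.flip s y.out * (coord y.out e - coord y.inn e) := by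
  obtain ⟨k, hk, hy⟩ := (D.mem_rows s y).1 hy
  have hc : D.word[k]? = some D.word[k] := by simp
  have hv := D.sliceView s k _ hc
  have hN := fun p e h => D.strandAt_nameOf (k, p) hk.le e h
  have hN' := fun p e h => D.strandAt_nameOf (k + 1, p) hk e h
  simp only [nameOf, Diagram.strandAt] at hN hN'
  have hco : ∀ {a : Name} {v : K}, D.flip s a = v → coord a e * D.flip s e = coord a e * v := by
    rintro a v rfl
    by_cases h : e = a
    · rw [h]
    · simp [coord, h]
  have h0 : ∀ g, (s g : K) ≠ 0 := fun g => (s g).ne_zero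
  rcases hw : D.word[k] with ⟨i, ⟨g, d⟩ | _ | u⟩
  · rw [hw] at hv hc
    obtain ⟨su, sv, Lu, Lv, hu, hv, rfl, -, e2, h1, h2, h3⟩ := hv.cup_inv
    have fa : D.flip s (k + 1, su.length) = Conway.flip s (g, d) := by
      simp [flip, Diagram.strandAt, e2]
    have fb : D.flip s (k + 1, su.length + 1) = Conway.flip s (g, !d) := by
      simp [flip, Diagram.strandAt, e2]
    rw [h3, List.mem_singleton] at hy
    subst hy
    have ca := hco fa
    have cb := hco fb
    cases d
    · simp [cupRow, cupWt, hol, Conway.flip] at fa fb ca cb ⊢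
      rw [fb]
      have := h0 g
      field_simp at ca cb ⊢
      linear_combination ca + cb
    · simp [cupRow, cupWt, hol, Conway.flip] at fa fb ca cb ⊢
      rw [fa]
      have := h0 g
      field_simp at ca cb ⊢
      linear_combination ca + cb
  · rw [hw] at hv hc
    obtain ⟨su, sv, Lu, Lv, ⟨g, d⟩, a, b, hu, hv, rfl, e1, -, h1, h2, h3⟩ := hv.cap_inv
    have fa : D.flip s a = Conway.flip s (g, d) := by
      have := hN su.length a (by simp [h1, ← hu])
      simp [flip, Diagram.strandAt, e1, this]
    have fb : D.flip s b = Conway.flip s (g, !d) := by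
      have := hN (su.length + 1) b (by simp [h1, ← hu])
      simp [flip, Diagram.strandAt, e1, this]
    rw [h3, List.mem_singleton] at hy
    subst hy
    have ca := hco fa
    have cb := hco fb
    cases d
    · simp [capRow, hol, Conway.flip] at fa fb ca cb ⊢
      rw [fa]
      have := h0 g
      field_simp at ca cb ⊢
      linear_combination ca + cb
    · simp [capRow, hol, Conway.flip] at fa fb ca cb ⊢
      rw [fb]
      have := h0 g
      field_simp at ca cb ⊢
      linear_combination ca + cb
  · rw [hw] at hv hc
    obtain ⟨su, sv, Lu, Lv, x, z, a, b, hu, hv, rfl, e1, e2, h1, h2, h3⟩ := hv.cross_inv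
    have fa : D.flip s a = Conway.flip s x := by
      have := hN su.length a (by simp [h1, ← hu])
      simp [flip, Diagram.strandAt, e1, this]
    have fb : D.flip s b = Conway.flip s z := by
      have := hN (su.length + 1) b (by simp [h1, ← hu])
      simp [flip, Diagram.strandAt, e1, this]
    have fc : D.flip s (k + 1, su.length) = Conway.flip s z := by
      simp [flip, Diagram.strandAt, e2]
    have fd : D.flip s (k + 1, su.length + 1) = Conway.flip s x := by
      simp [flip, Diagram.strandAt, e2]
    have ca := hco fa
    have cb := hco fb
    have cc := hco fc
    have cd := hco fd
    rw [h3] at hy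
    cases u
    · simp only [Bool.false_eq_true, if_false, List.mem_cons, List.not_mem_nil, or_false] at hy
      obtain rfl | rfl := hy
      · obtain ⟨f, z⟩ := z
        cases z <;> simp [overRow, fb, fc]
        · linear_combination cb - cc
        · linear_combination cc - cb
      · simp [underRowFalse] at ht
    · simp only [if_true, List.mem_cons, List.not_mem_nil, or_false] at hy
      obtain rfl | rfl := hy
      · simp [underRowTrue] at ht
      · obtain ⟨f, x⟩ := x
        cases x <;> simp [overRow, fa, fd]
        · linear_combination ca - cd
        · linear_combination cd - ca

theorem LinkDiagram.tag_inv (y : Row K) (hy : y ∈ rowsOf (D.program s)) (k : ℕ)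
    (ht : y.tag = some k) : ∃ i u, D.word[k]? = some ⟨i, .cross u⟩ ∧
      y ∈ rowsOf (D.instrs s k) := by
  obtain ⟨k', hk, hy⟩ := (D.mem_rows s y).1 hy
  have hc : D.word[k']? = some D.word[k'] := by simp
  have hv := D.sliceView s k' _ hc
  rcases hw : D.word[k'] with ⟨i, ⟨g, d⟩ | _ | u⟩
  · rw [hw] at hv
    obtain ⟨su, sv, Lu, Lv, -, -, rfl, -, -, -, -, h3⟩ := hv.cup_inv
    rw [h3, List.mem_singleton] at hy
    simp [hy, cupRow] at ht
  · rw [hw] at hv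
    obtain ⟨su, sv, Lu, Lv, x, a, b, -, -, rfl, -, -, -, -, h3⟩ := hv.cap_inv
    rw [h3, List.mem_singleton] at hy
    simp [hy, capRow] at ht
  · rw [hw] at hv hc
    have hy' := hy
    obtain ⟨su, sv, Lu, Lv, x, z, a, b, -, -, rfl, -, -, -, -, h3⟩ := hv.cross_inv
    suffices k' = k by subst this; exact ⟨_, u, hc, hy'⟩
    rw [h3] at hy
    cases u
    · simp only [Bool.false_eq_true, if_false, List.mem_cons, List.not_mem_nil, or_false] at hy
      obtain rfl | rfl := hy
      · simp [overRow] at ht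
      · simpa [underRowFalse] using ht
    · simp only [if_true, List.mem_cons, List.not_mem_nil, or_false] at hy
      obtain rfl | rfl := hy
      · simpa [underRowTrue] using ht
      · simp [overRow] at ht

theorem LinkDiagram.tag_unique (y z : Row K) (hy : y ∈ rowsOf (D.program s))
    (hz : z ∈ rowsOf (D.program s)) (k : ℕ) (hty : y.tag = some k) (htz : z.tag = some k) :
    y = z := by
  obtain ⟨i, u, hc, hy⟩ := D.tag_inv s y hy k hty
  obtain ⟨i, -, -, hz⟩ := D.tag_inv s z hz k htz
  obtain ⟨su, sv, Lu, Lv, x, z, a, b, -, -, rfl, -, -, -, -, h3⟩ := (D.sliceView s k _ hc).cross_inv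
  rw [h3] at hy hz
  cases u
  · simp only [Bool.false_eq_true, if_false, List.mem_cons, List.not_mem_nil, or_false] at hy hz
    obtain rfl | rfl := hy <;> obtain rfl | rfl := hz <;> simp_all [overRow]
  · simp only [if_true, List.mem_cons, List.not_mem_nil, or_false] at hy hz
    obtain rfl | rfl := hy <;> obtain rfl | rfl := hz <;> simp_all [overRow]

/-- A check over two decorations and four pairs of directions. The field `weight` of a relation is
defined so that the rescaled undercrossing relation is exactly the abelianised Fox derivative of the
relator. -/
theorem LinkDiagram.exists_crossingRow (c : D.Crossing) : ∃ y ∈ rowsOf (D.program s),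
    y.tag = some c.level ∧ ∃ o, D.CrossingRow s c y o := by
  have hc := crossing_word c
  have hk := lt_length_of_getElem? hc
  have hv := D.sliceView s _ _ hc
  have hN := fun p e h => D.strandAt_nameOf (c.level, p) hk.le e h
  have hA := fun p e h => D.arc_nameOf (c.level, p) hk.le e h
  simp only [nameOf, Diagram.strandAt] at hN hA
  have hco : ∀ {a : Name} {v : K}, D.flip s a = v → ∀ e,
      coord a e * D.flip s e = coord a e * v := by
    rintro a v rfl e
    by_cases h : e = a
    · rw [h]
    · simp [coord, h]
  have h0 : ∀ g, (s g : K) ≠ 0 := fun g => (s g).ne_zero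
  obtain ⟨su, sv, Lu, Lv, ⟨f, x⟩, ⟨g, z⟩, a, b, hu, -, hi, e1, e2, h1, h2, h3⟩ := hv.cross_inv
  have ea := hN su.length a (by simp [h1, ← hu])
  have eb := hN (su.length + 1) b (by simp [h1, ← hu])
  have fa : D.flip s a = Conway.flip s (f, x) := by
    simp [flip, Diagram.strandAt, e1, ea]
  have fb : D.flip s b = Conway.flip s (g, z) := by
    simp [flip, Diagram.strandAt, e1, eb]
  have fc : D.flip s (c.level + 1, su.length) = Conway.flip s (g, z) := by
    simp [flip, Diagram.strandAt, e2]
  have fd : D.flip s (c.level + 1, su.length + 1) = Conway.flip s (f, x) := by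
    simp [flip, Diagram.strandAt, e2]
  have ta : D.tau s (D.arc (c.level, su.length)) = s f ^ 2 := by
    change (D.labelAt _).elim _ _ = _
    simp [Diagram.labelAt, e1]
  have tb : D.tau s (D.arc (c.level, su.length + 1)) = s g ^ 2 := by
    change (D.labelAt _).elim _ _ = _
    simp [Diagram.labelAt, e1]
  have tc : D.tau s (D.arc (c.level + 1, su.length)) = s g ^ 2 := by
    change (D.labelAt _).elim _ _ = _
    simp [Diagram.labelAt, e2]
  have td : D.tau s (D.arc (c.level + 1, su.length + 1)) = s f ^ 2 := by
    change (D.labelAt _).elim _ _ = _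
    simp [Diagram.labelAt, e2]
  have aa := hA su.length a (by simp [h1, ← hu])
  have ab := hA (su.length + 1) b (by simp [h1, ← hu])
  have ba : a ∈ births (D.program s) :=
    D.mem_births_of_mem_namesAt s c.level hk.le a (by simp [h1])
  have bb : b ∈ births (D.program s) :=
    D.mem_births_of_mem_namesAt s c.level hk.le b (by simp [h1])
  have ua : D.upAt (c.level, su.length) = x := by simp [Diagram.upAt, e1]
  have ub : D.upAt (c.level, su.length + 1) = z := by simp [Diagram.upAt, e1]
  have ca := hco fa
  have cb := hco fb
  have cc := hco fc
  have cd := hco fd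
  -- The region to the right of both strands lies west (`p0`), south (`p1`), east (`p2`) or north
  -- (`p3`) of the crossing.
  have p0 := D.abel_pathWord s c.level su.length su _ e1 rfl
  have p1 := D.abel_pathWord s c.level (su.length + 1) (su ++ [(f, x)]) ((g, z) :: sv)
    (by rw [e1]; simp) (by simp)
  have p2 := D.abel_pathWord s c.level (su.length + 2) (su ++ [(f, x), (g, z)]) sv
    (by rw [e1]; simp) (by simp)
  have p3 := D.abel_pathWord s (c.level + 1) (su.length + 1) (su ++ [(g, z)]) ((f, x) :: sv)
    (by rw [e2]; simp) (by simp)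
  have hp : ∀ u v : List (Strand n), holProd s (u ++ v) = holProd s u * holProd s v := by
    intro u v; simp [holProd]
  rw [hp] at p1 p2 p3
  have hf := h0 f
  have hg := h0 g
  rw [hi] at h3
  cases hu' : c.type
  · rw [hu'] at h3
    simp only [Bool.false_eq_true, if_false] at h3
    refine ⟨_, (D.mem_rows s _).2 ⟨c.level, hk, by rw [h3]; exact List.mem_cons_of_mem _ (List.mem_singleton_self _)⟩, rfl, b, bb, ?_, ?_, ?_, ?_, ?_, ?_⟩
    · simp [overArc, overPoint, hu', hi, ab]
    · cases x <;> simp [startArc, underLow, underHigh, hu', hi, ua, underRowFalse, aa]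
    · cases x <;> simp [endArc, underLow, underHigh, hu', hi, ua, underRowFalse, aa]
    · cases x <;> simp [endArc, startArc, underLow, underHigh, hu', hi, ua, ta, td]
    · have hrel : ∀ p e, (underRowFalse s c.level (f, x) (g, z) p a b (c.level + 1, su.length + 1)).rel
          e * D.flip s e = hol s (g, z) * (coord (c.level + 1, su.length + 1) e *
            Conway.flip s (f, x)) - ((hol s (g, z))⁻¹ : Kˣ) * (coord a e * Conway.flip s (f, x)) -
          ((hol s (g, z))⁻¹ : Kˣ) * (hol s (f, x) ^ 2 - 1) *
            (coord b e * Conway.flip s (g, z)) := by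
        intro p e
        rw [← ca, ← cb, ← cd, underRowFalse]
        ring
      simp only [mul_assoc, hrel]
      cases x <;> cases z
      · refine .inr ⟨by simp [IsPositive, hu', hi, ua, ub], fun e => ?_⟩
        simp [startArc, overArc, overPoint, underLow, hu', hi, ua, ta, tb, underRowFalse, hol,
          Conway.flip, fa]
        field_simp
        ring
      · refine .inl ⟨by simp [IsPositive, hu', hi, ua, ub], fun e => ?_⟩
        simp [startArc, overArc, overPoint, underLow, hu', hi, ua, ta, tb, underRowFalse, hol,
          Conway.flip, fa]
        field_simp
        ring
      · refine .inl ⟨by simp [IsPositive, hu', hi, ua, ub], fun e => ?_⟩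
        simp [startArc, overArc, overPoint, underLow, underHigh, hu', hi, ua, td, tb,
          underRowFalse, hol, Conway.flip, fd]
        field_simp
        ring
      · refine .inr ⟨by simp [IsPositive, hu', hi, ua, ub], fun e => ?_⟩
        simp [startArc, overArc, overPoint, underLow, underHigh, hu', hi, ua, td, tb,
          underRowFalse, hol, Conway.flip, fd]
        field_simp
        ring
    · cases x <;> cases z <;> simp only [baseWord, hi, ua, ub, p0, p1, p2, p3] <;>
        simp [underRowFalse, hol, fa, fd, Conway.flip, holProd] <;> field_simp
  · rw [hu'] at h3
    simp only [if_true] at h3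
    refine ⟨_, (D.mem_rows s _).2 ⟨c.level, hk, by rw [h3]; exact List.mem_cons_self⟩, rfl, a, ba, ?_, ?_, ?_, ?_, ?_, ?_⟩
    · simp [overArc, overPoint, hu', hi, aa]
    · cases z <;> simp [startArc, underLow, underHigh, hu', hi, ub, underRowTrue, ab]
    · cases z <;> simp [endArc, underLow, underHigh, hu', hi, ub, underRowTrue, ab]
    · cases z <;> simp [endArc, startArc, underLow, underHigh, hu', hi, ub, tb, tc]
    · have hrel : ∀ p e, (underRowTrue s c.level (f, x) (g, z) p a b (c.level + 1, su.length)).rel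
          e * D.flip s e = ((hol s (f, x))⁻¹ : Kˣ) * (coord (c.level + 1, su.length) e *
            Conway.flip s (g, z)) - ((hol s (f, x))⁻¹ : Kˣ) * (1 - hol s (g, z) ^ 2) *
            (coord a e * Conway.flip s (f, x)) -
          hol s (f, x) * (coord b e * Conway.flip s (g, z)) := by
        intro p e
        rw [← ca, ← cb, ← cc, underRowTrue]
        ring
      simp only [mul_assoc, hrel]
      cases x <;> cases z
      · refine .inl ⟨by simp [IsPositive, hu', hi, ua, ub], fun e => ?_⟩
        simp [startArc, overArc, overPoint, underLow, hu', hi, ub, ta, tb, underRowTrue, hol,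
          Conway.flip, fb]
        field_simp
        ring
      · refine .inr ⟨by simp [IsPositive, hu', hi, ua, ub], fun e => ?_⟩
        simp [startArc, overArc, overPoint, underLow, underHigh, hu', hi, ub, ta, tc,
          underRowTrue, hol, Conway.flip, fc]
        field_simp
        ring
      · refine .inr ⟨by simp [IsPositive, hu', hi, ua, ub], fun e => ?_⟩
        simp [startArc, overArc, overPoint, underLow, hu', hi, ub, ta, tb, underRowTrue, hol,
          Conway.flip, fb]
        field_simp
        ring
      · refine .inl ⟨by simp [IsPositive, hu', hi, ua, ub], fun e => ?_⟩
        simp [startArc, overArc, overPoint, underLow, underHigh, hu', hi, ub, ta, tc,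
          underRowTrue, hol, Conway.flip, fc]
        field_simp
        ring
    · cases x <;> cases z <;> simp only [baseWord, hi, ua, ub, p0, p1, p2, p3] <;>
        simp [underRowTrue, hol, fb, fc, Conway.flip, holProd] <;> field_simp

end Wirtinger
end Conway

namespace Conway

/-! ### Elimination of the edges in favour of the arcs. -/

section Elimination
variable {n : ℕ} {K : Type} [Field K] {s : Fin n → Kˣ} {D : LinkDiagram n}
variable {m : ℕ} {x : Fin m → Row K}

theorem LinkDiagram.IsRows.sum_coord (hx : LinkDiagram.IsRows (s := s) (D := D) x)
    (a : Name) (ha : a ∈ births (D.program s)) (w : Name → K) :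
    ∑ j, coord a (x j).out * w (x j).out = w a := by
  obtain ⟨q, rfl⟩ := hx.surj a ha
  rw [Finset.sum_eq_single q]
  · simp [coord]
  · intro j _ hj
    have : (x j).out ≠ (x q).out := fun h => hj (hx.inj h)
    simp [coord, this]
  · simp

/-- Forwards, each step of an `Origin` stays on one arc. Backwards, `origins` is a function of the
arc, and the outgoing edge of the crossing has the crossing as its origin. -/
theorem LinkDiagram.origin_iff (hn : ((rowsOf (D.program s)).map Row.out).Nodup) (e : Name)
    (he : e ∈ births (D.program s)) (c : D.Crossing) :
    (∃ d, Origin (rowsOf (D.program s)) e c.level d) ↔ D.arc e = startArc c := by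
  constructor
  · rintro ⟨d, h⟩
    generalize hk : c.level = k at h
    induction h with
    | start y hy k ht =>
      subst hk
      obtain ⟨z, hz, htz, o, h⟩ := D.exists_crossingRow s c
      obtain rfl := D.tag_unique s y z hy hz _ ht htz
      exact h.out_arc
    | step y hy ht k d h ih =>
      rw [D.arc_out_eq_arc_inn s y hy ht]
      exact ih (D.mem_births_of_row s y hy).2 hk
  · intro h
    obtain ⟨z, hz, htz, o, hr⟩ := D.exists_crossingRow s c
    rw [← hr.out_arc] at h
    have h1 := origins_eq_of_arc_eq (s := s) hn h
    have h2 := (D.nameOf_birth s e he).2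
    have h3 := (D.nameOf_birth s z.out (D.mem_births_of_row s z hz).1).2
    have h4 : c.level ∈ D.origins s z.out := ⟨z.out, 0, h3, .start z hz _ htz⟩
    rw [← h1] at h4
    obtain ⟨e', d, h5, h6⟩ := h4
    obtain rfl := Option.some.inj (h2.symm.trans h5)
    exact ⟨d, h6⟩

/-- Here admissibility enters the determinant: no arc is a closed circle, so walking back along it
ends at a crossing. -/
theorem LinkDiagram.Admissible.exists_origin (hD : D.Admissible)
    (hn : ((rowsOf (D.program s)).map Row.out).Nodup) (e : Name)
    (he : e ∈ births (D.program s)) : ∃ k d, Origin (rowsOf (D.program s)) e k d := by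
  obtain ⟨h1, h2⟩ := D.nameOf_birth s e he
  have hp : D.IsPoint e := by
    refine ⟨h1, ?_⟩
    rw [← (D.names e.1 h1).length]
    exact (List.getElem?_eq_some_iff.1 h2).1
  obtain ⟨c, hc⟩ := hD.start e hp
  obtain ⟨d, hd⟩ := (D.origin_iff hn e he c).2 hc.symm
  exact ⟨_, d, hd⟩

/-- The matrix of the relations between the letters of the edges, normalised as the Wirtinger
relations. -/
def LinkDiagram.wirtinger (s : Fin n → Kˣ) (D : LinkDiagram n) (x : Fin m → Row K) :
    Matrix (Fin m) (Fin m) K :=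
  Matrix.of fun i j => (x i).wt / ((x i).weight * D.flip s (x i).out) * (x i).rel (x j).out *
    D.flip s (x j).out

theorem LinkDiagram.flip_ne_zero (e : Name) : D.flip s e ≠ 0 := by
  unfold LinkDiagram.flip
  cases D.strandAt e with
  | none => simp
  | some a =>
    simp only [Option.elim_some, Conway.flip]
    split_ifs <;> simp

theorem LinkDiagram.IsRows.wirtinger_untagged (hx : LinkDiagram.IsRows (s := s) (D := D) x)
    (i : Fin m) (hi : (x i).tag = none) (j : Fin m) :
    D.wirtinger s x i j = coord (x i).out (x j).out - coord (x i).inn (x j).out := by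
  have h := D.rel_flip s (x i) (hx.mem i) hi (x j).out
  have h1 := D.flip_ne_zero (s := s) (x i).out
  have h2 : ((x i).weight : K) ≠ 0 := (x i).weight.ne_zero
  rw [wirtinger, Matrix.of_apply]
  field_simp
  linear_combination h

open Classical in
/-- The indicator function of the edges of the arc that starts at level `k`. -/
noncomputable def originInd (rows : List (Row K)) (k : ℕ) (e : Name) : K :=
  if ∃ d, Origin rows e k d then 1 else 0

/-- The two edges of an untagged relation have the same origins, so the indicator of an arc
satisfies it. -/
theorem LinkDiagram.IsRows.wirtinger_sum_untagged (hx : LinkDiagram.IsRows (s := s) (D := D) x)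
    (i : Fin m) (hi : (x i).tag = none) (k : ℕ) :
    ∑ j, D.wirtinger s x i j * originInd (rowsOf (D.program s)) k (x j).out = 0 := by
  simp only [hx.wirtinger_untagged i hi, sub_mul, Finset.sum_sub_distrib]
  have hb := D.mem_births_of_row s _ (hx.mem i)
  rw [hx.sum_coord _ hb.1 (originInd (rowsOf (D.program s)) k),
    hx.sum_coord _ hb.2 (originInd (rowsOf (D.program s)) k), sub_eq_zero]
  unfold originInd
  congr 1
  apply propext
  constructor
  · rintro ⟨d, h⟩
    obtain ⟨d', -, h⟩ := h.inv_step hx.nodup (hx.mem i) hi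
    exact ⟨d', h⟩
  · rintro ⟨d, h⟩
    exact ⟨d + 1, .step _ (hx.mem i) hi k d h⟩

/-- Adding up the columns of all edges of an arc amounts to differentiating with respect to the
letter of the arc. -/
theorem LinkDiagram.IsRows.wirtinger_sum_tagged (hx : LinkDiagram.IsRows (s := s) (D := D) x)
    (i : Fin m) (c c' : D.Crossing) (hi : (x i).tag = some c.level) :
    ∑ j, D.wirtinger s x i j * originInd (rowsOf (D.program s)) c'.level (x j).out =
      D.jacobian s c c' := by
  obtain ⟨y, hy, hty, o, hr⟩ := D.exists_crossingRow s c
  obtain rfl := D.tag_unique s _ _ hy (hx.mem i) _ hty hi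
  have hb := D.mem_births_of_row s _ (hx.mem i)
  have h1 := D.flip_ne_zero (s := s) (x i).out
  have h2 : ((x i).weight : K) ≠ 0 := (x i).weight.ne_zero
  classical
  have hind : ∀ e ∈ births (D.program s), originInd (rowsOf (D.program s)) c'.level e =
      if D.arc e = startArc c' then (1 : K) else 0 := by
    intro e he
    unfold originInd
    simp only [D.origin_iff hx.nodup e he c']
  have hS := fun a ha => hx.sum_coord a ha (originInd (rowsOf (D.program s)) c'.level)
  rw [jacobian, Matrix.of_apply, relator]
  obtain ⟨hp, h⟩ | ⟨hp, h⟩ := hr.rel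
  · rw [if_pos hp, D.abel_fox_positive s _ _ _ _ hr.label]
    have e1 : ∀ j, D.wirtinger s x i j = (1 - D.tau s (startArc c)) * coord o (x j).out +
        D.tau s (overArc c) * coord (x i).out (x j).out - coord (x i).inn (x j).out := by
      intro j
      rw [wirtinger, Matrix.of_apply]
      field_simp
      linear_combination h (x j).out
    simp only [e1, sub_mul, add_mul, Finset.sum_sub_distrib, Finset.sum_add_distrib, mul_assoc,
      ← Finset.mul_sum, hS _ hb.1, hS _ hb.2, hS _ hr.over_mem, hind _ hb.1, hind _ hb.2,
      hind _ hr.over_mem, hr.over_arc, hr.out_arc, hr.inn_arc, one_mul]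
  · rw [if_neg hp, D.abel_fox_negative s _ _ _ _ hr.label]
    have e1 : ∀ j, D.wirtinger s x i j = (D.tau s (startArc c) - 1) * coord o (x j).out +
        coord (x i).out (x j).out - D.tau s (overArc c) * coord (x i).inn (x j).out := by
      intro j
      rw [wirtinger, Matrix.of_apply]
      field_simp
      linear_combination h (x j).out
    simp only [e1, sub_mul, add_mul, Finset.sum_sub_distrib, Finset.sum_add_distrib, mul_assoc,
      ← Finset.mul_sum, hS _ hb.1, hS _ hb.2, hS _ hr.over_mem, hind _ hb.1, hind _ hb.2,
      hind _ hr.over_mem, hr.over_arc, hr.out_arc, hr.inn_arc, one_mul]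

/-- The columns of the crossings in the elimination of the other edges. -/
noncomputable def eliminator (rows : List (Row K)) (x : Fin m → Row K) :
    Matrix (Fin m) (Fin m) K :=
  Matrix.of fun e e' => match (x e').tag with
    | some k => originInd rows k (x e).out
    | none => if e = e' then 1 else 0

theorem LinkDiagram.IsRows.eliminator_tagged (hx : LinkDiagram.IsRows (s := s) (D := D) x)
    (e e' : Fin m) (he : (x e).tag.isSome) :
    eliminator (rowsOf (D.program s)) x e e' = if e = e' then 1 else 0 := by
  obtain ⟨k, hk⟩ := Option.isSome_iff_exists.1 he
  rw [eliminator, Matrix.of_apply]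
  cases hk' : (x e').tag with
  | none => rfl
  | some k' =>
    simp only [originInd]
    congr 1
    apply propext
    constructor
    · rintro ⟨d, h⟩
      obtain ⟨rfl, -⟩ := h.inv_start hx.nodup (hx.mem e) hk
      exact hx.inj (congrArg Row.out (D.tag_unique s _ _ (hx.mem e) (hx.mem e') _ hk hk'))
    · rintro rfl
      rw [hk] at hk'
      obtain rfl := Option.some.inj hk'
      exact ⟨0, .start _ (hx.mem e) _ hk⟩

/-- Column operations: each crossing column absorbs the columns of the later edges of its arc, so
the matrix is block triangular with identity blocks. -/
theorem LinkDiagram.IsRows.det_eliminator (hx : LinkDiagram.IsRows (s := s) (D := D) x) :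
    (eliminator (rowsOf (D.program s)) x).det = 1 := by
  rw [Matrix.twoBlockTriangular_det' _ fun i => (x i).tag.isSome]
  · have h1 : (eliminator (rowsOf (D.program s)) x).toSquareBlockProp
        (fun i => (x i).tag.isSome) = 1 := by
      ext i j
      simp [Matrix.toSquareBlockProp_def, hx.eliminator_tagged i j i.2, Matrix.one_apply,
        Subtype.ext_iff]
    have h2 : (eliminator (rowsOf (D.program s)) x).toSquareBlockProp
        (fun i => ¬ (x i).tag.isSome) = 1 := by
      ext i j
      have : (x j).tag = none := by simpa using j.2
      simp [Matrix.toSquareBlockProp_def, eliminator, this, Matrix.one_apply, Subtype.ext_iff]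
    rw [h1, h2]
    simp
  · intro i hi j hj
    rw [hx.eliminator_tagged i j hi, if_neg]
    rintro rfl
    exact hj hi

end Elimination
end Conway

namespace Conway

/-! ### The potential function of an admissible diagram. -/

section Potential
variable {n : ℕ} {K : Type} [Field K] {s : Fin n → Kˣ} {D : LinkDiagram n}
variable {m : ℕ} {x : Fin m → Row K}

/-- Each untagged relation leads from an edge to the one just before it on its arc. Ordered by the
distance from the start of the arc, the matrix is unitriangular. -/
theorem LinkDiagram.IsRows.det_untagged (hx : LinkDiagram.IsRows (s := s) (D := D) x)
    (hD : D.Admissible) : (Matrix.of fun i j : {i // ¬ (x i).tag.isSome = true} =>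
      (coord (x i).out (x j).out - coord (x i).inn (x j).out : K)).det = 1 := by
  have ho : ∀ i : {i // ¬ (x i).tag.isSome = true}, ∃ d, ∃ k,
      Origin (rowsOf (D.program s)) (x i).out k d := by
    intro i
    obtain ⟨k, d, h⟩ := hD.exists_origin hx.nodup (x i).out (D.mem_births_of_row s _ (hx.mem i)).1
    exact ⟨d, k, h⟩
  choose b hb using ho
  have hdep : ∀ i j : {i // ¬ (x i).tag.isSome = true}, (x i).inn = (x j).out → b j < b i := by
    intro i j h
    obtain ⟨k, hk⟩ := hb i
    obtain ⟨k', hk'⟩ := hb j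
    obtain ⟨d, hd, h1⟩ := hk.inv_step hx.nodup (hx.mem i) (by simpa using i.2)
    rw [h] at h1
    obtain ⟨-, h2⟩ := hk'.unique hx.nodup h1
    omega
  have hout : ∀ i j : {i // ¬ (x i).tag.isSome = true}, i ≠ j → (x j).out ≠ (x i).out :=
    fun i j hij h => hij (Subtype.ext (hx.inj h)).symm
  have ht : Matrix.BlockTriangular (Matrix.of fun i j : {i // ¬ (x i).tag.isSome = true} =>
      (coord (x i).out (x j).out - coord (x i).inn (x j).out : K)) (OrderDual.toDual ∘ b) := by
    intro i j hij
    have hij : b i < b j := hij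
    have h1 : (x j).out ≠ (x i).out := hout i j (by rintro rfl; omega)
    have h2 : (x j).out ≠ (x i).inn := fun h => by
      have := hdep i j h.symm
      omega
    simp [coord, h1, h2]
  rw [ht.det]
  refine Finset.prod_eq_one fun a _ => ?_
  suffices h : Matrix.toSquareBlock (Matrix.of fun i j : {i // ¬ (x i).tag.isSome = true} =>
      (coord (x i).out (x j).out - coord (x i).inn (x j).out : K)) (OrderDual.toDual ∘ b) a = 1 by
    rw [h, Matrix.det_one]
  ext i j
  have hij : b i = b j := OrderDual.toDual.injective (i.2.trans j.2.symm)
  have h2 : (x j).out ≠ (x i).inn := fun h => by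
    have := hdep i j h.symm
    omega
  by_cases h : i = j
  · subst h
    simp [Matrix.toSquareBlock_def, coord, h2]
  · have h1 : (x j).out ≠ (x i).out := hout i j fun h' => h (Subtype.ext h')
    simp [Matrix.toSquareBlock_def, coord, h2, h1, h]

/-- Multiplication by `eliminator` makes the matrix, with row `r` replaced, block triangular: the
untagged block has determinant one, and the tagged block is the Jacobian with row `i` replaced. -/
theorem LinkDiagram.IsRows.adjugate_wirtinger (hx : LinkDiagram.IsRows (s := s) (D := D) x)
    (hD : D.Admissible) (i j : D.Crossing) (r q : Fin m) (hr : (x r).tag = some i.level)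
    (hq : (x q).tag = some j.level) :
    (D.wirtinger s x).adjugate q r = (D.jacobian s).adjugate j i := by
  have hex : ∀ c : D.Crossing, ∃ e, (x e).tag = some c.level := by
    intro c
    obtain ⟨y, hy, ht, -⟩ := D.exists_crossingRow s c
    obtain ⟨e, rfl⟩ := hx.exists_eq y hy
    exact ⟨e, ht⟩
  choose ρ hρ using hex
  have htag : ∀ (e e' : Fin m) (k : ℕ), (x e).tag = some k → (x e').tag = some k → e = e' :=
    fun e e' k h h' => hx.inj (congrArg Row.out (D.tag_unique s _ _ (hx.mem e) (hx.mem e') k h h'))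
  obtain rfl : r = ρ i := htag _ _ _ hr (hρ i)
  obtain rfl : q = ρ j := htag _ _ _ hq (hρ j)
  have hρi : ∀ c c', ρ c = ρ c' → c = c' := by
    intro c c' h
    have := hρ c
    rw [h, hρ c'] at this
    exact crossing_ext (Option.some.inj this).symm
  -- Crossings correspond to tagged relations through their levels.
  let ε : D.Crossing ≃ {e // (x e).tag.isSome = true} :=
    Equiv.ofBijective (fun c => ⟨ρ c, by simp [hρ c]⟩) ⟨fun c c' h => hρi c c'
      (congrArg Subtype.val h), fun e => by
        obtain ⟨k, hk⟩ := Option.isSome_iff_exists.1 e.2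
        obtain ⟨i, u, hc, -⟩ := D.tag_inv s _ (hx.mem e) k hk
        obtain ⟨c, rfl, -⟩ := exists_crossing hc
        exact ⟨c, Subtype.ext (htag _ _ _ (hρ c) hk)⟩⟩
  have hε : ∀ c, (ε c : Fin m) = ρ c := fun c => rfl
  set P := eliminator (rowsOf (D.program s)) x with hP
  set A := (D.wirtinger s x).updateRow (ρ i) (Pi.single (ρ j) 1) with hA
  have hPk : ∀ e e' k, (x e').tag = some k → P e e' = originInd (rowsOf (D.program s)) k (x e).out := by
    intro e e' k h
    simp [hP, eliminator, h]
  have hPn : ∀ e e', (x e').tag = none → P e e' = if e = e' then 1 else 0 := by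
    intro e e' h
    simp [hP, eliminator, h]
  have hAr : ∀ e, e ≠ ρ i → ∀ e', A e e' = D.wirtinger s x e e' := by
    intro e he e'
    rw [hA, Matrix.updateRow_ne he]
  have h1 : A.det = (A * P).det := by rw [Matrix.det_mul, hP, hx.det_eliminator, mul_one]
  rw [Matrix.adjugate_apply, ← hA, h1,
    Matrix.twoBlockTriangular_det _ fun i => (x i).tag.isSome = true]
  · have h2 : ((A * P).toSquareBlockProp fun i => ¬ (x i).tag.isSome = true) =
        Matrix.of fun i j : {i // ¬ (x i).tag.isSome = true} =>
          (coord (x i).out (x j).out - coord (x i).inn (x j).out : K) := by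
      ext e e'
      have he : (x e).tag = none := by simpa using e.2
      have he' : (x e').tag = none := by simpa using e'.2
      rw [Matrix.toSquareBlockProp_def, Matrix.of_apply, Matrix.of_apply, Matrix.mul_apply]
      simp only [hPn _ _ he', mul_ite, mul_one, mul_zero, Finset.sum_ite_eq', Finset.mem_univ,
        if_true]
      rw [hAr _ (by rintro h; rw [h, hρ] at he; cases he), hx.wirtinger_untagged _ he]
    have h3 : ((A * P).toSquareBlockProp fun i => (x i).tag.isSome = true).submatrix ε ε =
        (D.jacobian s).updateRow i (Pi.single j 1) := by
      ext c c'
      rw [Matrix.submatrix_apply, Matrix.toSquareBlockProp_def, Matrix.of_apply, hε, hε,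
        Matrix.mul_apply]
      by_cases hc : c = i
      · subst hc
        rw [Matrix.updateRow_self, hA, Matrix.updateRow_self]
        simp only [Pi.single_apply, ite_mul, one_mul, zero_mul, Finset.sum_ite_eq',
          Finset.mem_univ, if_true]
        rw [hP, hx.eliminator_tagged _ _ (by simp [hρ])]
        congr 1
        apply propext
        exact ⟨fun h => (hρi _ _ h).symm, fun h => by rw [h]⟩
      · rw [Matrix.updateRow_ne hc]
        simp only [hPk _ _ _ (hρ c'), hAr _ fun h => hc (hρi _ _ h)]
        exact hx.wirtinger_sum_tagged _ c c' (hρ c)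
    rw [h2, hx.det_untagged hD, mul_one, Matrix.adjugate_apply, ← h3,
      Matrix.det_submatrix_equiv_self]
  · intro e he e' he'
    obtain ⟨k, hk⟩ := Option.isSome_iff_exists.1 he'
    have he : (x e).tag = none := by simpa using he
    rw [Matrix.mul_apply]
    simp only [hPk _ _ _ hk, hAr e (by rintro rfl; rw [hρ] at he; cases he)]
    exact hx.wirtinger_sum_untagged e he k

/-- Weights are local: an eastward minimum contributes `s g`, an eastward maximum `(s g)⁻¹`, and an
undercrossing relation the inverse parameter of the line above it. -/
theorem LinkDiagram.IsRows.prod_weight (hx : LinkDiagram.IsRows (s := s) (D := D) x) :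
    ∏ i, (x i).weight = ∏ g : Fin n, s g ^ (D.rotation g - (D.overCount g : ℤ)) := by
  have h1 : ∏ i, (x i).weight = ((rowsOf (D.program s)).map Row.weight).prod := by
    rw [← List.prod_reverse, ← List.map_reverse, hx.eq, List.map_ofFn, List.prod_ofFn]
    rfl
  have h2 : ((rowsOf (D.program s)).map Row.weight).prod =
      ∏ k : Fin D.word.length, ((rowsOf (D.instrs s k)).map Row.weight).prod := by
    rw [D.program_eq, rowsOf_flatMap, ← Finset.prod_range
      (fun k => ((rowsOf (D.instrs s k)).map Row.weight).prod)]
    induction D.word.length with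
    | zero => simp
    | succ l ih => rw [List.range_succ, Finset.prod_range_succ, ← ih]; simp
  let ov : Fin n → Fin D.word.length → ℤ := fun g k =>
    match D.word[k] with
    | ⟨i, .cross u⟩ => if D.labelAt (k, if u then i else i + 1) = some g then 1 else 0
    | _ => 0
  let rot : Fin n → Fin D.word.length → ℤ := fun g k =>
    match D.word[k] with
    | ⟨_, .cup h d⟩ => if h = g ∧ d = false then 1 else 0
    | ⟨i, .cap⟩ => if D.labelAt (k, i) = some g ∧ D.upAt (k, i) = true then -1 else 0
    | ⟨_, .cross _⟩ => 0
  have h3 : ∀ g, (D.overCount g : ℤ) = ∑ k, ov g k := by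
    intro g
    rw [overCount, Finset.card_filter, Nat.cast_sum,
      ← Fintype.sum_subtype_add_sum_subtype
        (fun k : Fin D.word.length => (D.word[k].piece.crossType).isSome = true) (ov g)]
    have e1 : ∀ c : D.Crossing, ov g c.1 =
        ((if D.labelAt (overPoint c) = some g then 1 else 0 : ℕ) : ℤ) := by
      intro c
      have hw : D.word[c.1] = ⟨c.pos, .cross c.type⟩ := by
        have := crossing_word c
        obtain ⟨h, h'⟩ := List.getElem?_eq_some_iff.1 this
        exact h'
      have ho : overPoint c = ((c.1 : ℕ), if c.type then c.pos else c.pos + 1) := by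
        unfold overPoint Diagram.Crossing.level
        split_ifs <;> rfl
      simp only [ov, hw, ho, Nat.cast_ite, Nat.cast_one, Nat.cast_zero]
    have e2 : ∑ k : {k : Fin D.word.length // ¬ (D.word[k].piece.crossType).isSome = true},
        ov g k = 0 := by
      refine Finset.sum_eq_zero fun k _ => ?_
      have := k.2
      simp only [ov]
      revert this
      rcases D.word[(k : Fin D.word.length)] with ⟨i, _ | _ | u⟩ <;> simp [Piece.crossType]
    rw [e2, add_zero]
    exact (Finset.sum_congr rfl fun c _ => e1 c).symm
  have h4 : ∀ g, D.rotation g - (D.overCount g : ℤ) = ∑ k, (rot g k - ov g k) := by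
    intro g
    rw [Finset.sum_sub_distrib, ← h3]
    rfl
  rw [h1, h2]
  have h5 : ∀ (g : Fin n) (f : Fin D.word.length → ℤ), s g ^ (∑ k, f k) = ∏ k, s g ^ f k := by
    intro g f
    exact map_prod ((zpowersHom Kˣ) (s g)) (fun k => Multiplicative.ofAdd (f k)) Finset.univ
  simp only [h4, h5]
  rw [Finset.prod_comm]
  refine Finset.prod_congr rfl fun k _ => ?_
  have hc : D.word[(k : ℕ)]? = some D.word[k] := by simp
  have hv := D.sliceView s k _ hc
  simp only [rot, ov]
  rcases hw : D.word[k] with ⟨i, ⟨g, d⟩ | _ | u⟩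
  · rw [hw] at hv
    obtain ⟨su, sv, Lu, Lv, -, -, rfl, -, -, -, -, h6⟩ := hv.cup_inv
    cases d
    · simp [h6, cupRow]
    · simp [h6, cupRow]
  · rw [hw] at hv
    obtain ⟨su, sv, Lu, Lv, ⟨g, d⟩, a, b, -, -, rfl, e1, -, -, -, h6⟩ := hv.cap_inv
    cases d
    · simp [h6, capRow, Diagram.upAt, e1]
    · simp [h6, capRow, Diagram.upAt, Diagram.labelAt, e1]
  · rw [hw] at hv
    obtain ⟨su, sv, Lu, Lv, ⟨g, d⟩, ⟨g', d'⟩, a, b, -, -, rfl, e1, -, -, -, h6⟩ := hv.cross_inv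
    cases u
    · simp [h6, overRow, underRowFalse, Diagram.labelAt, e1]
    · simp [h6, overRow, underRowTrue, Diagram.labelAt, e1]

theorem LinkDiagram.hsq_sub_one (e : Name) (he : e ∈ births (D.program s)) :
    D.hsq s e - 1 = D.flip s e * (D.tau s (D.arc e) - 1) := by
  obtain ⟨h1, h2⟩ := D.nameOf_birth s e he
  have h3 : e.2 < (D.state e.1).length := by
    rw [← (D.names e.1 h1).length]
    exact (List.getElem?_eq_some_iff.1 h2).1
  have h4 : (D.state e.1)[e.2]? = some (D.state e.1)[e.2] := by simp
  have h5 : D.tau s (D.arc e) = (s (D.state e.1)[e.2].1 : K) ^ 2 := by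
    change (D.labelAt e).elim _ _ = _
    simp [Diagram.labelAt, h4]
  rw [h5]
  simp only [hsq, flip, Diagram.strandAt, h4, Option.elim_some, Conway.flip]
  generalize (D.state e.1)[e.2] = a
  obtain ⟨g, d⟩ := a
  have : (s g : K) ≠ 0 := (s g).ne_zero
  cases d
  · simp [hol]
  · simp [hol]
    field_simp
    ring

/-- The potential function of an admissible diagram. -/
theorem LinkDiagram.Admissible.potential_eq (hD : D.Admissible) (hs : ∀ g, (s g : K) ^ 2 ≠ 1)
    (i j : D.Crossing) : D.potential s i j = D.conway s := by
  obtain ⟨m, x, h1, h2, h3, h4⟩ := D.exists_rows s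
  have hx : LinkDiagram.IsRows (s := s) (D := D) x := ⟨h1, h2, h3, h4⟩
  obtain ⟨y, hy, hty, o, hr⟩ := D.exists_crossingRow s i
  obtain ⟨r, rfl⟩ := hx.exists_eq y hy
  obtain ⟨y, hy, htz, o', hq⟩ := D.exists_crossingRow s j
  obtain ⟨q, rfl⟩ := hx.exists_eq y hy
  have hadj := hx.adjugate_wirtinger hD i j r q hty htz
  have hcon := hx.conway_eq hs q r
  have hf := fun e => D.flip_ne_zero (s := s) e
  have hw : ∀ i, ((x i).weight : K) ≠ 0 := fun i => (x i).weight.ne_zero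
  -- The normalised matrix differs from `relMatrix` by diagonal factors, so its adjugate differs by
  -- the products of these with one entry omitted.
  have hfac : D.wirtinger s x = Matrix.diagonal (fun i => (x i).wt / ((x i).weight *
      D.flip s (x i).out)) * relMatrix x * Matrix.diagonal fun j => D.flip s (x j).out := by
    ext i j
    rw [Matrix.mul_diagonal, Matrix.diagonal_mul]
    rfl
  rw [hfac, Matrix.adjugate_mul_distrib, Matrix.adjugate_mul_distrib, Matrix.adjugate_diagonal,
    Matrix.adjugate_diagonal, Matrix.diagonal_mul, Matrix.mul_diagonal] at hadj
  have hF := Finset.mul_prod_erase Finset.univ (fun j => D.flip s (x j).out) (Finset.mem_univ q)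
  have hA := Finset.mul_prod_erase Finset.univ (fun i => (x i).wt / ((x i).weight *
    D.flip s (x i).out)) (Finset.mem_univ r)
  have hA' : ∏ i, (x i).wt / ((x i).weight * D.flip s (x i).out) =
      (∏ i, (x i).wt) / ((∏ i, ((x i).weight : K)) * ∏ i, D.flip s (x i).out) := by
    rw [Finset.prod_div_distrib, Finset.prod_mul_distrib]
  rw [hA'] at hA
  have hW : (∏ i, ((x i).weight : K)) =
      ((∏ g : Fin n, s g ^ (D.rotation g - (D.overCount g : ℤ)) : Kˣ) : K) := by
    rw [← hx.prod_weight, Units.coe_prod]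
  have hb := (D.mem_births_of_row s _ (hx.mem q)).1
  have hq1 := hx.hsq_ne_one hs q
  rw [D.hsq_sub_one _ hb, hq.out_arc] at hcon hq1
  have hT := right_ne_zero_of_mul hq1
  have hm := hx.mult_ne_zero r
  have hbase := hr.base
  have hne : D.abel s (MonoidAlgebra.of ℤ _ (baseWord i)) * (x r).wt ≠ 0 := by
    rw [hbase]
    exact neg_ne_zero.2 (mul_ne_zero (mul_ne_zero hm (hw r)) (hf _))
  have hφ := left_ne_zero_of_mul hne
  have hwt := right_ne_zero_of_mul hne
  have hFp : ∏ j, D.flip s (x j).out ≠ 0 := Finset.prod_ne_zero_iff.2 fun _ _ => hf _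
  have hWp : ∏ i, ((x i).weight : K) ≠ 0 := Finset.prod_ne_zero_iff.2 fun _ _ => hw _
  rw [potential, D.abel_of, ← hadj, ← hW, div_mul_eq_mul_div, div_eq_iff (mul_ne_zero hφ hT)]
  have hfq := hf (x q).out
  have hfr := hf (x r).out
  have hwr := hw r
  generalize ∏ i ∈ Finset.univ.erase q, D.flip s (x i).out = Fq at *
  generalize ∏ i ∈ Finset.univ.erase r, (x i).wt / ((x i).weight * D.flip s (x i).out) = Ar at *
  generalize ∏ j, D.flip s (x j).out = F at *
  generalize (∏ i, ((x i).weight : K)) = W at *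
  generalize ∏ i, (x i).wt = Wt at *
  generalize (relMatrix x).adjugate q r = M at *
  generalize D.abel s (MonoidAlgebra.of ℤ _ (baseWord i)) = φ at *
  generalize D.tau s (startArc j) = T at *
  generalize D.flip s (x q).out = fq at *
  generalize D.flip s (x r).out = fr at *
  generalize ((x r).weight : K) = wr at *
  generalize (x r).mult = mu at *
  generalize (x r).wt = w at *
  subst hF
  have hFq : Fq ≠ 0 := right_ne_zero_of_mul hFp
  field_simp at hA
  apply mul_left_cancel₀ (mul_ne_zero (mul_ne_zero hfq hm) hwt)
  linear_combination M * mu * hA + M * Wt * hbase - w * φ * hcon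

end Potential
end Conway

namespace Conway

/-! ### Kinked diagrams are admissible. -/

section Admissible
variable {n : ℕ} (D : LinkDiagram n)
open LinkDiagram

/-- Going up from a point of a diagram. -/
theorem LinkDiagram.step_up (k p : ℕ) (hk : k < D.word.length) (hp : p < (D.state k).length) :
    (∃ p', D.Joined (k, p) (k + 1, p') ∧ (D.state (k + 1))[p']? = (D.state k)[p]?) ∨
    (D.word[k]? = some ⟨p, .cap⟩ ∨ ∃ i, D.word[k]? = some ⟨i, .cap⟩ ∧ p = i + 1) ∨
    ∃ c : D.Crossing, underLow c = (k, p) ∧ (underHigh c).1 = k + 1 ∧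
      (D.state (k + 1))[(underHigh c).2]? = (D.state k)[p]? := by
  have hc : D.word[k]? = some D.word[k] := by simp
  obtain ⟨su, si, so, sv, h1, h2, hpos, hi, ho, -, -, h4, h5⟩ :=
    apply_eq_some _ _ _ (D.apply_state k _ hc)
  by_cases hp1 : p < D.word[k].pos
  · refine Or.inl ⟨p, .left k p _ hc hp1, ?_⟩
    rw [h1, h2, List.getElem?_append_left (by omega), List.getElem?_append_left (by omega)]
  by_cases hp2 : D.word[k].pos + D.word[k].piece.inWidth ≤ p
  · obtain ⟨j, rfl⟩ := Nat.exists_eq_add_of_le hp2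
    refine Or.inl ⟨_, .right k j _ hc, ?_⟩
    rw [h1, h2, List.getElem?_append_right (by omega), List.getElem?_append_right (by omega),
      List.getElem?_append_right (by omega), List.getElem?_append_right (by omega)]
    congr 1
    omega
  obtain ⟨i, hP⟩ : ∃ i, D.word[k].pos = i := ⟨_, rfl⟩
  rcases hcc : D.word[k].piece with _ | _ | x
  · simp [hcc, Piece.inWidth] at hp2; omega
  · have hc' : D.word[k]? = some ⟨i, .cap⟩ := by rw [hc, ← hP, ← hcc]
    simp [hcc, Piece.inWidth] at hp2
    obtain rfl | rfl : p = i ∨ p = i + 1 := by omega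
    · exact Or.inr (Or.inl (Or.inl hc'))
    · exact Or.inr (Or.inl (Or.inr ⟨i, hc', rfl⟩))
  · have hc' : D.word[k]? = some ⟨i, .cross x⟩ := by rw [hc, ← hP, ← hcc]
    simp [hcc, Piece.inWidth] at hp2
    obtain ⟨a, b, rfl, rfl⟩ := h5 x hcc
    obtain ⟨c, e1, e2, e3⟩ := D.exists_crossing hc'
    have hsi : su.length = i := by omega
    have s1 : (D.state k)[i]? = some a := by simp [h1, ← hsi]
    have s2 : (D.state k)[i + 1]? = some b := by simp [h1, ← hsi]
    have t1 : (D.state (k + 1))[i]? = some b := by simp [h2, ← hsi]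
    have t2 : (D.state (k + 1))[i + 1]? = some a := by simp [h2, ← hsi]
    obtain rfl | rfl : p = i ∨ p = i + 1 := (by omega : p = i ∨ p = i + 1) <;> cases x
    · exact Or.inr (Or.inr ⟨c, by simp [underLow, e1, e2, e3], by simp [underHigh, e1, e2, e3],
        by simp [underHigh, e1, e2, e3, s1, t2]⟩)
    · exact Or.inl ⟨p + 1, .overRight k p hc', by rw [s1, t2]⟩
    · exact Or.inl ⟨i, .overLeft k i hc', by rw [s2, t1]⟩
    · exact Or.inr (Or.inr ⟨c, by simp [underLow, e1, e2, e3], by simp [underHigh, e1, e2, e3],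
        by simp [underHigh, e1, e2, e3, s2, t1]⟩)

/-- Going down from a point of a diagram. -/
theorem LinkDiagram.step_down (k p : ℕ) (hk : k < D.word.length)
    (hp : p < (D.state (k + 1)).length) :
    (∃ p', D.Joined (k, p') (k + 1, p) ∧ (D.state (k + 1))[p]? = (D.state k)[p']?) ∨
    (∃ g d i, D.word[k]? = some ⟨i, .cup g d⟩ ∧ (p = i ∨ p = i + 1)) ∨
    ∃ c : D.Crossing, underHigh c = (k + 1, p) ∧ (underLow c).1 = k ∧
      (D.state (k + 1))[p]? = (D.state k)[(underLow c).2]? := by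
  have hc : D.word[k]? = some D.word[k] := by simp
  obtain ⟨su, si, so, sv, h1, h2, hpos, hi, ho, -, -, h4, h5⟩ :=
    apply_eq_some _ _ _ (D.apply_state k _ hc)
  by_cases hp1 : p < D.word[k].pos
  · refine Or.inl ⟨p, .left k p _ hc hp1, ?_⟩
    rw [h1, h2, List.getElem?_append_left (by omega), List.getElem?_append_left (by omega)]
  by_cases hp2 : D.word[k].pos + D.word[k].piece.outWidth ≤ p
  · obtain ⟨j, rfl⟩ := Nat.exists_eq_add_of_le hp2
    refine Or.inl ⟨_, .right k j _ hc, ?_⟩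
    rw [h1, h2, List.getElem?_append_right (by omega), List.getElem?_append_right (by omega),
      List.getElem?_append_right (by omega), List.getElem?_append_right (by omega)]
    congr 1
    omega
  obtain ⟨i, hP⟩ : ∃ i, D.word[k].pos = i := ⟨_, rfl⟩
  rcases hcc : D.word[k].piece with ⟨g, d⟩ | _ | x
  · simp [hcc, Piece.outWidth] at hp2
    exact Or.inr (Or.inl ⟨g, d, i, by rw [hc, ← hP, ← hcc], by omega⟩)
  · simp [hcc, Piece.outWidth] at hp2; omega
  · have hc' : D.word[k]? = some ⟨i, .cross x⟩ := by rw [hc, ← hP, ← hcc]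
    simp [hcc, Piece.outWidth] at hp2
    obtain ⟨a, b, rfl, rfl⟩ := h5 x hcc
    obtain ⟨c, e1, e2, e3⟩ := D.exists_crossing hc'
    have hsi : su.length = i := by omega
    have s1 : (D.state k)[i]? = some a := by simp [h1, ← hsi]
    have s2 : (D.state k)[i + 1]? = some b := by simp [h1, ← hsi]
    have t1 : (D.state (k + 1))[i]? = some b := by simp [h2, ← hsi]
    have t2 : (D.state (k + 1))[i + 1]? = some a := by simp [h2, ← hsi]
    obtain rfl | rfl : p = i ∨ p = i + 1 := (by omega : p = i ∨ p = i + 1) <;> cases x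
    · exact Or.inl ⟨p + 1, .overLeft k p hc', by rw [s2, t1]⟩
    · exact Or.inr (Or.inr ⟨c, by simp [underHigh, e1, e2, e3], by simp [underLow, e1, e2, e3],
        by simp [underLow, e1, e2, e3, s2, t1]⟩)
    · exact Or.inr (Or.inr ⟨c, by simp [underHigh, e1, e2, e3], by simp [underLow, e1, e2, e3],
        by simp [underLow, e1, e2, e3, s1, t2]⟩)
    · exact Or.inl ⟨i, .overRight k i hc', by rw [s1, t2]⟩

theorem LinkDiagram.touch_down (k p : ℕ) (hk : k < D.word.length)
    (hp : p < (D.state (k + 1)).length) :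
    (∃ p' < (D.state k).length, D.Touch (k, p') (k + 1, p)) ∨
    (∃ g d i, D.word[k]? = some ⟨i, .cup g d⟩ ∧ (p = i ∨ p = i + 1)) := by
  have hlt : ∀ p', (D.state (k + 1))[p]? = (D.state k)[p']? → p' < (D.state k).length := by
    intro p' h
    by_contra h'
    rw [List.getElem?_eq_none (not_lt.1 h'), List.getElem?_eq_none_iff] at h
    omega
  rcases D.step_down k p hk hp with ⟨p', h, h'⟩ | h | ⟨c, h1, h2, h3⟩
  · exact Or.inl ⟨p', hlt _ h', .strand _ _ h⟩
  · exact Or.inr h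
  · refine Or.inl ⟨_, hlt _ h3, ?_⟩
    have hc := D.crossing_word c
    cases hx : c.type <;> rw [hx] at hc <;> simp only [underHigh, underLow, hx] at h1 h2 h3 ⊢ <;>
      simp only [Bool.false_eq_true, if_false, if_true, Prod.mk.injEq] at h1 h2 ⊢
    · rw [← h1.2, ← h2]
      exact .crossRight _ _ _ hc
    · rw [← h1.2, ← h2]
      exact .crossLeft _ _ _ hc

/-- Every minimum but the lowest one is followed by a crossing with a neighbouring strand, and
every maximum is preceded by a kink whose upper arc starts at the crossing. -/
structure LinkDiagram.IsKinked : Prop where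
  cup : ∀ k i g d, D.word[k + 1]? = some ⟨i, .cup g d⟩ →
    ∃ j x, D.word[k + 2]? = some ⟨j, .cross x⟩ ∧ (j + 1 = i ∨ j = i + 1)
  cap : ∀ k i, D.word[k]? = some ⟨i, .cap⟩ →
    ∃ k', k = k' + 1 ∧ D.word[k']? = some ⟨i, .cross (D.upAt (k, i))⟩

variable {D}

/-- Induction on the level: a point either continues a strand from below or belongs to a new
minimum. In the latter case the next slice is a crossing of one of its legs with a strand that is
already connected to the bottom. -/
theorem LinkDiagram.IsKinked.connected_bottom (h : D.IsKinked) (k p : ℕ) (hk : k + 1 ≤ D.word.length)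
    (hp : p < (D.state (k + 1)).length) : Relation.EqvGen D.Touch (k + 1, p) (1, 0) := by
  induction k generalizing p with
  | zero =>
    rcases D.touch_down 0 p (by omega) hp with ⟨p', h1, -⟩ | ⟨g, d, i, h1, h2⟩
    · simp [Diagram.state_zero] at h1
    · have := D.apply_state 0 _ h1
      obtain rfl : i = 0 := by
        simp only [Slice.apply, Diagram.state_zero] at this
        split at this <;> simp_all
      rcases h2 with rfl | rfl
      · exact .refl _
      · exact .symm _ _ (.rel _ _ (.strand _ _ (.cup 0 0 g d h1)))
  | succ k ih =>
    have hdown : ∀ p, (∃ p' < (D.state (k + 1)).length, D.Touch (k + 1, p') (k + 2, p)) →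
        Relation.EqvGen D.Touch (k + 2, p) (1, 0) := by
      rintro p ⟨p', h1, h2⟩
      exact .trans _ _ _ (.symm _ _ (.rel _ _ h2)) (ih p' (by omega) h1)
    rcases D.touch_down (k + 1) p (by omega) hp with h1 | ⟨g, d, i, h1, h2⟩
    · exact hdown p h1
    · obtain ⟨j, x, h3, h4⟩ := h.cup k i g d h1
      have hj : j + 1 < (D.state (k + 2)).length := by
        obtain ⟨su, si, so, sv, e1, e2, hpos, hi, ho, -, -, -, h5⟩ :=
          apply_eq_some _ _ _ (D.apply_state (k + 2) _ h3)
        simp only [Piece.inWidth] at hi hpos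
        rw [e1]
        simp
        omega
      have hn : ∀ p, p < (D.state (k + 2)).length → p ≠ i → p ≠ i + 1 →
          Relation.EqvGen D.Touch (k + 2, p) (1, 0) := by
        intro p hp h5 h6
        refine hdown p ((D.touch_down (k + 1) p (by omega) hp).resolve_right ?_)
        rintro ⟨g', d', i', h7, h8⟩
        rw [h1] at h7
        simp only [Option.some.injEq, Slice.mk.injEq] at h7
        omega
      have hcup : Relation.EqvGen D.Touch (k + 2, i) (k + 2, i + 1) :=
        .rel _ _ (.strand _ _ (.cup (k + 1) i g d h1))
      have hcr : Relation.EqvGen D.Touch (k + 2, j) (k + 2, j + 1) :=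
        .rel _ _ (.crossPoint (k + 2) j x h3)
      have hi : Relation.EqvGen D.Touch (k + 2, i) (1, 0) := by
        rcases h4 with rfl | rfl
        · exact .trans _ _ _ (.symm _ _ hcr) (hn j (by omega) (by omega) (by omega))
        · exact .trans _ _ _ hcup (.trans _ _ _ hcr (hn _ hj (by omega) (by omega)))
      rcases h2 with rfl | rfl
      · exact hi
      · exact .trans _ _ _ (.symm _ _ hcup) hi

/-- Follows the arc against its orientation. Going up, this ends at an undercrossing or at a
maximum, whose kink provides the start; going down, it ends at an undercrossing or turns at a
minimum onto a leg that leads up. -/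
theorem LinkDiagram.IsKinked.exists_start (h : D.IsKinked) (q : ℕ × ℕ) (hq : D.IsPoint q) :
    ∃ c : D.Crossing, startArc c = D.arc q := by
  have hdown : ∀ m k p, k + m = D.word.length → (D.state k)[p]?.map Prod.snd = some false →
      ∃ c : D.Crossing, startArc c = D.arc (k, p) := by
    intro m
    induction m with
    | zero =>
      intro k p hk hp
      obtain rfl : k = D.word.length := by omega
      simp [Diagram.state_length] at hp
    | succ m ih =>
      intro k p hk hp
      have hpl : p < (D.state k).length := by
        by_contra h'
        simp [List.getElem?_eq_none (not_lt.1 h')] at hp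
      -- The decoration of the kink makes the incoming leg of the maximum the end of the line
      -- passing under, so the arc over the maximum starts there.
      have hcap : ∀ i, D.word[k]? = some ⟨i, .cap⟩ →
          ∃ c : D.Crossing, startArc c = D.arc (k, i) := by
        intro i hi
        obtain ⟨k', rfl, hk'⟩ := h.cap k i hi
        have hj : D.arc (k' + 1, i) = D.arc (k' + 1, i + 1) := Quot.sound (.cap _ _ hi)
        obtain ⟨c, e1, e2, e3⟩ := D.exists_crossing hk'
        obtain ⟨su, si, so, sv, s1, s2, hpos, -, -, -, -, h4, -⟩ :=
          apply_eq_some _ _ _ (D.apply_state _ _ hi)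
        obtain ⟨a, rfl⟩ := h4 rfl
        simp only at hpos
        obtain ⟨su', si', so', sv', s1', s2', hpos', -, -, -, -, -, h5⟩ :=
          apply_eq_some _ _ _ (D.apply_state _ _ hk')
        obtain ⟨x, y, rfl, rfl⟩ := h5 _ rfl
        simp only at hpos'
        have t1 : (D.state (k' + 1))[i]? = some a := by simp [s1, hpos]
        have t2 : (D.state (k' + 1))[i + 1]? = some (a.1, !a.2) := by simp [s1, hpos]
        have t1' : (D.state (k' + 1))[i]? = some y := by simp [s2', hpos']
        have t2' : (D.state (k' + 1))[i + 1]? = some x := by simp [s2', hpos']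
        have r1 : (D.state k')[i]? = some x := by simp [s1', hpos']
        have r2 : (D.state k')[i + 1]? = some y := by simp [s1', hpos']
        obtain rfl := Option.some.inj (t1.symm.trans t1')
        obtain rfl := Option.some.inj (t2.symm.trans t2')
        have hu : D.upAt (k' + 1, i) = a.2 := by simp [Diagram.upAt, t1]
        rw [hu] at e3
        refine ⟨c, ?_⟩
        obtain ⟨g, d⟩ := a
        simp only at r1 r2
        cases d
        · simp [startArc, underLow, underHigh, e1, e2, e3, Diagram.upAt, r1, hj]
        · simp [startArc, underLow, underHigh, e1, e2, e3, Diagram.upAt, r2]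
      rcases D.step_up k p (by omega) hpl with ⟨p', h1, h2⟩ | (h1 | ⟨i, h1, rfl⟩) | ⟨c, h1, h2, h3⟩
      · obtain ⟨c, hc⟩ := ih (k + 1) p' (by omega) (by rw [h2, hp])
        exact ⟨c, hc.trans (Quot.sound h1).symm⟩
      · exact hcap p h1
      · obtain ⟨c, hc⟩ := hcap i h1
        exact ⟨c, hc.trans (Quot.sound (.cap _ _ h1))⟩
      · refine ⟨c, ?_⟩
        have : D.upAt (k, p) = false := by simp only [Diagram.upAt, hp]; rfl
        simp [startArc, h1, this]
  have hup : ∀ k p, k ≤ D.word.length → (D.state k)[p]?.map Prod.snd = some true →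
      ∃ c : D.Crossing, startArc c = D.arc (k, p) := by
    intro k
    induction k with
    | zero => intro p _ hp; simp [Diagram.state_zero] at hp
    | succ k ih =>
      intro p hk hp
      have hpl : p < (D.state (k + 1)).length := by
        by_contra h'
        simp [List.getElem?_eq_none (not_lt.1 h')] at hp
      rcases D.step_down k p (by omega) hpl with ⟨p', h1, h2⟩ | ⟨g, d, i, h1, h2⟩ | ⟨c, h1, h2, h3⟩
      · obtain ⟨c, hc⟩ := ih p' (by omega) (by rw [← h2, hp])
        exact ⟨c, hc.trans (Quot.sound h1)⟩
      · have hj : D.arc (k + 1, i) = D.arc (k + 1, i + 1) := Quot.sound (.cup _ _ _ _ h1)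
        obtain ⟨su, si, so, sv, s1, s2, hpos, -, -, -, h3, -, -⟩ :=
          apply_eq_some _ _ _ (D.apply_state _ _ h1)
        obtain rfl := h3 g d rfl
        simp only at hpos
        have t1 : (D.state (k + 1))[i]? = some (g, d) := by simp [s2, hpos]
        have t2 : (D.state (k + 1))[i + 1]? = some (g, !d) := by simp [s2, hpos]
        obtain ⟨m, hm⟩ := Nat.exists_eq_add_of_le hk
        rcases h2 with rfl | rfl
        · obtain ⟨c, hc⟩ := hdown m (k + 1) (p + 1) hm.symm (by
            rw [t1] at hp
            obtain rfl : d = true := by simpa using hp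
            simp [t2])
          exact ⟨c, hc.trans hj.symm⟩
        · obtain ⟨c, hc⟩ := hdown m (k + 1) i hm.symm (by
            rw [t2] at hp
            obtain rfl : d = false := by simpa using hp
            simp [t1])
          exact ⟨c, hc.trans hj⟩
      · refine ⟨c, ?_⟩
        have : D.upAt (underLow c) = true := by
          have e : underLow c = (k, (underLow c).2) := Prod.ext h2 rfl
          rw [e, Diagram.upAt]
          simp only
          rw [← h3, hp]
          rfl
        simp [startArc, this, h1]
  obtain ⟨k, p⟩ := q
  obtain ⟨hk, hp⟩ := hq
  simp only at hk hp
  obtain ⟨m, hm⟩ := Nat.exists_eq_add_of_le hk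
  cases hd : ((D.state k)[p]).2
  · exact hdown m k p hm.symm (by simp [hp, hd])
  · exact hup k p hk (by simp [hp, hd])

theorem LinkDiagram.IsKinked.admissible (h : D.IsKinked) : D.Admissible where
  connected := by
    have key : ∀ q, D.IsPoint q → Relation.EqvGen D.Touch q (1, 0) := by
      rintro ⟨_ | k, p⟩ ⟨hk, hp⟩
      · simp [Diagram.state_zero] at hp
      · exact h.connected_bottom k p hk hp
    exact fun q r hq hr => .trans _ _ _ (key q hq) (.symm _ _ (key r hr))
  start := h.exists_start

end Admissible
end Conway

namespace Conway

/-! ### Every link has a kinked diagram. -/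

section Normalise
variable {n : ℕ}

/-- The link presented by a word, if it is a diagram. -/
noncomputable def linkOf (w : List (Slice n Bool)) : Option (Link n) :=
  open Classical in if h : w ≠ [] ∧ run w [] = some [] then some (Link.mk ⟨w, h.1, h.2⟩) else none

/-- Two words present the same links when they are stacked on a word ending with `s`. -/
def SameLink (s : List (Strand n)) (w w' : List (Slice n Bool)) : Prop :=
  ∀ u, run u [] = some s → linkOf (u ++ w) = linkOf (u ++ w')

theorem SameLink.refl (s : List (Strand n)) (w : List (Slice n Bool)) : SameLink s w w :=
  fun _ _ => rfl

theorem SameLink.symm {s : List (Strand n)} {w w' : List (Slice n Bool)} (h : SameLink s w w') :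
    SameLink s w' w := fun u hu => (h u hu).symm

theorem SameLink.trans {s : List (Strand n)} {w w' w'' : List (Slice n Bool)}
    (h : SameLink s w w') (h' : SameLink s w' w'') : SameLink s w w'' :=
  fun u hu => (h u hu).trans (h' u hu)

theorem SameLink.cons {s t : List (Strand n)} {c : Slice n Bool} (hc : c.apply s = some t)
    {w w' : List (Slice n Bool)} (h : SameLink t w w') : SameLink s (c :: w) (c :: w') := by
  intro u hu
  have := h (u ++ [c]) (by simp [run_append, hu, run, hc])
  simpa using this

/-- A nonempty level `s` forces a nonempty word below it, so the diagram stays nonempty even if the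
move deletes everything above. -/
theorem SameLink.of_move {s t : List (Strand n)} {l r : List (Slice n Bool)} (hs : s ≠ [])
    (h : Move l r) (hl : run l s = some t) (hr : run r s = some t) (w : List (Slice n Bool)) :
    SameLink s (l ++ w) (r ++ w) := by
  intro u hu
  have hu' : u ≠ [] := by
    rintro rfl
    simp [run] at hu
    exact hs hu
  have hrun : run (u ++ (l ++ w)) [] = run (u ++ (r ++ w)) [] := by
    simp [run_append, hu, hl, hr]
  unfold linkOf
  by_cases hc : run (u ++ (l ++ w)) [] = some []
  · have hc' := hrun ▸ hc
    rw [dif_pos ⟨by simp [hu'], hc⟩, dif_pos ⟨by simp [hu'], hc'⟩]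
    exact congrArg some (Quot.sound ⟨u, w, l, r, h, by simp, by simp⟩)
  · have hc' := hrun ▸ hc
    rw [dif_neg fun h => hc h.2, dif_neg fun h => hc' h.2]

/-- The words from `s` to the empty level which do not meet the empty level before the end. -/
inductive Tight : List (Strand n) → List (Slice n Bool) → Prop
  | last (c : Slice n Bool) (s : List (Strand n)) (h : c.apply s = some []) : Tight s [c]
  | cons (c : Slice n Bool) (s t : List (Strand n)) (w : List (Slice n Bool))
      (h : c.apply s = some t) (ht : t ≠ []) (hw : Tight t w) : Tight s (c :: w)

theorem eq_cap_of_apply {c : Slice n Bool} {s : List (Strand n)} (h : c.apply s = some []) :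
    ∃ x : Strand n, c = ⟨0, .cap⟩ ∧ s = [x, (x.1, !x.2)] := by
  obtain ⟨su, si, so, sv, rfl, h2, hp, hi, ho, -, -, h4, -⟩ := apply_eq_some _ _ _ h
  simp only [List.nil_eq, List.append_eq_nil_iff] at h2
  obtain ⟨rfl, rfl, rfl⟩ := h2
  obtain ⟨i, ⟨g, d⟩ | _ | x⟩ := c <;> simp [Piece.outWidth] at ho
  obtain ⟨x, rfl⟩ := h4 rfl
  exact ⟨x, by simpa using hp.symm, by simp⟩

theorem eq_cup_of_apply {c : Slice n Bool} {t : List (Strand n)} (h : c.apply [] = some t) :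
    ∃ g d, c = ⟨0, .cup g d⟩ ∧ t = [(g, d), (g, !d)] := by
  obtain ⟨su, si, so, sv, h1, rfl, hp, hi, ho, -, h3, -, -⟩ := apply_eq_some _ _ _ h
  simp only [List.nil_eq, List.append_eq_nil_iff] at h1
  obtain ⟨rfl, rfl, rfl⟩ := h1
  obtain ⟨i, ⟨g, d⟩ | _ | x⟩ := c <;> simp [Piece.inWidth] at hi
  exact ⟨g, d, by simpa using hp.symm, by simp [h3 g d rfl]⟩

/-- An intermediate empty level lies between a maximum and a minimum. A far commutation raises the
next component beside the previous one, creating the minimum before the maximum is closed. -/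
theorem exists_tight (w : List (Slice n Bool)) (s : List (Strand n)) (h : run w s = some [])
    (hw : w ≠ []) : ∃ w', Tight s w' ∧ SameLink s w w' := by
  induction w generalizing s with
  | nil => exact absurd rfl hw
  | cons c w ih =>
    simp only [run, Option.bind_eq_some_iff] at h
    obtain ⟨t, hc, hw⟩ := h
    by_cases hwn : w = []
    · subst hwn
      obtain rfl := Option.some.inj hw
      exact ⟨_, .last c s hc, .refl _ _⟩
    · obtain ⟨w', h1, h2⟩ := ih t hw hwn
      by_cases ht : t = []
      · subst ht
        obtain ⟨x, rfl, rfl⟩ := eq_cap_of_apply hc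
        cases h1 with
        | last c' _ h =>
          obtain ⟨x, -, h⟩ := eq_cap_of_apply h
          simp at h
        | cons c' _ t' w'' h ht' hw'' =>
          obtain ⟨g, d, rfl, rfl⟩ := eq_cup_of_apply h
          have e1 : Slice.apply (X := Bool) ⟨2, .cup g d⟩ [x, (x.1, !x.2)] =
              some [x, (x.1, !x.2), (g, d), (g, !d)] := by simp [Slice.apply]
          have e2 : Slice.apply (X := Bool) ⟨0, .cap⟩ [x, (x.1, !x.2), (g, d), (g, !d)] =
              some [(g, d), (g, !d)] := by simp [Slice.apply]
          refine ⟨⟨2, .cup g d⟩ :: ⟨0, .cap⟩ :: w'',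
            .cons _ _ _ _ e1 (by simp) (.cons _ _ _ _ e2 (by simp) hw''), ?_⟩
          refine (h2.cons hc).trans ?_
          exact SameLink.of_move (by simp) (.far 0 0 .cap (.cup g d))
            (by simp only [run, hc, h, Option.bind_some, Piece.outWidth]; rfl)
            (by simp only [Piece.inWidth, run]; rw [e1]; simp only [Option.bind_some]; rw [e2]; rfl) _
      · exact ⟨_, .cons c s t w' hc ht h1, h2.cons hc⟩

/-- The words in which every minimum is followed by a crossing with a neighbouring strand and every
maximum is preceded by a kink whose upper arc starts at the crossing. -/
inductive Kinked : List (Strand n) → List (Slice n Bool) → Prop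
  | nil : Kinked [] []
  | cross (i : ℕ) (x : Bool) (s t : List (Strand n)) (w : List (Slice n Bool))
      (h : Slice.apply ⟨i, .cross x⟩ s = some t) (hw : Kinked t w) :
      Kinked s (⟨i, .cross x⟩ :: w)
  | cup (i j : ℕ) (g : Fin n) (d x : Bool) (s t u : List (Strand n)) (w : List (Slice n Bool))
      (h : Slice.apply (X := Bool) ⟨i, .cup g d⟩ s = some t)
      (h' : Slice.apply ⟨j, .cross x⟩ t = some u) (hij : j + 1 = i ∨ j = i + 1) (hw : Kinked u w) :
      Kinked s (⟨i, .cup g d⟩ :: ⟨j, .cross x⟩ :: w)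
  | cap (i : ℕ) (a : Strand n) (s t u : List (Strand n)) (w : List (Slice n Bool))
      (h : Slice.apply ⟨i, .cross a.2⟩ s = some t) (h' : Slice.apply (X := Bool) ⟨i, .cap⟩ t = some u)
      (ha : t[i]? = some a) (hw : Kinked u w) :
      Kinked s (⟨i, .cross a.2⟩ :: ⟨i, .cap⟩ :: w)

theorem Kinked.run_eq {s : List (Strand n)} {w : List (Slice n Bool)} (h : Kinked s w) :
    run w s = some [] := by
  induction h with
  | nil => rfl
  | cross i x s t w h hw ih => simpa [run, h] using ih
  | cup i j g d x s t u w h h' hij hw ih => simpa [run, h, h'] using ih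
  | cap i a s t u w h h' ha hw ih => simpa [run, h, h'] using ih

theorem Kinked.cup_getElem {s : List (Strand n)} {w : List (Slice n Bool)} (h : Kinked s w)
    (k i : ℕ) (g : Fin n) (d : Bool) (hk : w[k]? = some ⟨i, .cup g d⟩) :
    ∃ j x, w[k + 1]? = some ⟨j, .cross x⟩ ∧ (j + 1 = i ∨ j = i + 1) := by
  induction h generalizing k with
  | nil => simp at hk
  | cross i x s t w h hw ih =>
    cases k with
    | zero => simp at hk
    | succ k => exact ih k hk
  | cup i j g d x s t u w h h' hij hw ih =>
    match k with
    | 0 =>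
      simp at hk
      exact ⟨j, x, rfl, by omega⟩
    | 1 => simp at hk
    | k + 2 => exact ih k hk
  | cap i a s t u w h h' ha hw ih =>
    match k with
    | 0 => simp at hk
    | 1 => simp at hk
    | k + 2 => exact ih k hk

theorem Kinked.cap_getElem {s : List (Strand n)} {w : List (Slice n Bool)} (h : Kinked s w)
    (k i : ℕ) (hk : w[k]? = some ⟨i, .cap⟩) :
    ∃ k' t a, k = k' + 1 ∧ w[k']? = some ⟨i, .cross a.2⟩ ∧ run (w.take k) s = some t ∧
      t[i]? = some a := by
  induction h generalizing k with
  | nil => simp at hk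
  | cross j x s t w h hw ih =>
    cases k with
    | zero => simp at hk
    | succ k =>
      obtain ⟨k', t, a, rfl, h1, h2, h3⟩ := ih k hk
      exact ⟨k' + 1, t, a, rfl, h1, by simpa [run, h] using h2, h3⟩
  | cup j j' g d x s t u w h h' hij hw ih =>
    match k with
    | 0 => simp at hk
    | 1 => simp at hk
    | k + 2 =>
      obtain ⟨k', t, a, rfl, h1, h2, h3⟩ := ih k hk
      exact ⟨k' + 2, t, a, rfl, h1, by simpa [run, h, h'] using h2, h3⟩
  | cap j a s t u w h h' ha hw ih =>
    match k with
    | 0 => simp at hk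
    | 1 =>
      simp at hk
      subst hk
      exact ⟨0, t, a, rfl, rfl, by simp [run, h], ha⟩
    | k + 2 =>
      obtain ⟨k', t, a, rfl, h1, h2, h3⟩ := ih k hk
      exact ⟨k' + 2, t, a, rfl, h1, by simpa [run, h, h'] using h2, h3⟩

/-- A kink is added below the maximum by the first Reidemeister move, which allows both decorations.
-/
theorem Kinked.exists_cap {s t : List (Strand n)} {i : ℕ} {w w' : List (Slice n Bool)}
    (h : Slice.apply (X := Bool) ⟨i, .cap⟩ s = some t) (hw : Kinked t w') (hs : SameLink t w w') :
    ∃ w', Kinked s w' ∧ SameLink s (⟨i, .cap⟩ :: w) w' := by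
  obtain ⟨su, si, so, sv, rfl, rfl, rfl, -, ho, -, -, h4, -⟩ := apply_eq_some _ _ _ h
  obtain ⟨x, rfl⟩ := h4 rfl
  obtain rfl := List.length_eq_zero_iff.1 ho
  simp only [List.cons_append, List.nil_append] at *
  have e1 := fun u : Bool => apply_cross su sv x (x.1, !x.2) u
  have e2 : Slice.apply (X := Bool) ⟨su.length, .cap⟩ (su ++ (x.1, !x.2) :: x :: sv) =
      some (su ++ sv) := by simp [Slice.apply]
  -- The kink swaps the legs, so above it the left leg is `(x.1, !x.2)` and its direction dictates
  -- the decoration.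
  refine ⟨_, .cap su.length (x.1, !x.2) _ _ _ _ (e1 _) e2 (by simp) hw, (hs.cons h).trans ?_⟩
  exact (SameLink.of_move (t := su ++ sv) (by simp) (.kinkCap _ _) (by simp [run, e1, e2])
    (by simp [run, h]) _).symm

/-- Two cancelling crossings tie the minimum to a neighbouring strand; a neighbour exists because
the level below is not empty. -/
theorem Kinked.exists_cup {s t : List (Strand n)} {i : ℕ} {g : Fin n} {d : Bool}
    {w w' : List (Slice n Bool)} (hs : s ≠ [])
    (h : Slice.apply (X := Bool) ⟨i, .cup g d⟩ s = some t) (hw : Kinked t w')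
    (h' : SameLink t w w') : ∃ w', Kinked s w' ∧ SameLink s (⟨i, .cup g d⟩ :: w) w' := by
  obtain ⟨su, si, so, sv, rfl, rfl, hi, hl, -, -, h3, -, -⟩ := apply_eq_some _ _ _ h
  obtain rfl := h3 g d rfl
  obtain rfl := List.length_eq_zero_iff.1 hl
  have key : ∃ j u, (j + 1 = i ∨ j = i + 1) ∧
      (∀ x : Bool, Slice.apply ⟨j, .cross x⟩ (su ++ ([(g, d), (g, !d)] ++ sv)) = some u) ∧
      ∀ x : Bool, Slice.apply ⟨j, .cross x⟩ u = some (su ++ ([(g, d), (g, !d)] ++ sv)) := by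
    rcases List.eq_nil_or_concat su with rfl | ⟨su', y, rfl⟩
    · cases sv with
      | nil => simp at hs
      | cons y sv =>
        refine ⟨1, [(g, d)] ++ y :: (g, !d) :: sv, Or.inr (by simpa using hi.symm), fun x => ?_, fun x => ?_⟩
        · simpa using apply_cross [(g, d)] sv (g, !d) y x
        · simpa using apply_cross [(g, d)] sv y (g, !d) x
    · refine ⟨su'.length, su' ++ (g, d) :: y :: (g, !d) :: sv, Or.inl (by simpa using hi), fun x => ?_, fun x => ?_⟩
      · simpa using apply_cross su' ((g, !d) :: sv) y (g, d) x
      · simpa using apply_cross su' ((g, !d) :: sv) (g, d) y x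
  obtain ⟨j, u, hij, e1, e2⟩ := key
  refine ⟨_, .cup i j g d true _ _ _ _ h (e1 _) hij (.cross j false _ _ _ (e2 _) hw),
    (h'.cons h).trans (SameLink.cons h ?_)⟩
  exact (SameLink.of_move (by simp) (.cancel j true)
    (by rw [run, e1, Option.bind_some, run, e2]; rfl) rfl _).symm

theorem Tight.exists_kinked {s : List (Strand n)} {w : List (Slice n Bool)} (h : Tight s w)
    (hs : s ≠ []) : ∃ w', Kinked s w' ∧ SameLink s w w' := by
  induction h with
  | last c s h =>
    obtain ⟨x, rfl, rfl⟩ := eq_cap_of_apply h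
    exact Kinked.exists_cap h .nil (.refl _ _)
  | cons c s t w h ht hw ih =>
    obtain ⟨w', h1, h2⟩ := ih ht
    obtain ⟨i, ⟨g, d⟩ | _ | x⟩ := c
    · exact Kinked.exists_cup hs h h1 h2
    · exact Kinked.exists_cap h h1 h2
    · exact ⟨_, .cross i x _ _ _ h h1, h2.cons h⟩

theorem Kinked.isKinked {g : Fin n} {d : Bool} {w : List (Slice n Bool)}
    (h : Kinked [(g, d), (g, !d)] w) {D : LinkDiagram n} (hD : D.word = ⟨0, .cup g d⟩ :: w) :
    D.IsKinked where
  cup k i g d hk := by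
    rw [hD] at hk ⊢
    exact h.cup_getElem k i g d hk
  cap k i hk := by
    rw [hD] at hk ⊢
    cases k with
    | zero => simp at hk
    | succ k =>
      obtain ⟨k', t, a, rfl, h1, h2, h3⟩ := h.cap_getElem k i hk
      refine ⟨k' + 1, rfl, ?_⟩
      have : D.state (k' + 1 + 1) = t := by
        rw [Diagram.state, hD, List.take_succ_cons]
        simp [run, Slice.apply, h2]
      simpa [Diagram.upAt, this, h3] using h1

theorem Link.exists_admissible (L : Link n) : ∃ D : LinkDiagram n, D.Admissible ∧ Link.mk D = L := by
  obtain ⟨D, rfl⟩ := Quot.exists_rep L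
  obtain ⟨w, h1, h2⟩ := exists_tight D.word [] D.closed D.nonempty
  have h3 : ∃ g d w', Kinked [(g, d), (g, !d)] w' ∧
      SameLink [] D.word (⟨0, .cup g d⟩ :: w') := by
    cases h1 with
    | last c _ h =>
      obtain ⟨x, -, h⟩ := eq_cap_of_apply h
      simp at h
    | cons c _ t w h ht hw =>
      obtain ⟨g, d, rfl, rfl⟩ := eq_cup_of_apply h
      obtain ⟨w', h3, h4⟩ := hw.exists_kinked ht
      exact ⟨g, d, w', h3, h2.trans (h4.cons h)⟩
  obtain ⟨g, d, w', h3, h4⟩ := h3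
  have h5 : run (⟨0, .cup g d⟩ :: w') [] = some [] := by
    simpa [run, Slice.apply] using h3.run_eq
  refine ⟨⟨_, by simp, h5⟩, (h3.isKinked rfl).admissible, ?_⟩
  have := h4 [] rfl
  rw [List.nil_append, List.nil_append, linkOf, linkOf, dif_pos ⟨D.nonempty, D.closed⟩,
    dif_pos ⟨by simp, h5⟩] at this
  exact (Option.some.inj this).symm

end Normalise
end Conway

namespace Conway

/-! ### Change of the coefficient ring. -/

section Naturality
variable {n : ℕ} {R S : Type} [CommRing R] [CommRing S] (φ : R →+* S) (s : Fin n → Rˣ)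

/-- The images of the parameters under a ring homomorphism. -/
def mapUnits (g : Fin n) : Sˣ := Units.map (φ : R →* S) (s g)

theorem map_hol (a : Strand n) : φ (hol s a) = hol (mapUnits φ s) a := by
  unfold hol mapUnits
  split <;> rfl

theorem map_hol_inv (a : Strand n) :
    φ ((hol s a)⁻¹ : Rˣ) = ((hol (mapUnits φ s) a)⁻¹ : Sˣ) := by
  unfold hol mapUnits
  split
  · simp
  · rfl

theorem map_jw (l : List (Strand n)) (σ : List Bool) : φ (jw l σ) = jw l σ := by
  induction l generalizing σ with
  | nil => simp [jw]
  | cons a l ih =>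
    cases σ with
    | nil => simp [jw]
    | cons b σ =>
      simp only [jw, map_mul, ih]
      split <;> simp

theorem map_crossKern (x : Bool) (a b : Strand n) (τ ω : List Bool) :
    φ (crossKern s x a b τ ω) = crossKern (mapUnits φ s) x a b τ ω := by
  unfold crossKern
  split <;> cases x <;> simp [map_hol, map_hol_inv]

theorem map_kern (P : Piece n Bool) (l : List (Strand n)) (τ ω : List Bool) :
    φ (kern s P l τ ω) = kern (mapUnits φ s) P l τ ω := by
  obtain ⟨g, d⟩ | _ | x := P
  · have h : φ (cupWt s g d) = cupWt (mapUnits φ s) g d := by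
      unfold cupWt mapUnits
      split
      · simp
      · rfl
    simp only [kern]
    split <;> simp [h, map_hol]
  · have h : ∀ a : Strand n, φ (capWt s a) = capWt (mapUnits φ s) a := by
      intro a
      unfold capWt mapUnits
      split <;> simp
    simp only [kern]
    split
    · split <;> simp [h, map_hol]
    · simp
  · simp only [kern]
    split
    · simp only [map_mul, map_crossKern, crossSign]
      split <;> simp
    · simp

theorem map_op (c : Slice n Bool) (st : List (Strand n)) (ψ : List Bool → R) (σ : List Bool) :
    φ (op s c st ψ σ) = op (mapUnits φ s) c st (fun τ => φ (ψ τ)) σ := by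
  unfold op
  rw [bitSum_map]
  congr 1
  funext τ
  have h : ∀ l σ, φ (jwDeg c.piece l σ) = jwDeg c.piece l σ := by
    intro l σ
    unfold jwDeg
    split
    · simp
    · exact map_jw φ l σ
  simp only [map_mul, map_kern, h]

theorem map_opW (w : List (Slice n Bool)) (st : List (Strand n)) (ψ : List Bool → R)
    (σ : List Bool) : φ (opW s w st ψ σ) = opW (mapUnits φ s) w st (fun τ => φ (ψ τ)) σ := by
  induction w generalizing st ψ with
  | nil => rfl
  | cons c w ih => simp only [opW, ih, map_op]

theorem map_cutState (g : Fin n) (d : Bool) (τ : List Bool) :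
    φ (cutState s g d τ) = cutState (mapUnits φ s) g d τ := by
  unfold cutState
  split
  · split
    · rfl
    · simp [mapUnits]
  · simp

/-- The cut value is a polynomial in the parameters and their inverses. It can be estimated in the
ring of power series and compared with the potential function in the fraction field. -/
theorem map_cutValue (w : List (Slice n Bool)) :
    φ (cutValue s w) = cutValue (mapUnits φ s) w := by
  unfold cutValue
  split
  · simp only [map_opW, map_cutState]
  · simp

end Naturality

/-! ### Double points and powers of the augmentation ideal. -/

section Filtration
variable {n : ℕ} {R : Type} [CommRing R] {s : Fin n → Rˣ} {I : Ideal R}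

theorem hol_sub_one_mem (hs : ∀ g, (s g : R) - 1 ∈ I) (a : Strand n) : (hol s a : R) - 1 ∈ I := by
  unfold hol
  split
  · have h := I.mul_mem_left (-(((s a.1)⁻¹ : Rˣ) : R)) (hs a.1)
    convert h using 1
    linear_combination (s a.1).inv_mul
  · exact hs _

theorem hol_inv_sub_one_mem (hs : ∀ g, (s g : R) - 1 ∈ I) (a : Strand n) :
    (((hol s a)⁻¹ : Rˣ) : R) - 1 ∈ I := by
  have h := I.mul_mem_left (-(((hol s a)⁻¹ : Rˣ) : R)) (hol_sub_one_mem hs a)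
  convert h using 1
  linear_combination (hol s a).inv_mul

/-- The two kinds of crossings have the same operator modulo the augmentation ideal. -/
theorem crossKern_sub_mem (hs : ∀ g, (s g : R) - 1 ∈ I) (x : Bool) (a b : Strand n)
    (τ ω : List Bool) : crossKern s x a b τ ω - crossKern s (!x) a b τ ω ∈ I := by
  suffices h : crossKern s true a b τ ω - crossKern s false a b τ ω ∈ I by
    cases x
    · simpa using I.neg_mem h
    · exact h
  have ha := hol_sub_one_mem hs a
  have hb := hol_sub_one_mem hs b
  have ha' := hol_inv_sub_one_mem hs a
  have hb' := hol_inv_sub_one_mem hs b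
  unfold crossKern
  split
  · simpa using I.sub_mem ha hb'
  · simpa using I.sub_mem ha hb
  · simpa using I.sub_mem ha' hb'
  · have h := I.mul_mem_left (((hol s a)⁻¹ : Rˣ) * (1 + hol s b) : R) hb
    simp only [if_true, Bool.false_eq_true, if_false, sub_zero]
    convert h using 1
    ring
  · have h := I.mul_mem_left (((hol s b)⁻¹ : Rˣ) * (1 + hol s a) : R) ha
    simp only [if_true, Bool.false_eq_true, if_false]
    convert h using 1
    ring
  · have h := I.sub_mem hb ha'
    simp only [if_true, Bool.false_eq_true, if_false]
    convert h using 1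
    ring
  · simp

theorem op_mem (J : Ideal R) (c : Slice n Bool) (st : List (Strand n)) {ψ : List Bool → R}
    (h : ∀ τ, ψ τ ∈ J) (σ : List Bool) : op s c st ψ σ ∈ J :=
  bitSum_mem J fun _ _ => J.mul_mem_left _ (h _)

/-- A crossing change gains one factor of `I`, since it alters the kernel only by elements of `I`.
-/
theorem op_cross_sub_mem (hs : ∀ g, (s g : R) - 1 ∈ I) (J : Ideal R) (i : ℕ) (x : Bool)
    (st : List (Strand n)) {ψ : List Bool → R} (h : ∀ τ, ψ τ ∈ J) (σ : List Bool) :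
    op s ⟨i, .cross x⟩ st ψ σ - op s ⟨i, .cross (!x)⟩ st ψ σ ∈ I * J := by
  have key : op s ⟨i, .cross x⟩ st ψ σ - op s ⟨i, .cross (!x)⟩ st ψ σ = bitSum 2 fun τ =>
      (kern s (.cross x) (st.drop i) τ ((σ.drop i).take 2) -
        kern s (.cross (!x)) (st.drop i) τ ((σ.drop i).take 2)) *
          ψ (σ.take i ++ τ ++ σ.drop (i + 2)) := by
    rw [sub_eq_iff_eq_add]
    unfold op
    simp only [Piece.inWidth, Piece.outWidth]
    rw [← bitSum_add]
    congr 1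
    funext τ
    simp only [jwDeg, Piece.crossType, Option.isSome_some, if_true]
    ring
  rw [key]
  refine bitSum_mem _ fun τ _ => Ideal.mul_mem_mul ?_ (h _)
  simp only [kern]
  split
  · rw [← mul_sub]
    exact I.mul_mem_left _ (crossKern_sub_mem hs _ _ _ _ _)
  · simp

/-- The double points of a singular word whose slices are numbered from `k` on. -/
def doublesFrom : ℕ → List (Slice n (Option Bool)) → Finset ℕ
  | _, [] => ∅
  | k, c :: w => if c.piece.crossType = some none then insert k (doublesFrom (k + 1) w)
      else doublesFrom (k + 1) w

theorem le_of_mem_doublesFrom (k : ℕ) (w : List (Slice n (Option Bool))) (j : ℕ)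
    (h : j ∈ doublesFrom k w) : k ≤ j := by
  induction w generalizing k with
  | nil => simp [doublesFrom] at h
  | cons c w ih =>
    simp only [doublesFrom] at h
    split at h
    · rcases Finset.mem_insert.1 h with rfl | h
      · exact le_rfl
      · have := ih _ h; omega
    · have := ih _ h; omega

/-- A resolution of a singular word whose slices are numbered from `k` on. The crossings `true` are
positive where `e` is true. -/
def resolveFrom (e : ℕ → Slice n (Option Bool) → Bool) (P : Finset ℕ) :
    ℕ → List (Slice n (Option Bool)) → List (Slice n Bool)
  | _, [] => []
  | k, c :: w => ⟨c.pos, c.piece.map fun x => x.getD (e k c == decide (k ∈ P))⟩ ::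
      resolveFrom e P (k + 1) w

theorem resolveFrom_insert (e : ℕ → Slice n (Option Bool) → Bool) (P : Finset ℕ) (j k : ℕ)
    (hj : j < k) (w : List (Slice n (Option Bool))) :
    resolveFrom e (insert j P) k w = resolveFrom e P k w := by
  induction w generalizing k with
  | nil => rfl
  | cons c w ih =>
    have : k ≠ j := by omega
    simp [resolveFrom, ih (k + 1) (by omega), this]

/-- The alternating sum of the resolutions of a singular word with `k` double points lies in the
`k`-th power of the augmentation ideal. -/
theorem sum_resolveFrom_mem (hs : ∀ g, (s g : R) - 1 ∈ I)
    (e : ℕ → Slice n (Option Bool) → Bool) (w : List (Slice n (Option Bool))) (k : ℕ)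
    (st : List (Strand n)) (J : Ideal R) (ψ : List Bool → R) (hψ : ∀ τ, ψ τ ∈ J) (σ : List Bool) :
    ∑ P ∈ (doublesFrom k w).powerset, ((-1 : ℤ) ^ (doublesFrom k w \ P).card) •
      opW s (resolveFrom e P k w) st ψ σ ∈ I ^ (doublesFrom k w).card * J := by
  induction w generalizing k st J ψ with
  | nil => simpa [doublesFrom, resolveFrom, opW] using hψ σ
  | cons c w ih =>
    by_cases hc : c.piece.crossType = some none
    · obtain ⟨i, ⟨g, d⟩ | _ | x⟩ := c <;> simp [Piece.crossType] at hc
      subst hc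
      have hk : k ∉ doublesFrom (k + 1) w := fun h => by
        have := le_of_mem_doublesFrom _ _ _ h
        omega
      have hd : doublesFrom k ((⟨i, .cross none⟩ : Slice n (Option Bool)) :: w) =
          insert k (doublesFrom (k + 1) w) := by simp [doublesFrom, Piece.crossType]
      rw [hd, Finset.sum_powerset_insert hk, ← Finset.sum_add_distrib, Finset.card_insert_of_notMem hk,
        pow_succ, mul_assoc]
      -- The two resolutions at `k` are subtracted before the rest of the word is applied; the
      -- difference takes values in `I * J`, which replaces `J` in the induction.
      refine Set.mem_of_eq_of_mem ?_ (ih (k + 1)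
        ((Slice.apply (⟨i, .cross none⟩ : Slice n (Option Bool)) st).getD []) (I * J)
        (fun τ => op s ⟨i, .cross (e k ⟨i, .cross none⟩)⟩ st ψ τ -
          op s ⟨i, .cross (!e k ⟨i, .cross none⟩)⟩ st ψ τ) (op_cross_sub_mem hs J _ _ _ hψ))
      refine Finset.sum_congr rfl fun P hP => ?_
      rw [Finset.mem_powerset] at hP
      have hkP : k ∉ P := fun h => hk (hP h)
      have h1 : (insert k (doublesFrom (k + 1) w) \ P).card =
          (doublesFrom (k + 1) w \ P).card + 1 := by
        rw [Finset.insert_sdiff_of_notMem _ hkP, Finset.card_insert_of_notMem]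
        simp [hk]
      have h2 : insert k (doublesFrom (k + 1) w) \ insert k P = doublesFrom (k + 1) w \ P := by
        ext j
        simp only [Finset.mem_sdiff, Finset.mem_insert]
        constructor
        · tauto
        · rintro ⟨h, h'⟩
          exact ⟨Or.inr h, by rintro (rfl | h''); exacts [hk h, h' h'']⟩
      have h3 : ∀ x : Bool, Slice.apply (⟨i, .cross x⟩ : Slice n Bool) st =
          Slice.apply (⟨i, .cross none⟩ : Slice n (Option Bool)) st := fun x => rfl
      have h5 : ∀ b : Bool, (b == true) = b := by decide
      have h6 : ∀ b : Bool, (b == false) = !b := by decide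
      rw [h1, h2, pow_succ]
      simp only [resolveFrom, h5, h6, opW, Piece.map, Option.getD_none, hkP, Finset.mem_insert_self,
        decide_true, decide_false, h3, resolveFrom_insert e P k (k + 1) (by omega)]
      have h4 : (fun τ => op s ⟨i, .cross (e k ⟨i, .cross none⟩)⟩ st ψ τ -
          op s ⟨i, .cross (!e k ⟨i, .cross none⟩)⟩ st ψ τ) =
          op s ⟨i, .cross (e k ⟨i, .cross none⟩)⟩ st ψ +
          (-1 : R) • op s ⟨i, .cross (!e k ⟨i, .cross none⟩)⟩ st ψ := by
        funext τ
        simp [sub_eq_add_neg]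
      rw [h4, opW_add, opW_smul]
      simp only [Pi.add_apply, Pi.smul_apply, smul_eq_mul, zsmul_eq_mul]
      push_cast
      ring
    · have hd : doublesFrom k (c :: w) = doublesFrom (k + 1) w := by simp [doublesFrom, hc]
      rw [hd]
      -- Away from double points the slice is the same in all resolutions.
      obtain ⟨c', hc'⟩ : ∃ c' : Slice n Bool, ∀ f : Bool, (⟨c.pos, c.piece.map fun x => x.getD f⟩ :
          Slice n Bool) = c' := by
        obtain ⟨i, ⟨g, d⟩ | _ | _ | x⟩ := c
        · exact ⟨⟨i, .cup g d⟩, fun _ => rfl⟩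
        · exact ⟨⟨i, .cap⟩, fun _ => rfl⟩
        · simp [Piece.crossType] at hc
        · exact ⟨⟨i, .cross x⟩, fun _ => rfl⟩
      simp only [resolveFrom, hc', opW]
      exact ih (k + 1) _ J _ (op_mem J c' st hψ)

theorem mapIdx_eq_resolveFrom (e : ℕ → Slice n (Option Bool) → Bool) (P : Finset ℕ) (j : ℕ)
    (w : List (Slice n (Option Bool))) :
    (w.mapIdx fun k c => (⟨c.pos, c.piece.map fun x => x.getD (e (j + k) c == decide (j + k ∈ P))⟩ :
      Slice n Bool)) = resolveFrom e P j w := by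
  induction w generalizing j with
  | nil => rfl
  | cons c w ih =>
    rw [List.mapIdx_cons, resolveFrom, ← ih (j + 1)]
    simp only [add_zero, List.cons.injEq, true_and]
    congr 1
    funext k c
    rw [show j + (k + 1) = j + 1 + k by omega]

theorem mem_doublesFrom (j : ℕ) (w : List (Slice n (Option Bool))) (k : ℕ) :
    k ∈ doublesFrom j w ↔ ∃ l, k = j + l ∧ (w[l]?).bind (fun c => c.piece.crossType) = some none := by
  induction w generalizing j with
  | nil => simp [doublesFrom]
  | cons c w ih =>
    have h : k ∈ doublesFrom j (c :: w) ↔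
        (k = j ∧ c.piece.crossType = some none) ∨ k ∈ doublesFrom (j + 1) w := by
      rw [doublesFrom]
      split <;> simp_all
    rw [h, ih]
    constructor
    · rintro (⟨rfl, h'⟩ | ⟨l, rfl, h'⟩)
      · exact ⟨0, rfl, by simpa using h'⟩
      · exact ⟨l + 1, by omega, by simpa using h'⟩
    · rintro ⟨_ | l, rfl, h'⟩
      · exact Or.inl ⟨rfl, by simpa using h'⟩
      · exact Or.inr ⟨l, by omega, by simpa using h'⟩

theorem Diagram.doublePoints_eq (S : SingularDiagram n) :
    S.doublePoints = doublesFrom 0 S.word := by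
  ext k
  rw [mem_doublesFrom, Diagram.doublePoints, Finset.mem_filter, Finset.mem_range]
  constructor
  · rintro ⟨-, h⟩
    exact ⟨k, by simp, h⟩
  · rintro ⟨l, rfl, h⟩
    rw [zero_add]
    refine ⟨?_, h⟩
    by_contra hl
    simp [List.getElem?_eq_none (not_lt.1 hl)] at h

theorem Diagram.resolve_word (S : SingularDiagram n) (P : Finset ℕ) :
    (S.resolve P).word = resolveFrom
      (fun k c => S.upAt (k, c.pos) == S.upAt (k, c.pos + 1)) P 0 S.word := by
  rw [← mapIdx_eq_resolveFrom]
  simp only [zero_add]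
  rfl

/-- The cut values of the resolutions of a singular diagram. -/
theorem Diagram.sum_cutValue_mem (hs : ∀ g, (s g : R) - 1 ∈ I) (S : SingularDiagram n) :
    ∃ g d, (∀ P, ∃ w, (S.resolve P).word = ⟨0, .cup g d⟩ :: w) ∧
      ∑ P ∈ S.doublePoints.powerset, ((-1 : ℤ) ^ (S.doublePoints \ P).card) •
        cutValue s (S.resolve P).word ∈ I ^ S.doublePoints.card := by
  obtain ⟨g, d, w, hw, -⟩ := S.exists_cup
  refine ⟨g, d, fun P => ⟨_, by rw [S.resolve_word, hw]; rfl⟩, ?_⟩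
  -- The bottom slice is a minimum, not a double point, so all resolutions are cut open at the same
  -- place with the same state.
  have h1 : S.doublePoints = doublesFrom 1 w := by
    rw [S.doublePoints_eq, hw]
    simp [doublesFrom, Piece.crossType]
  have h2 := sum_resolveFrom_mem hs (fun k c => S.upAt (k, c.pos) == S.upAt (k, c.pos + 1)) w 1
    [(g, d), (g, !d)] ⊤ (cutState s g d) (fun _ => trivial) []
  rw [Ideal.mul_top, ← h1] at h2
  refine Set.mem_of_eq_of_mem (Finset.sum_congr rfl fun P _ => ?_) h2
  rw [S.resolve_word, hw]
  rfl

end Filtration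
end Conway

namespace Conway

/-! ### Laurent expansions and the Vassiliev property. -/

section Series
variable {n : ℕ}

/-- Two expansions may clear denominators by different monomials; they are compared after
multiplication by both. -/
theorem isLaurentExpansion_unique {F : SeriesField n} {c c' : (Fin n → ℤ) → ℚ}
    (h : IsLaurentExpansion F c) (h' : IsLaurentExpansion F c') : c = c' := by
  obtain ⟨a, h1, h2⟩ := h
  obtain ⟨a', h1', h2'⟩ := h'
  have key : MvPowerSeries.monomial a' (1 : ℚ) *
        (show MvPowerSeries (Fin n) ℚ from fun e => c fun g => (e g : ℤ) - (a g : ℤ)) =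
      MvPowerSeries.monomial a (1 : ℚ) *
        (show MvPowerSeries (Fin n) ℚ from fun e => c' fun g => (e g : ℤ) - (a' g : ℤ)) := by
    apply IsFractionRing.injective (MvPowerSeries (Fin n) ℚ) (SeriesField n)
    rw [map_mul, map_mul, ← h2, ← h2']
    ring
  have hcoeff : ∀ (f : MvPowerSeries (Fin n) ℚ) e, MvPowerSeries.coeff e f = f e := fun _ _ => rfl
  funext p
  -- If this fails, some exponent lies below both bounds and both coefficients vanish. Otherwise `p
  -- + a + a'` is nonnegative and can be used as an exponent.
  by_cases hp : ∀ g, -(a g : ℤ) ≤ p g ∨ -(a' g : ℤ) ≤ p g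
  · have hnn : ∀ g, 0 ≤ p g + a g + a' g := fun g => by
      rcases hp g with h | h <;> omega
    have hk := congrArg (MvPowerSeries.coeff
      (Finsupp.equivFunOnFinite.symm fun g => (p g + a g + a' g).toNat)) key
    rw [MvPowerSeries.coeff_monomial_mul, MvPowerSeries.coeff_monomial_mul, one_mul, one_mul,
      hcoeff, hcoeff] at hk
    have e1 : (if a' ≤ Finsupp.equivFunOnFinite.symm fun g => (p g + a g + a' g).toNat then
        c fun g => (((Finsupp.equivFunOnFinite.symm fun g => (p g + a g + a' g).toNat) - a' :
          Fin n →₀ ℕ) g : ℤ) - (a g : ℤ) else 0) = c p := by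
      split
      · rename_i h
        congr 1
        funext g
        have := h g
        have := hnn g
        simp at *
        omega
      · rename_i h
        symm
        by_contra hc
        refine h fun g => ?_
        have := h1 p hc g
        simp
        omega
    have e2 : (if a ≤ Finsupp.equivFunOnFinite.symm fun g => (p g + a g + a' g).toNat then
        c' fun g => (((Finsupp.equivFunOnFinite.symm fun g => (p g + a g + a' g).toNat) - a :
          Fin n →₀ ℕ) g : ℤ) - (a' g : ℤ) else 0) = c' p := by
      split
      · rename_i h
        congr 1
        funext g
        have := h g
        have := hnn g
        simp at *
        omega
      · rename_i h
        symm
        by_contra hc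
        refine h fun g => ?_
        have := h1' p hc g
        simp
        omega
    rw [← e1, ← e2]
    exact hk
  · push Not at hp
    obtain ⟨g, hg, hg'⟩ := hp
    have e1 : c p = 0 := by
      by_contra h
      have := h1 p h g
      omega
    have e2 : c' p = 0 := by
      by_contra h
      have := h1' p h g
      omega
    rw [e1, e2]

theorem laurentExpansion_eq {F : SeriesField n} {c : (Fin n → ℤ) → ℚ}
    (h : IsLaurentExpansion F c) : laurentExpansion F = c :=
  isLaurentExpansion_unique (Classical.epsilon_spec ⟨c, h⟩) h

/-- The coefficients of the Laurent series `f / h_g`. -/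
noncomputable def divCoeff (g : Fin n) (f : MvPowerSeries (Fin n) ℚ) (p : Fin n → ℤ) : ℚ :=
  if ∀ i, 0 ≤ p i + (Finsupp.single g 1 : Fin n →₀ ℕ) i then
    MvPowerSeries.coeff (Finsupp.equivFunOnFinite.symm fun i =>
      (p i + (Finsupp.single g 1 : Fin n →₀ ℕ) i).toNat) f
  else 0

theorem isLaurentExpansion_divCoeff {F : SeriesField n} {g : Fin n}
    {f : MvPowerSeries (Fin n) ℚ} (h : algebraMap (MvPowerSeries (Fin n) ℚ) (SeriesField n)
      (MvPowerSeries.X g) * F = algebraMap (MvPowerSeries (Fin n) ℚ) (SeriesField n) f) :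
    IsLaurentExpansion F (divCoeff g f) := by
  refine ⟨Finsupp.single g 1, fun p hp i => ?_, ?_⟩
  · by_contra hi
    apply hp
    rw [divCoeff, if_neg]
    intro h'
    have := h' i
    omega
  · rw [show MvPowerSeries.monomial (Finsupp.single g 1) (1 : ℚ) = MvPowerSeries.X g from rfl, h]
    congr 1
    funext e
    rw [divCoeff, if_pos]
    · change f e = f _
      congr 1
      ext i
      simp
    · intro i
      omega

/-- Division by `h_g` lowers the total degree by one; this is the source of the `+ 1` in the type.
-/
theorem divCoeff_eq_zero {g : Fin n} {f : MvPowerSeries (Fin n) ℚ} {k : ℕ}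
    (hf : ∀ e : Fin n →₀ ℕ, e.degree < k → MvPowerSeries.coeff e f = 0) (p : Fin n → ℤ)
    (hp : ∑ i, p i + 1 < (k : ℤ)) : divCoeff g f p = 0 := by
  rw [divCoeff]
  split
  · rename_i h
    apply hf
    zify
    rw [Finsupp.degree_eq_sum]
    push_cast
    have : ∀ i, (((Finsupp.equivFunOnFinite.symm fun i =>
        (p i + (Finsupp.single g 1 : Fin n →₀ ℕ) i).toNat) i : ℕ) : ℤ) =
        p i + (Finsupp.single g 1 : Fin n →₀ ℕ) i := fun i => by
      simpa using h i
    rw [Finset.sum_congr rfl fun i _ => this i, Finset.sum_add_distrib]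
    have h1 : ∑ i, (((Finsupp.single g 1 : Fin n →₀ ℕ) i : ℕ) : ℤ) = 1 := by
      rw [Finset.sum_eq_single g] <;> simp +contextual [eq_comm]
    rw [h1]
    exact hp
  · rfl

theorem divCoeff_sum {ι : Type} (A : Finset ι) (g : Fin n) (ε : ι → ℤ)
    (f : ι → MvPowerSeries (Fin n) ℚ) (p : Fin n → ℤ) :
    ∑ P ∈ A, ε P • divCoeff g (f P) p = divCoeff g (∑ P ∈ A, ε P • f P) p := by
  unfold divCoeff
  split
  · rw [map_sum]
    exact Finset.sum_congr rfl fun P _ => (map_zsmul _ _ _).symm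
  · simp

/-- The ideal of power series without constant term. -/
noncomputable def augIdeal (n : ℕ) : Ideal (MvPowerSeries (Fin n) ℚ) :=
  RingHom.ker (MvPowerSeries.constantCoeff (σ := Fin n) (R := ℚ))

theorem coeff_eq_zero_of_mem_pow {k : ℕ} {f : MvPowerSeries (Fin n) ℚ} (hf : f ∈ augIdeal n ^ k)
    (e : Fin n →₀ ℕ) (he : e.degree < k) : MvPowerSeries.coeff e f = 0 := by
  suffices h : (k : ℕ∞) ≤ f.order by
    exact MvPowerSeries.coeff_of_lt_order (lt_of_lt_of_le (by exact_mod_cast he) h)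
  induction k generalizing f e with
  | zero => simp
  | succ k ih =>
    rw [pow_succ] at hf
    induction hf using Submodule.mul_induction_on' with
    | mem_mul_mem a ha b hb =>
      refine le_trans ?_ (MvPowerSeries.le_order_mul)
      push_cast
      refine add_le_add ?_ (MvPowerSeries.one_le_order_iff_constCoeff_eq_zero.2 hb)
      -- The induction hypothesis carries an irrelevant exponent of degree less than `k`. The
      -- exponent `0` supplies one when `k` is positive.
      cases k with
      | zero => simp
      | succ k => exact ih ha 0 (by simp)
    | add a _ b _ ha hb => exact le_trans (le_min ha hb) MvPowerSeries.min_order_le_add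

theorem constantCoeff_rescale_exp (a : ℚ) :
    PowerSeries.constantCoeff (PowerSeries.rescale a (PowerSeries.exp ℚ)) = 1 := by
  rw [← PowerSeries.coeff_zero_eq_constantCoeff_apply, PowerSeries.coeff_rescale]
  simp

theorem exists_subst_eq (g : Fin n) (P : PowerSeries ℚ) (a : ℚ) (h : PowerSeries.constantCoeff P = a) :
    ∃ Q : PowerSeries ℚ, PowerSeries.coeff 0 Q = PowerSeries.coeff 1 P ∧
      PowerSeries.subst (MvPowerSeries.X g : MvPowerSeries (Fin n) ℚ) P =
        MvPowerSeries.C a + MvPowerSeries.X g * PowerSeries.subst (MvPowerSeries.X g) Q := by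
  obtain ⟨Q, hQ⟩ : PowerSeries.X ∣ P - PowerSeries.C a := by
    rw [PowerSeries.X_dvd_iff]
    simp [h]
  have hs := PowerSeries.HasSubst.X (S := ℚ) g
  have hP : P = PowerSeries.C a + PowerSeries.X * Q := by rw [← hQ]; ring
  refine ⟨Q, ?_, ?_⟩
  · rw [hP]
    simp
  · rw [hP, PowerSeries.subst_add hs, PowerSeries.subst_mul hs, PowerSeries.subst_X hs,
      ← PowerSeries.coe_substAlgHom hs, PowerSeries.C_eq_algebraMap, AlgHom.commutes]
    rfl

theorem halfExp_sub_one_mem (g : Fin n) :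
    (halfExp g : MvPowerSeries (Fin n) ℚ) - 1 ∈ augIdeal n := by
  obtain ⟨Q, -, hQ⟩ := exists_subst_eq g (PowerSeries.rescale (1 / 2 : ℚ) (PowerSeries.exp ℚ)) 1
    (constantCoeff_rescale_exp _)
  have h : (halfExp g : MvPowerSeries (Fin n) ℚ) = expSeries (1 / 2) g := rfl
  rw [augIdeal, RingHom.mem_ker, h, expSeries, hQ]
  simp

/-- The series `2 sinh (h_g / 2)` has no constant term and linear coefficient one, so its quotient
by `h_g` is a unit. -/
theorem exists_halfExp_sub_inv (g : Fin n) : ∃ u : (MvPowerSeries (Fin n) ℚ)ˣ,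
    (halfExp g : MvPowerSeries (Fin n) ℚ) - ((halfExp g)⁻¹).val =
      MvPowerSeries.X g * u.val := by
  have hs := PowerSeries.HasSubst.X (S := ℚ) g
  obtain ⟨Q, h0, hQ⟩ := exists_subst_eq g (PowerSeries.rescale (1 / 2 : ℚ) (PowerSeries.exp ℚ) -
    PowerSeries.rescale (-(1 / 2) : ℚ) (PowerSeries.exp ℚ)) 0
    (by simp only [map_sub, constantCoeff_rescale_exp, sub_self])
  have hu : IsUnit (PowerSeries.subst (MvPowerSeries.X g : MvPowerSeries (Fin n) ℚ) Q) := by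
    rw [← PowerSeries.coe_substAlgHom hs]
    refine IsUnit.map _ ?_
    rw [PowerSeries.isUnit_iff_constantCoeff, ← PowerSeries.coeff_zero_eq_constantCoeff_apply, h0]
    simp [PowerSeries.coeff_rescale, PowerSeries.coeff_exp]
  refine ⟨hu.unit, ?_⟩
  have h : (halfExp g : MvPowerSeries (Fin n) ℚ) = expSeries (1 / 2) g := rfl
  have h' : ((halfExp g)⁻¹).val =
    expSeries (-(1 / 2)) g := rfl
  rw [h, h', expSeries, expSeries, IsUnit.unit_spec]
  rw [← PowerSeries.coe_substAlgHom hs] at hQ ⊢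
  rw [map_sub] at hQ
  rw [hQ]
  simp

theorem X_ne_zero (g : Fin n) : algebraMap (MvPowerSeries (Fin n) ℚ) (SeriesField n)
    (MvPowerSeries.X g) ≠ 0 := by
  intro h
  have h := (map_eq_zero_iff _ (IsFractionRing.injective (MvPowerSeries (Fin n) ℚ)
    (SeriesField n))).1 h
  have := congrArg (MvPowerSeries.coeff (Finsupp.single g 1)) h
  simp at this

theorem sqrtExp_sub_inv {g : Fin n} {u : (MvPowerSeries (Fin n) ℚ)ˣ}
    (hu : (halfExp g : MvPowerSeries (Fin n) ℚ) - ((halfExp g)⁻¹).val =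
      MvPowerSeries.X g * u.val) :
    (sqrtExp g : SeriesField n) - ((sqrtExp g)⁻¹ : (SeriesField n)ˣ) =
      algebraMap (MvPowerSeries (Fin n) ℚ) (SeriesField n) (MvPowerSeries.X g) *
        algebraMap (MvPowerSeries (Fin n) ℚ) (SeriesField n) u := by
  rw [← map_mul, ← hu, map_sub]
  rfl

theorem algebraMap_unit_ne_zero (u : (MvPowerSeries (Fin n) ℚ)ˣ) :
    algebraMap (MvPowerSeries (Fin n) ℚ) (SeriesField n) u ≠ 0 :=
  (u.isUnit.map _).ne_zero

theorem sqrtExp_sq_ne_one (g : Fin n) : (sqrtExp g : SeriesField n) ^ 2 ≠ 1 := by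
  intro h
  obtain ⟨u, hu⟩ := exists_halfExp_sub_inv g
  have h1 := sqrtExp_sub_inv hu
  have h2 : (sqrtExp g : SeriesField n) - ((sqrtExp g)⁻¹ : (SeriesField n)ˣ) = 0 := by
    have := (sqrtExp g).ne_zero
    rw [Units.val_inv_eq_inv_val]
    field_simp
    rw [h, sub_self, mul_zero]
  rw [h2] at h1
  exact mul_ne_zero (X_ne_zero g) (algebraMap_unit_ne_zero u) h1.symm

theorem LinkDiagram.Admissible.nonempty_crossing {D : LinkDiagram n} (h : D.Admissible) :
    Nonempty D.Crossing := by
  obtain ⟨g, d, w, hw, -⟩ := D.exists_cup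
  obtain ⟨c, -⟩ := h.start (1, 0) ⟨by rw [hw]; simp, by
    rw [Diagram.state, hw]
    simp [run, Slice.apply]⟩
  exact ⟨c⟩

/-- The potential function of a link can be computed from any diagram. -/
theorem conwayPotential_eq (D : LinkDiagram n) :
    conwayPotential (Link.mk D) = D.conway sqrtExp := by
  obtain ⟨E, hE, hDE⟩ := (Link.mk D).exists_admissible
  obtain ⟨c⟩ := hE.nonempty_crossing
  -- Existence of an admissible diagram with a crossing makes the choice meaningful; the chosen
  -- diagram need not be `E`, but presents the same link as `D`.
  obtain ⟨E', i, j, h1, h2, h3⟩ := Classical.epsilon_spec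
    (p := fun F : SeriesField n => ∃ (E : LinkDiagram n) (i j : E.Crossing), E.Admissible ∧
      Link.mk E = Link.mk D ∧ F = E.potential sqrtExp i j) ⟨_, E, c, c, hE, hDE, rfl⟩
  rw [conwayPotential, h3, h1.potential_eq sqrtExp_sq_ne_one,
    conway_eq_of_link sqrtExp sqrtExp_sq_ne_one E' D h2]

/-- Multiplying by `h_g` cancels all of the divisor `s g - (s g)⁻¹` except the unit `u`, and the cut
value is a power series; so the only possible pole is simple and along `h_g`. -/
theorem isLaurentExpansion_conwayPotential {g : Fin n} {u : (MvPowerSeries (Fin n) ℚ)ˣ}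
    (hu : (halfExp g : MvPowerSeries (Fin n) ℚ) - ((halfExp g)⁻¹).val =
      MvPowerSeries.X g * u.val) (D : LinkDiagram n) {d : Bool} {w : List (Slice n Bool)}
    (hw : D.word = ⟨0, .cup g d⟩ :: w) :
    IsLaurentExpansion (conwayPotential (Link.mk D))
      (divCoeff g (cutValue halfExp D.word * (u⁻¹ : (MvPowerSeries (Fin n) ℚ)ˣ))) := by
  apply isLaurentExpansion_divCoeff
  have h1 : D.conway sqrtExp = cutValue sqrtExp D.word /
      ((sqrtExp g : SeriesField n) - ((sqrtExp g)⁻¹ : (SeriesField n)ˣ)) := by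
    simp [LinkDiagram.conway, hw]
  have h2 : algebraMap (MvPowerSeries (Fin n) ℚ) (SeriesField n) (cutValue halfExp D.word) =
      cutValue sqrtExp D.word := map_cutValue _ _ _
  have h3 : algebraMap (MvPowerSeries (Fin n) ℚ) (SeriesField n) u *
      algebraMap (MvPowerSeries (Fin n) ℚ) (SeriesField n)
        (u⁻¹ : (MvPowerSeries (Fin n) ℚ)ˣ) = 1 := by
    rw [← map_mul, Units.mul_inv, map_one]
  rw [conwayPotential_eq, h1, sqrtExp_sub_inv hu, map_mul, h2, ← mul_div_assoc,
    div_eq_iff (mul_ne_zero (X_ne_zero g) (algebraMap_unit_ne_zero u))]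
  linear_combination -(cutValue sqrtExp D.word *
    algebraMap (MvPowerSeries (Fin n) ℚ) (SeriesField n) (MvPowerSeries.X g)) * h3

theorem isLaurentExpansion_laurentExpansion (L : Link n) :
    IsLaurentExpansion (conwayPotential L) (laurentExpansion (conwayPotential L)) := by
  obtain ⟨D, rfl⟩ := Quot.exists_rep L
  obtain ⟨g, d, w, hw, -⟩ := D.exists_cup
  obtain ⟨u, hu⟩ := exists_halfExp_sub_inv g
  exact Classical.epsilon_spec ⟨_, isLaurentExpansion_conwayPotential hu D hw⟩

/-- All resolutions share the label `g` of the bottom minimum, hence the unit `u`, so the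
alternating sum passes inside `divCoeff`. The sum of the numerators lies in the power of the
augmentation ideal given by the number of double points. -/
theorem isVassilievOfType_coeff (p : Fin n → ℤ) : IsVassilievOfType
    (fun L : Link n => laurentExpansion (conwayPotential L) p) ((∑ g, p g) + 1) := by
  intro S hS
  obtain ⟨g, d, hw, hmem⟩ := S.sum_cutValue_mem (s := halfExp) (I := augIdeal n) halfExp_sub_one_mem
  obtain ⟨u, hu⟩ := exists_halfExp_sub_inv g
  rw [singularExtension]
  have h1 : ∀ P, laurentExpansion (conwayPotential (Link.mk (S.resolve P))) p =
      divCoeff g (cutValue halfExp (S.resolve P).word * (u⁻¹ : (MvPowerSeries (Fin n) ℚ)ˣ)) p := by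
    intro P
    obtain ⟨w, hw⟩ := hw P
    rw [laurentExpansion_eq (isLaurentExpansion_conwayPotential hu _ hw)]
  simp only [h1]
  rw [divCoeff_sum]
  refine divCoeff_eq_zero (k := S.doublePoints.card) (fun e he => ?_) p hS
  refine coeff_eq_zero_of_mem_pow ?_ e he
  have h2 := Ideal.mul_mem_right (u⁻¹ : (MvPowerSeries (Fin n) ℚ)ˣ).val _ hmem
  rw [Finset.sum_mul] at h2
  refine Set.mem_of_eq_of_mem (Finset.sum_congr rfl fun P _ => ?_) h2
  rw [smul_mul_assoc]

/-- Alternating sums of coefficient functions are computed exponent by exponent, which reduces the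
claim to exponents of total degree `m`. -/
theorem isVassilievOfType_degreePart (m : ℤ) : IsVassilievOfType
    (fun L : Link n => degreePart m (laurentExpansion (conwayPotential L))) (m + 1) := by
  intro S hS
  funext p
  have h : singularExtension (fun L : Link n => degreePart m (laurentExpansion (conwayPotential L)))
      S p = if ∑ g, p g = m then
        singularExtension (fun L : Link n => laurentExpansion (conwayPotential L) p) S else 0 := by
    simp only [singularExtension, Finset.sum_apply, Pi.smul_apply, degreePart]
    split <;> simp
  rw [h]
  split
  · rename_i hm
    exact isVassilievOfType_coeff p S (by rw [hm]; exact hS)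
  · rfl

end Series
end Conway

theorem mainTheorem3 (n : ℕ) :
    (∀ L : Conway.Link n, ∃ D : Conway.LinkDiagram n, D.Admissible ∧ Conway.Link.mk D = L) ∧
    (∀ D : Conway.LinkDiagram n, D.Admissible → ∀ i j : D.Crossing,
      Conway.conwayPotential (Conway.Link.mk D) = D.potential Conway.sqrtExp i j) ∧
    (∀ L : Conway.Link n, Conway.IsLaurentExpansion (Conway.conwayPotential L)
      (Conway.laurentExpansion (Conway.conwayPotential L))) ∧
    (∀ p : Fin n → ℤ, Conway.IsVassilievOfType
      (fun L : Conway.Link n => Conway.laurentExpansion (Conway.conwayPotential L) p)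
      ((∑ g, p g) + 1)) ∧
    (∀ m : ℤ, Conway.IsVassilievOfType
      (fun L : Conway.Link n =>
        Conway.degreePart m (Conway.laurentExpansion (Conway.conwayPotential L)))
      (m + 1)) :=
  ⟨Conway.Link.exists_admissible,
    fun D hD i j => (Conway.conwayPotential_eq D).trans
      (hD.potential_eq Conway.sqrtExp_sq_ne_one i j).symm,
    Conway.isLaurentExpansion_laurentExpansion,
    Conway.isVassilievOfType_coeff, Conway.isVassilievOfType_degreePart⟩
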